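/- Let $\triangle$ be the triangular grid, with vertex set $\{\varphi(p):p\in\mathbb Z^3\}$, where $\varphi$ is the projection of $\mathbb R^3$ along $(1,1,1)$; its edges, in positive orientation, go from $v$ to $v+\varphi(\varepsilon_i)$, where $\varepsilon_1,\varepsilon_2,\varepsilon_3$ is the standard basis. A lozenge is the union of two triangles sharing an edge $e$; it overlaps $e$, and its orientation is the direction of $e$. A finite region $R$ is a finite set of triangles of $\triangle$, together with their edges and vertices; $|R|$ is its number of triangles, and $R$ is simply connected if the subset of the plane covered by its triangles is a simply connected space. An edge of $R$ is interior if both triangles adjacent to it are in $R$, and is a boundary edge otherwise. Let $X_1$ be a set of edges of $R$ and $X_2$ a set of interior edges of $R$. $\mathrm{Tiling}(R,X_1,X_2)$ is the problem of finding a set $T$ of lozenges contained in $R$, covering every triangle of $R$ exactly once, such that no edge of $X_1\cup X_2$ is overlapped by a lozenge of $T$ and, for every edge of $X_2$, the two lozenges of $T$ that cover its two adjacent triangles have different orientations; or of reporting that there is none. Let $DC(R,X_1,X_2)$ be the weighted directed graph on the vertices of $R$ with: an edge $u\to v$ of weight $+1$ for every edge of $R$ with positive orientation $u\to v$; an edge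 $v\to u$ of weight $-1$ whenever moreover this edge is a boundary edge or belongs to $X_1\cup X_2$; and edges $w\to w'$ and $w'\to w$ of weight $0$ for every edge $uv\in X_2$, where $w\neq w'$ are the two vertices adjacent to both $u$ and $v$. **Corollary.** For finite simply connected regions $R$, the graph $DC(R,X_1,X_2)$ has $O(|R|)$ edges, and $\mathrm{Tiling}(R,X_1,X_2)$ can be solved in time $O(|R|^2)$ by applying the Bellman–Ford algorithm to $DC(R,X_1,X_2)$. That is, there are a constant $C$ and fixed programs $\mathit{build}$ and $\mathit{extract}$ for a unit-cost random access machine (integer registers and arrays; addition, subtraction and comparison, but no multiplication) such that, on every instance given by lists of the triangles of $R$ and of the edges in $X_1$ and $X_2$, the following holds. $\mathit{build}$ writes the vertices and an edge list of $DC(R,X_1,X_2)$ into memory; then the single-source Bellman–Ford algorithm is run on this graph from one of its vertices; then $\mathit{extract}$ is run; the three take at most $C|R|^2$ steps in total. If the instance has no solution, Bellman–Ford reports a negative cycle and $\mathit{extract}$ reports unsolvability. Otherwise Bellman–Ford reports no negative cycle, the distances $h$ that it computes satisfy $h(v)-h(u)\le w$ for every edge $u\to v$ of weight $w$ of $DC(R,X_1,X_2)$,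 and $\mathit{extract}$ outputs the set of all lozenges overlapping those edges of $R$, with positive orientation $u\to v$, for which $h(v)-h(u)\neq 1$; this set is a solution. -/

import Mathlib

namespace LozengeTiling

/-! ### The triangular grid

The vertex `φ(x, y, z)` of the grid, the projection of `(x, y, z) ∈ ℤ³` along `(1, 1, 1)`, is
written in the lattice coordinates `(x - z, y - z)`. -/

/-- Vertices of the triangular grid. -/
abbrev Vertex := ℤ × ℤ

/-- The three positive directions `φ(1,0,0)`, `φ(0,1,0)`, `φ(0,0,1)`; their sum is zero. -/
def dirVec : Fin 3 → Vertex := ![(1, 0), (0, 1), (-1, -1)]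

/-- Edges of the grid: `(v, d)` is the edge joining `v` to `v + dirVec d`. Every edge is written in
exactly one way like this, namely in its positive orientation. -/
abbrev Edge := Vertex × Fin 3

def Edge.src (e : Edge) : Vertex := e.1

def Edge.tgt (e : Edge) : Vertex := e.1 + dirVec e.2

/-- Triangles of the grid: `(v, 0)` has the vertices `v`, `v + (1,0)`, `v + (1,1)`, and `(v, 1)` has
the vertices `v`, `v + (0,1)`, `v + (1,1)`. -/
abbrev Tri := Vertex × Fin 2

def Tri.verts (t : Tri) : Finset Vertex :=
  {t.1, t.1 + (if t.2 = 0 then (1, 0) else (0, 1)), t.1 + (1, 1)}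

def Tri.edges (t : Tri) : Finset Edge :=
  if t.2 = 0 then {(t.1, 0), (t.1 + (1, 0), 1), (t.1 + (1, 1), 2)}
  else {(t.1, 1), (t.1 + (0, 1), 0), (t.1 + (1, 1), 2)}

/-- Two vertices are adjacent when they are joined by an edge of the grid. -/
def Adjacent (p q : Vertex) : Prop :=
  ∃ e : Edge, (e.src = p ∧ e.tgt = q) ∨ (e.src = q ∧ e.tgt = p)

/-! ### Finite regions: the subcomplex spanned by a finite set `R` of triangles -/

/-- The vertices of the region. -/
def regionVerts (R : Finset Tri) : Finset Vertex := R.biUnion Tri.verts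

/-- The edges of the region. -/
def regionEdges (R : Finset Tri) : Finset Edge := R.biUnion Tri.edges

/-- Edges both of whose adjacent triangles lie in the region. -/
def IsInterior (R : Finset Tri) (e : Edge) : Prop := ∀ t : Tri, e ∈ t.edges → t ∈ R

/-- Edges of the region that are not interior. -/
def IsBoundary (R : Finset Tri) (e : Edge) : Prop := e ∈ regionEdges R ∧ ¬ IsInterior R e

/-- The closed triangle as a subset of the plane, in lattice coordinates (they differ from the usual
picture with equilateral triangles by a linear isomorphism). -/
def Tri.closedTriangle (t : Tri) : Set (ℝ × ℝ) :=
  convexHull ℝ ((fun v : Vertex => ((v.1 : ℝ), (v.2 : ℝ))) '' (t.verts : Set Vertex))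

/-- The subset of the plane covered by the region. -/
def carrier (R : Finset Tri) : Set (ℝ × ℝ) := ⋃ t ∈ R, t.closedTriangle

/-! ### Lozenge tilings

A lozenge is the union of two triangles that share an edge; that edge is the one which the lozenge
overlaps. We denote a lozenge by the edge it overlaps: `e : Edge` is the lozenge made of the two
triangles `t` with `e ∈ t.edges`. It is the projection of a square face of the cubic grid whose
normal direction is that of `e`, so its orientation (colour) is `e.2`. -/

/-- `T` is a set of lozenges contained in the region, and every triangle of the region is covered
by exactly one of them. -/
def IsTiling (R : Finset Tri) (T : Finset Edge) : Prop :=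
  (∀ l ∈ T, ∀ t : Tri, l ∈ t.edges → t ∈ R) ∧ ∀ t ∈ R, ∃! l : Edge, l ∈ T ∧ l ∈ t.edges

/-- `T` is a solution of `Tiling(R, X₁, X₂)`: a tiling that overlaps no edge of `X₁ ∪ X₂` and in
which, for every edge of `X₂`, the two lozenges adjacent to this edge (those that cover its two
triangles) have different orientations. -/
def IsSolution (R : Finset Tri) (X₁ X₂ T : Finset Edge) : Prop :=
  IsTiling R T ∧ (∀ e ∈ X₁ ∪ X₂, e ∉ T) ∧
  ∀ e ∈ X₂, ∀ t t' : Tri, t ≠ t' → e ∈ t.edges → e ∈ t'.edges →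
    ∀ l ∈ T, ∀ l' ∈ T, l ∈ t.edges → l' ∈ t'.edges → l.2 ≠ l'.2

/-! ### The weighted directed graph `DC(R, X₁, X₂)` -/

/-- A directed edge `(u, v, w)` goes from `u` to `v` and has weight `w`. -/
abbrev Arc := Vertex × Vertex × ℤ

/-- The directed edges of `DC(R, X₁, X₂)`; its vertices are those of `R`. -/
def dcArcs (R : Finset Tri) (X₁ X₂ : Finset Edge) : Set Arc :=
  {a | ∃ e ∈ regionEdges R, a = (e.src, e.tgt, 1)} ∪
  {a | ∃ e, (IsBoundary R e ∨ e ∈ X₁ ∨ e ∈ X₂) ∧ a = (e.tgt, e.src, -1)} ∪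
  {a | ∃ e ∈ X₂, ∃ w w' : Vertex, w ≠ w' ∧
    Adjacent w e.src ∧ Adjacent w e.tgt ∧ Adjacent w' e.src ∧ Adjacent w' e.tgt ∧
    a = (w, w', 0)}

/-! ### Machine model

A random access machine with unit costs and without multiplication. Its programs are structured;
the memory consists of integer registers and integer arrays, and a program mentions only finitely
many of them. Every constant, register access, array access, addition, subtraction, comparison,
assignment and test costs one step. -/

structure Store where
  var : ℕ → ℤ
  arr : ℕ → ℤ → ℤ

inductive Expr where
  | const (k : ℤ)
  | var (x : ℕ)
  | read (a : ℕ) (i : Expr)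
  | add (e f : Expr)
  | sub (e f : Expr)
  | lt (e f : Expr)
  | eq (e f : Expr)

/-- The value of an expression; truth values are `1` and `0`. -/
def Expr.eval (s : Store) : Expr → ℤ
  | const k => k
  | var x => s.var x
  | read a i => s.arr a (i.eval s)
  | add e f => e.eval s + f.eval s
  | sub e f => e.eval s - f.eval s
  | lt e f => if e.eval s < f.eval s then 1 else 0
  | eq e f => if e.eval s = f.eval s then 1 else 0

/-- The number of steps that the evaluation takes. -/
def Expr.cost : Expr → ℕ
  | const _ => 1
  | var _ => 1
  | read _ i => i.cost + 1
  | add e f => e.cost + f.cost + 1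
  | sub e f => e.cost + f.cost + 1
  | lt e f => e.cost + f.cost + 1
  | eq e f => e.cost + f.cost + 1

inductive Cmd where
  | skip
  | assign (x : ℕ) (e : Expr)
  | write (a : ℕ) (i e : Expr)
  | seq (c d : Cmd)
  | ite (b : Expr) (c d : Cmd)
  | loop (b : Expr) (c : Cmd)

def Store.setVar (s : Store) (x : ℕ) (k : ℤ) : Store :=
  { s with var := Function.update s.var x k }

def Store.setArr (s : Store) (a : ℕ) (i k : ℤ) : Store :=
  { s with arr := Function.update s.arr a (Function.update (s.arr a) i k) }

/-- `Run c s n s'`: started in `s`, the program `c` halts in `s'` after exactly `n` steps.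
`Cmd.loop b c` is the loop "while `b ≠ 0` do `c`". -/
inductive Run : Cmd → Store → ℕ → Store → Prop where
  | skip (s : Store) : Run .skip s 1 s
  | assign (x : ℕ) (e : Expr) (s : Store) :
      Run (.assign x e) s (e.cost + 1) (s.setVar x (e.eval s))
  | write (a : ℕ) (i e : Expr) (s : Store) :
      Run (.write a i e) s (i.cost + e.cost + 1) (s.setArr a (i.eval s) (e.eval s))
  | seq {c d : Cmd} {s s' s'' : Store} {m n : ℕ} :
      Run c s m s' → Run d s' n s'' → Run (.seq c d) s (m + n) s''
  | ite_true {b : Expr} {c d : Cmd} {s s' : Store} {n : ℕ} :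
      b.eval s ≠ 0 → Run c s n s' → Run (.ite b c d) s (b.cost + 1 + n) s'
  | ite_false {b : Expr} {c d : Cmd} {s s' : Store} {n : ℕ} :
      b.eval s = 0 → Run d s n s' → Run (.ite b c d) s (b.cost + 1 + n) s'
  | loop_true {b : Expr} {c : Cmd} {s s' s'' : Store} {m n : ℕ} :
      b.eval s ≠ 0 → Run c s m s' → Run (.loop b c) s' n s'' →
      Run (.loop b c) s (b.cost + 1 + m + n) s''
  | loop_false {b : Expr} {c : Cmd} {s : Store} :
      b.eval s = 0 → Run (.loop b c) s (b.cost + 1) s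

/-- "For `x` from `0` while `x < n` do `c`". -/
def Cmd.forLt (x : ℕ) (n : Expr) (c : Cmd) : Cmd :=
  .seq (.assign x (.const 0))
    (.loop (.lt (.var x) n) (.seq c (.assign x (.add (.var x) (.const 1)))))

/-! ### Storage of the input and of the output -/

/-- The register `n` holds the size of `S`, and the first `S.card` entries of the arrays `ax`, `ay`,
`ak` list the elements of `S` in some order, without repetition. -/
def Lists {k : ℕ} (s : Store) (n ax ay ak : ℕ) (S : Finset (Vertex × Fin k)) : Prop :=
  s.var n = (S.card : ℤ) ∧
  ∀ c : Vertex × Fin k, c ∈ S ↔ ∃ i : ℕ, i < S.card ∧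
    s.arr ax i = c.1.1 ∧ s.arr ay i = c.1.2 ∧ s.arr ak i = ((c.2 : ℕ) : ℤ)

/-- The memory holds the instance `(R, X₁, X₂)`. All other memory cells are arbitrary. -/
def HoldsInput (s : Store) (R : Finset Tri) (X₁ X₂ : Finset Edge) : Prop :=
  Lists s 0 0 1 2 R ∧ Lists s 1 3 4 5 X₁ ∧ Lists s 2 6 7 8 X₂

/-- The memory holds the set of lozenges `T` as output. -/
def HoldsOutput (s : Store) (T : Finset Edge) : Prop := Lists s 9 16 17 18 T

/-! ### The Bellman-Ford algorithm -/

/-- Register: the number of vertices. -/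
abbrev numV : ℕ := 3
/-- Register: the number of directed edges. -/
abbrev numA : ℕ := 4
/-- Register: the counter of the rounds. -/
abbrev ctrR : ℕ := 5
/-- Register: the counter of the vertices or directed edges. -/
abbrev ctrI : ℕ := 6
/-- Register: `1` if Bellman-Ford ends without finding a negative cycle, otherwise `0`. -/
abbrev okB : ℕ := 7
/-- Register: `1` if the tiling problem has a solution, otherwise `0`. -/
abbrev solvable : ℕ := 8
/-- Arrays: the two coordinates of the vertex number `i`. -/
abbrev vx : ℕ := 9
abbrev vy : ℕ := 10
/-- Arrays: the numbers of the two ends of the directed edge number `i`, and its weight. -/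
abbrev aSrc : ℕ := 11
abbrev aDst : ℕ := 12
abbrev aWt : ℕ := 13
/-- Array: the tentative distance to the vertex number `i` (meaningful if it is finite). -/
abbrev distA : ℕ := 14
/-- Array: `1` if the tentative distance to the vertex number `i` is finite, `0` if it is `∞`. -/
abbrev reachedA : ℕ := 15

/-- The vertex number `i`. -/
def vertexAt (s : Store) (i : ℤ) : Vertex := (s.arr vx i, s.arr vy i)

/-- The directed edge number `i`. -/
def arcAt (s : Store) (i : ℤ) : Arc :=
  (vertexAt s (s.arr aSrc i), vertexAt s (s.arr aDst i), s.arr aWt i)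

/-- The memory holds the graph with vertex set `V` and set of directed edges `A`: the vertices are
numbered without repetition, and the directed edges are listed. -/
def HoldsGraph (s : Store) (V : Finset Vertex) (A : Set Arc) : Prop :=
  Set.BijOn (vertexAt s) (Set.Ico 0 (s.var numV)) V ∧
  (∀ i ∈ Set.Ico 0 (s.var numA),
    s.arr aSrc i ∈ Set.Ico 0 (s.var numV) ∧ s.arr aDst i ∈ Set.Ico 0 (s.var numV)) ∧
  arcAt s '' Set.Ico 0 (s.var numA) = A

/-- Run `c` if the directed edge `u → v` number `ctrI` of weight `w` can be relaxed, that is, if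
`dist u + w < dist v`, where distances can be `∞`. -/
def ifRelaxable (c : Cmd) : Cmd :=
  .ite (.read reachedA (.read aSrc (.var ctrI)))
    (.ite (.read reachedA (.read aDst (.var ctrI)))
      (.ite (.lt (.add (.read distA (.read aSrc (.var ctrI))) (.read aWt (.var ctrI)))
          (.read distA (.read aDst (.var ctrI))))
        c .skip)
      c)
    .skip

/-- Bellman-Ford with the vertex number `0` as source: all distances are `∞` except that of the
source, which is `0`; then all directed edges are relaxed, `numV - 1` times; at last it is checked
whether some directed edge can still be relaxed. -/
def bellmanFord : Cmd :=
  .seq (.forLt ctrI (.var numV) (.write reachedA (.var ctrI) (.const 0)))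
  (.seq (.write reachedA (.const 0) (.const 1))
  (.seq (.write distA (.const 0) (.const 0))
  (.seq
    (.forLt ctrR (.sub (.var numV) (.const 1))
      (.forLt ctrI (.var numA)
        (ifRelaxable
          (.seq
            (.write distA (.read aDst (.var ctrI))
              (.add (.read distA (.read aSrc (.var ctrI))) (.read aWt (.var ctrI))))
            (.write reachedA (.read aDst (.var ctrI)) (.const 1))))))
  (.seq (.assign okB (.const 1))
    (.forLt ctrI (.var numA) (ifRelaxable (.assign okB (.const 0))))))))

end LozengeTiling

open LozengeTiling

namespace LozengeTiling

/-! A tiling is the same thing as a height function. Give each positively oriented edge the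
increment -2 if a lozenge overlaps it, and 1 otherwise. The positive edges of a triangle form a
directed cycle, exactly one of which is overlapped, so the increments around it sum to 1 + 1 - 2 = 0
(`IsTiling.sum_edges`). As the region is simply connected, they are the increments of a height on
the vertices (`exists_height_of_closed`). The arcs of the graph say that increments are at most 1,
that they equal 1 on boundary edges and on `X₁ ∪ X₂`, and that the two vertices opposite an edge of
`X₂` have equal height, which is what different orientations amount to. So every solution gives a
feasible potential (`IsSolution.exists_potential`).

Conversely, a feasible potential whose increments along edges are 1 modulo 3 gives a solution: three
numbers that are at most 1, congruent to 1 modulo 3 and of sum zero are 1, 1, -2 in some order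
(`IsPotential.isSolution_heightTiling`). For shortest distances the congruence is automatic, because
`x + y` modulo 3 changes along every arc by its weight (`three_dvd_of_mem_dcArcs`), so the length of
a walk is determined modulo 3 by its ends.

Bellman–Ford keeps distances that are lengths of walks and ends with distances at most the lengths
of all simple paths (`within_bellmanFord`). If a potential exists, walks shorten to simple paths, so
no arc stays relaxable (`BFResult.not_relaxable`). If no arc is relaxable, the distances form a
potential with the right congruence (`BFResult.exists_height`). Hence the final test decides
solvability.

Exactness of closed cochains is reduced to covering theory: linear interpolation of the cochain,
taken modulo 1, is a continuous map from the region to the circle, and its lifts along edges recover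
the cochain.

For the time bound, `build` and `extract` treat `O(|R|)` items by linear searches of cost `O(|R|)`
each (`within_build`, `within_extract_ok`), and Bellman–Ford runs on `O(|R|)` vertices and listed
arcs. -/

/-! ### Topology: circle-valued maps on simply connected spaces -/

/-- A continuous map from a simply connected space to `ℝ/ℤ` has a real-valued lift whose
increments along paths are the increments of the lifted paths. -/
theorem exists_lift_of_simplyConnected {X : Type*} [TopologicalSpace X] [SimplyConnectedSpace X]
    (f : C(X, AddCircle (1 : ℝ))) :
    ∃ H : X → ℝ, ∀ (x y : X) (γ : Path x y) (g : C(unitInterval, ℝ)),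
      (∀ s, ((g s : ℝ) : AddCircle (1 : ℝ)) = f (γ s)) → H y - H x = g 1 - g 0 := by
  have cov : IsCoveringMap ((↑) : ℝ → AddCircle (1 : ℝ)) := AddCircle.isCoveringMap_coe 1
  obtain ⟨x₀⟩ : Nonempty X := inferInstance
  obtain ⟨e₀, he₀⟩ := QuotientAddGroup.mk_surjective (f x₀)
  have he₀' : f x₀ = ((e₀ : ℝ) : AddCircle (1 : ℝ)) := he₀.symm
  let P : ∀ x, Path x₀ x := fun x => PathConnectedSpace.somePath x₀ x
  let Q : ∀ x, Path (f x₀) (f x) := fun x => (P x).map f.continuous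
  let Γ : ∀ x, C(unitInterval, ℝ) := fun x =>
    cov.liftPath (Q x) e₀ ((Q x).source.trans he₀')
  refine ⟨fun x => Γ x 1, fun x y γ g hg => ?_⟩
  -- Simple connectedness enters here: the chosen path to `y` and the detour through `x` along `γ`
  -- are homotopic, so their lifts from `e₀` end at the same point.
  have hhom : (P y).Homotopic ((P x).trans γ) := SimplyConnectedSpace.paths_homotopic _ _
  have hhom' : (Q y).Homotopic ((Q x).trans (γ.map f.continuous)) := by
    have := hhom.map f
    rwa [Path.map_trans] at this
  have h1 : Γ y 1 = cov.liftPath ((Q x).trans (γ.map f.continuous) : Path _ _) e₀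
      (by simpa using he₀') 1 :=
    cov.liftPath_apply_one_eq_of_homotopicRel hhom' e₀ _ _
  have h2 := cov.liftPath_trans he₀' (Q x) (γ.map f.continuous)
  have hx : ((Γ x 1 : ℝ) : AddCircle (1 : ℝ)) = f x := by
    have := congrFun (cov.liftPath_lifts (Q x) e₀ ((Q x).source.trans he₀')) 1
    simpa using this
  -- Lifts of `γ` are unique given their start, so the lift starting at `Γ x 1` is `g` shifted by a
  -- constant.
  have h3 : (⟨fun s => g s + (Γ x 1 - g 0), by fun_prop⟩ : C(unitInterval, ℝ)) =
      cov.liftPath (γ.map f.continuous) (Γ x 1) (by simpa using hx.symm) := by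
    rw [cov.eq_liftPath_iff']
    refine ⟨?_, by simp⟩
    funext s
    have h0 := hg 0
    simp only [Path.source] at h0
    simp [hx, h0, hg s]
  have h4 : Γ y 1 = g 1 + (Γ x 1 - g 0) := by
    rw [h1, h2]
    have := congrArg (fun k : C(unitInterval, ℝ) => k 1) h3
    simpa using this.symm
  simp only [h4]
  ring

/-! ### Geometry of the closed triangles -/

/-- The inequalities cut out a convex set that contains the three vertices, hence their convex hull.
-/
theorem Tri.mem_closedTriangle {t : Tri} {p : ℝ × ℝ} (h : p ∈ t.closedTriangle) :
    if t.2 = 0 then 0 ≤ p.2 - t.1.2 ∧ p.2 - t.1.2 ≤ p.1 - t.1.1 ∧ p.1 - t.1.1 ≤ 1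
    else 0 ≤ p.1 - t.1.1 ∧ p.1 - t.1.1 ≤ p.2 - t.1.2 ∧ p.2 - t.1.2 ≤ 1 := by
  obtain ⟨⟨i, j⟩, k⟩ := t
  have key : ∀ S : Set (ℝ × ℝ), Convex ℝ S → (∀ v ∈ Tri.verts ((i, j), k),
      ((v.1 : ℝ), (v.2 : ℝ)) ∈ S) → p ∈ S := fun S hS hv =>
    convexHull_min (by rintro _ ⟨v, hv', rfl⟩; exact hv v hv') hS h
  fin_cases k
  · refine key {p | 0 ≤ p.2 - j ∧ p.2 - j ≤ p.1 - i ∧ p.1 - i ≤ 1} ?_ ?_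
    · rintro ⟨x, y⟩ ⟨h1, h2, h3⟩ ⟨x', y'⟩ ⟨h1', h2', h3'⟩ a b ha hb hab
      obtain rfl : b = 1 - a := by linarith
      simp only [Set.mem_ofPred_eq, Prod.smul_mk, Prod.mk_add_mk, smul_eq_mul] at *
      refine ⟨?_, ?_, ?_⟩ <;> nlinarith
    · simp [Tri.verts, add_comm]
  · refine key {p | 0 ≤ p.1 - i ∧ p.1 - i ≤ p.2 - j ∧ p.2 - j ≤ 1} ?_ ?_
    · rintro ⟨x, y⟩ ⟨h1, h2, h3⟩ ⟨x', y'⟩ ⟨h1', h2', h3'⟩ a b ha hb hab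
      obtain rfl : b = 1 - a := by linarith
      simp only [Set.mem_ofPred_eq, Prod.smul_mk, Prod.mk_add_mk, smul_eq_mul] at *
      refine ⟨?_, ?_, ?_⟩ <;> nlinarith
    · simp [Tri.verts, add_comm]

theorem Tri.isClosed_closedTriangle (t : Tri) : IsClosed t.closedTriangle :=
  ((t.verts.finite_toSet.image _).isCompact_convexHull ℝ).isClosed

/-- Pasting along finitely many closed pieces. -/
theorem continuousOn_carrier {Y : Type*} [TopologicalSpace Y] {R : Finset Tri} {f : ℝ × ℝ → Y}
    (h : ∀ t ∈ R, ContinuousOn f t.closedTriangle) : ContinuousOn f (carrier R) := by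
  have : carrier R = ⋃ t : R, t.1.closedTriangle := by
    simp [carrier, Set.iUnion_subtype]
  rw [this]
  exact (locallyFinite_of_finite _).continuousOn_iUnion
    (fun t => t.1.isClosed_closedTriangle) (fun t => h t.1 t.2)

/-- Any point of a triangle has the lattice point below it among the vertices of the triangle. -/
theorem Tri.floor_mem_verts {t : Tri} {p : ℝ × ℝ} (h : p ∈ t.closedTriangle) :
    (⌊p.1⌋, ⌊p.2⌋) ∈ t.verts := by
  have h := t.mem_closedTriangle h
  obtain ⟨⟨i, j⟩, k⟩ := t
  obtain ⟨x, y⟩ := p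
  have hf : ∀ (z : ℝ) (n : ℤ), 0 ≤ z - n → z - n ≤ 1 →
      (⌊z⌋ = n ∧ z - n < 1) ∨ (⌊z⌋ = n + 1 ∧ z - n = 1) := by
    intro z n h0 h1
    rcases h1.lt_or_eq with h1 | h1
    · exact Or.inl ⟨Int.floor_eq_iff.2 ⟨by linarith, by linarith⟩, h1⟩
    · refine Or.inr ⟨Int.floor_eq_iff.2 ⟨?_, ?_⟩, h1⟩ <;> push_cast <;> linarith
  -- Of the four corners of the unit square, the one outside the triangle is excluded: there the
  -- smaller of the two offsets would equal 1 while the larger one is below 1.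
  fin_cases k <;> simp at h <;> obtain ⟨h1, h2, h3⟩ := h
  · rcases hf x i (by linarith) (by linarith) with ⟨hx, hx'⟩ | ⟨hx, hx'⟩ <;>
    rcases hf y j (by linarith) (by linarith) with ⟨hy, hy'⟩ | ⟨hy, hy'⟩ <;>
    first | (exfalso; linarith) | simp [Tri.verts, hx, hy]
  · rcases hf x i (by linarith) (by linarith) with ⟨hx, hx'⟩ | ⟨hx, hx'⟩ <;>
    rcases hf y j (by linarith) (by linarith) with ⟨hy, hy'⟩ | ⟨hy, hy'⟩ <;>
    first | (exfalso; linarith) | simp [Tri.verts, hx, hy]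

def Vertex.toReal (v : Vertex) : ℝ × ℝ := (v.1, v.2)

theorem Tri.toReal_mem {t : Tri} {v : Vertex} (h : v ∈ t.verts) : v.toReal ∈ t.closedTriangle :=
  subset_convexHull ℝ _ ⟨v, h, rfl⟩

theorem Tri.closedTriangle_subset_carrier {R : Finset Tri} {t : Tri} (h : t ∈ R) :
    t.closedTriangle ⊆ carrier R :=
  Set.subset_biUnion_of_mem (u := fun t : Tri => t.closedTriangle) h

/-- In a connected region, a nonempty set of vertices of the region is everything if it contains,
with one vertex of a triangle of the region, the others. -/
theorem regionVerts_subset_of_closed {R : Finset Tri} [PreconnectedSpace (carrier R)]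
    {S : Set Vertex} (hS : ∀ t ∈ R, ∀ u ∈ t.verts, ∀ v ∈ t.verts, u ∈ S → v ∈ S)
    {v₀ : Vertex} (hv₀ : v₀ ∈ regionVerts R) (h₀ : v₀ ∈ S) {v : Vertex} (hv : v ∈ regionVerts R) :
    v ∈ S := by
  classical
  -- By `Tri.floor_mem_verts`, `f` reads membership in `S` off a vertex of the triangle containing
  -- the point. So `f` is constant on each triangle, hence continuous on the region, hence constant
  -- by connectedness.
  let f : ℝ × ℝ → Bool := fun p => decide ((⌊p.1⌋, ⌊p.2⌋) ∈ S)
  have hf : ContinuousOn f (carrier R) := by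
    refine continuousOn_carrier fun t ht => ?_
    by_cases h : ∃ u ∈ t.verts, u ∈ S
    · obtain ⟨u, hu, huS⟩ := h
      refine (continuousOn_const (c := true)).congr fun p hp => ?_
      simpa [f] using hS t ht u hu _ (Tri.floor_mem_verts hp) huS
    · push Not at h
      refine (continuousOn_const (c := false)).congr fun p hp => ?_
      simpa [f] using h _ (Tri.floor_mem_verts hp)
  have hmem : ∀ v ∈ regionVerts R, v.toReal ∈ carrier R := by
    intro v hv
    obtain ⟨t, ht, hvt⟩ := Finset.mem_biUnion.1 hv
    exact Tri.closedTriangle_subset_carrier ht (Tri.toReal_mem hvt)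
  have hval : ∀ v : Vertex, f v.toReal = true ↔ v ∈ S := by
    intro v; simp [f, Vertex.toReal]
  have hconn : IsPreconnected (carrier R) := isPreconnected_iff_preconnectedSpace.2 inferInstance
  have := hconn.constant hf (hmem _ hv) (hmem _ hv₀)
  rw [← hval, this, hval]
  exact h₀

/-! ### Closed cochains on a simply connected region are exact -/

/-- The piecewise linear function that interpolates the cochain `c` in the unit squares. -/
noncomputable def cellInterp (c : Edge → ℤ) (i j : ℤ) (a b : ℝ) : ℝ :=
  if b < a then a * c ((i, j), 0) + b * c ((i + 1, j), 1)
  else if a < b then b * c ((i, j), 1) + a * c ((i, j + 1), 0)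
  -- The diagonal is an edge shared by the two triangles of the square. Interpolating along that
  -- edge itself favours neither, as the cochain need be closed only on triangles of the region.
  else - a * c ((i + 1, j + 1), 2)

/-- The interpolation of the cochain `c` on a triangle. -/
noncomputable def triInterp (c : Edge → ℤ) (t : Tri) (p : ℝ × ℝ) : ℝ :=
  if t.2 = 0 then (p.1 - t.1.1) * c (t.1, 0) + (p.2 - t.1.2) * c ((t.1.1 + 1, t.1.2), 1)
  else (p.2 - t.1.2) * c (t.1, 1) + (p.1 - t.1.1) * c ((t.1.1, t.1.2 + 1), 0)

/-- On the right or top side of the unit square the floor moves on to the next square, and the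
interpolation starts from another vertex. The value then changes by a sum of values of `c`, an
integer, which vanishes in the circle. -/
theorem cellInterp_eq_triInterp {c : Edge → ℤ} {t : Tri} (hc : ∑ e ∈ t.edges, c e = 0)
    {p : ℝ × ℝ} (hp : p ∈ t.closedTriangle) :
    ((cellInterp c ⌊p.1⌋ ⌊p.2⌋ (Int.fract p.1) (Int.fract p.2) : ℝ) : AddCircle (1 : ℝ)) =
      (triInterp c t p : ℝ) := by
  have h := t.mem_closedTriangle hp
  obtain ⟨⟨i, j⟩, k⟩ := t
  obtain ⟨x, y⟩ := p
  have hf : ∀ (z : ℝ) (n : ℤ), 0 ≤ z - n → z - n ≤ 1 →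
      (⌊z⌋ = n ∧ Int.fract z = z - n ∧ z - n < 1) ∨
      (⌊z⌋ = n + 1 ∧ Int.fract z = 0 ∧ z - n = 1) := by
    intro z n h0 h1
    rcases h1.lt_or_eq with h1 | h1
    · have : ⌊z⌋ = n := Int.floor_eq_iff.2 ⟨by linarith, by linarith⟩
      exact Or.inl ⟨this, by rw [Int.fract, this], h1⟩
    · have : ⌊z⌋ = n + 1 := Int.floor_eq_iff.2 ⟨by push_cast; linarith, by push_cast; linarith⟩
      exact Or.inr ⟨this, by rw [Int.fract, this]; push_cast; linarith, h1⟩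
  have hint : ∀ (r s : ℝ) (n : ℤ), r = s + n → (r : AddCircle (1 : ℝ)) = (s : ℝ) := by
    rintro r s n rfl
    rw [AddCircle.coe_add, add_eq_left, AddCircle.coe_eq_zero_iff]
    exact ⟨n, by simp⟩
  fin_cases k
  · have hc' : (c ((i, j), 0) : ℝ) + (c ((i + 1, j), 1) + c ((i + 1, j + 1), 2)) = 0 := by
      have : c ((i, j), 0) + (c ((i + 1, j), 1) + c ((i + 1, j + 1), 2)) = 0 := by
        rw [← hc]; simp [Tri.edges]
      exact_mod_cast this
    obtain ⟨h1, h2, h3⟩ : 0 ≤ y - j ∧ y - j ≤ x - i ∧ x - i ≤ 1 := h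
    rcases hf x i (by linarith) (by linarith) with ⟨hx, hx', hx''⟩ | ⟨hx, hx', hx''⟩ <;>
    rcases hf y j (by linarith) (by linarith) with ⟨hy, hy', hy''⟩ | ⟨hy, hy', hy''⟩ <;>
    simp only [hx, hy, hx', hy', cellInterp, triInterp]
    · refine hint _ _ 0 ?_
      rcases h2.lt_or_eq with h2 | h2
      · rw [if_pos h2]; simp
      · simp only [h2, lt_irrefl, if_false, Int.cast_zero, Fin.zero_eta, if_true]
        linear_combination (-(x - i)) * hc'
    · exfalso; linarith
    · refine hint _ _ (- c ((i, j), 0)) ?_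
      rcases h1.lt_or_eq with h1 | h1
      · simp [h1, h1.not_gt, hx'']
      · simp [← h1, hx'']
    · refine hint _ _ (- c ((i, j), 0) - c ((i + 1, j), 1)) ?_
      simp [hx'', hy'']
  · have hc' : (c ((i, j), 1) : ℝ) + (c ((i, j + 1), 0) + c ((i + 1, j + 1), 2)) = 0 := by
      have : c ((i, j), 1) + (c ((i, j + 1), 0) + c ((i + 1, j + 1), 2)) = 0 := by
        rw [← hc]; simp [Tri.edges]
      exact_mod_cast this
    obtain ⟨h1, h2, h3⟩ : 0 ≤ x - i ∧ x - i ≤ y - j ∧ y - j ≤ 1 := h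
    rcases hf x i (by linarith) (by linarith) with ⟨hx, hx', hx''⟩ | ⟨hx, hx', hx''⟩ <;>
    rcases hf y j (by linarith) (by linarith) with ⟨hy, hy', hy''⟩ | ⟨hy, hy', hy''⟩ <;>
    simp only [hx, hy, hx', hy', cellInterp, triInterp]
    · refine hint _ _ 0 ?_
      rcases h2.lt_or_eq with h2 | h2
      · rw [if_neg h2.not_gt, if_pos h2]; simp
      · simp only [h2, lt_irrefl, if_false, Int.cast_zero, Fin.mk_one, one_ne_zero]
        linear_combination (-(y - j)) * hc'
    · refine hint _ _ (- c ((i, j), 1)) ?_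
      rcases h1.lt_or_eq with h1 | h1
      · simp [h1, hy'']
      · simp [← h1, hy'']
    · exfalso; linarith
    · refine hint _ _ (- c ((i, j), 1) - c ((i, j + 1), 0)) ?_
      simp [hx'', hy'']

/-- The interpolation is built from the edges in directions 0 and 1; only the diagonal edge needs
the sum around the triangle to vanish. -/
theorem triInterp_tgt_sub_src {c : Edge → ℤ} {t : Tri} (hc : ∑ e ∈ t.edges, c e = 0) {e : Edge}
    (he : e ∈ t.edges) :
    triInterp c t e.tgt.toReal - triInterp c t e.src.toReal = c e := by
  obtain ⟨⟨i, j⟩, k⟩ := t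
  fin_cases k
  · have hc' : (c ((i, j), 0) : ℝ) + (c ((i + 1, j), 1) + c ((i + 1, j + 1), 2)) = 0 := by
      have : c ((i, j), 0) + (c ((i + 1, j), 1) + c ((i + 1, j + 1), 2)) = 0 := by
        rw [← hc]; simp [Tri.edges]
      exact_mod_cast this
    simp [Tri.edges] at he
    rcases he with rfl | rfl | rfl <;>
      simp [triInterp, Vertex.toReal, Edge.tgt, Edge.src, dirVec]
    linarith
  · have hc' : (c ((i, j), 1) : ℝ) + (c ((i, j + 1), 0) + c ((i + 1, j + 1), 2)) = 0 := by
      have : c ((i, j), 1) + (c ((i, j + 1), 0) + c ((i + 1, j + 1), 2)) = 0 := by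
        rw [← hc]; simp [Tri.edges]
      exact_mod_cast this
    simp [Tri.edges] at he
    rcases he with rfl | rfl | rfl <;>
      simp [triInterp, Vertex.toReal, Edge.tgt, Edge.src, dirVec]
    linarith

theorem Tri.src_tgt_mem_verts {t : Tri} {e : Edge} (he : e ∈ t.edges) :
    e.src ∈ t.verts ∧ e.tgt ∈ t.verts := by
  obtain ⟨⟨i, j⟩, k⟩ := t
  fin_cases k <;> simp [Tri.edges] at he <;> rcases he with rfl | rfl | rfl <;>
    simp [Tri.verts, Edge.src, Edge.tgt, dirVec]

/-- The positively oriented edges of a triangle form a directed cycle. -/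
theorem Tri.verts_closed {t : Tri} {S : Set Vertex} (hS : ∀ e ∈ t.edges, e.src ∈ S → e.tgt ∈ S) :
    ∀ u ∈ t.verts, ∀ v ∈ t.verts, u ∈ S → v ∈ S := by
  obtain ⟨⟨i, j⟩, k⟩ := t
  fin_cases k <;> simp [Tri.edges, Edge.src, Edge.tgt, dirVec] at hS <;> simp [Tri.verts] <;> tauto

theorem triInterp_lineMap (c : Edge → ℤ) (t : Tri) (p q : ℝ × ℝ) (s : ℝ) :
    triInterp c t (AffineMap.lineMap p q s) =
      triInterp c t p + s * (triInterp c t q - triInterp c t p) := by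
  simp only [triInterp, AffineMap.lineMap_apply, vsub_eq_sub, vadd_eq_add, Prod.fst_add,
    Prod.snd_add, Prod.smul_fst, Prod.smul_snd, Prod.fst_sub, Prod.snd_sub, smul_eq_mul]
  split_ifs <;> ring

/-- On a simply connected region, every cochain that sums to zero around the triangles is the
coboundary of a function on the vertices. -/
theorem exists_height_of_closed {R : Finset Tri} [SimplyConnectedSpace (carrier R)]
    {c : Edge → ℤ} (hc : ∀ t ∈ R, ∑ e ∈ t.edges, c e = 0) :
    ∃ h : Vertex → ℤ, ∀ e ∈ regionEdges R, h e.tgt - h e.src = c e := by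
  classical
  -- A single formula on the whole plane, so that nothing has to be chosen where triangles meet; on
  -- each triangle of the region it agrees modulo 1 with an affine function.
  let F : ℝ × ℝ → AddCircle (1 : ℝ) := fun p =>
    (cellInterp c ⌊p.1⌋ ⌊p.2⌋ (Int.fract p.1) (Int.fract p.2) : ℝ)
  have hF : ∀ t ∈ R, ∀ p ∈ t.closedTriangle, F p = (triInterp c t p : ℝ) := fun t ht p hp =>
    cellInterp_eq_triInterp (hc t ht) hp
  have hcont : ContinuousOn F (carrier R) := by
    refine continuousOn_carrier fun t ht => ContinuousOn.congr ?_ (hF t ht)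
    refine Continuous.continuousOn ?_
    refine (AddCircle.continuous_mk' (1 : ℝ)).comp ?_
    unfold triInterp
    split_ifs <;> fun_prop
  obtain ⟨H, hH⟩ := exists_lift_of_simplyConnected
    (⟨fun p => F p.1, hcont.domRestrict⟩ : C(carrier R, AddCircle (1 : ℝ)))
  let K : Vertex → ℝ := fun v => if hv : v.toReal ∈ carrier R then H ⟨v.toReal, hv⟩ else 0
  have hK : ∀ e ∈ regionEdges R, K e.tgt - K e.src = c e := by
    intro e he
    obtain ⟨t, ht, het⟩ := Finset.mem_biUnion.1 he
    obtain ⟨hs, ht'⟩ := Tri.src_tgt_mem_verts het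
    have hs := Tri.toReal_mem hs
    have ht' := Tri.toReal_mem ht'
    have hseg : ∀ s : unitInterval,
        AffineMap.lineMap e.src.toReal e.tgt.toReal (s : ℝ) ∈ t.closedTriangle := fun s =>
      (convex_convexHull ℝ _).lineMap_mem hs ht' s.2
    have hsub := Tri.closedTriangle_subset_carrier ht
    simp only [K, dif_pos (hsub hs), dif_pos (hsub ht')]
    let γ : Path (⟨_, hsub hs⟩ : carrier R) ⟨_, hsub ht'⟩ :=
      { toFun := fun s => ⟨_, hsub (hseg s)⟩
        continuous_toFun := by
          refine Continuous.subtype_mk ?_ _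
          simp only [AffineMap.lineMap_apply]
          fun_prop
        source' := by simp
        target' := by simp }
    -- Along the segment from `e.src` to `e.tgt` the map `F` lifts to an affine function with total
    -- increment `c e`.
    rw [hH _ _ γ ⟨fun s => triInterp c t e.src.toReal + s * c e, by fun_prop⟩]
    · simp
    · intro s
      change _ = F (AffineMap.lineMap e.src.toReal e.tgt.toReal (s : ℝ))
      rw [hF t ht _ (hseg s), triInterp_lineMap, triInterp_tgt_sub_src (hc t ht) het]
      rfl
  by_cases hR : ∃ v₀, v₀ ∈ regionVerts R
  · obtain ⟨v₀, hv₀⟩ := hR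
    -- `K` is only real-valued. Its increments along edges are integers, so by connectedness all
    -- values differ from `K v₀` by integers, and these differences serve as the height.
    have hint : ∀ v ∈ regionVerts R, v ∈ {v | ∃ n : ℤ, K v - K v₀ = n} := by
      intro v hv
      refine regionVerts_subset_of_closed (S := {v | ∃ n : ℤ, K v - K v₀ = n}) ?_ hv₀
        ⟨0, by simp⟩ hv
      intro t ht
      refine Tri.verts_closed fun e he => ?_
      rintro ⟨n, hn⟩
      have := hK e (Finset.mem_biUnion.2 ⟨t, ht, he⟩)
      exact ⟨n + c e, by push_cast; linarith⟩
    choose! n hn using hint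
    refine ⟨n, fun e he => ?_⟩
    obtain ⟨t, ht, het⟩ := Finset.mem_biUnion.1 he
    obtain ⟨hs, ht'⟩ := Tri.src_tgt_mem_verts het
    have h1 := hn _ (Finset.mem_biUnion.2 ⟨t, ht, hs⟩)
    have h2 := hn _ (Finset.mem_biUnion.2 ⟨t, ht, ht'⟩)
    have h3 := hK e he
    have : ((n e.tgt - n e.src : ℤ) : ℝ) = c e := by
      push_cast; linarith
    exact_mod_cast this
  · refine ⟨0, fun e he => ?_⟩
    obtain ⟨t, ht, het⟩ := Finset.mem_biUnion.1 he
    exact absurd ⟨_, Finset.mem_biUnion.2 ⟨t, ht, (Tri.src_tgt_mem_verts het).1⟩⟩ hR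

/-! ### The two triangles adjacent to an edge -/

/-- The adjacent triangle of kind `0`. -/
def Edge.lower (e : Edge) : Tri := (e.1 - ![(0, 0), (1, 0), (1, 1)] e.2, 0)

/-- The adjacent triangle of kind `1`. -/
def Edge.upper (e : Edge) : Tri := (e.1 - ![(0, 1), (0, 0), (1, 1)] e.2, 1)

/-- The third vertex of the triangle `e.lower`. -/
def Edge.lowerApex (e : Edge) : Vertex := e.1 + ![(1, 1), (-1, 0), (0, -1)] e.2

/-- The third vertex of the triangle `e.upper`. -/
def Edge.upperApex (e : Edge) : Vertex := e.1 + ![(0, -1), (1, 1), (-1, 0)] e.2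

theorem Edge.mem_edges_iff {e : Edge} {t : Tri} : e ∈ t.edges ↔ t = e.lower ∨ t = e.upper := by
  obtain ⟨⟨x, y⟩, d⟩ := e
  obtain ⟨⟨i, j⟩, k⟩ := t
  fin_cases d <;> fin_cases k <;>
    simp [Tri.edges, Edge.lower, Edge.upper, Prod.ext_iff] <;> omega

theorem Edge.mem_lower_edges (e : Edge) : e ∈ e.lower.edges := mem_edges_iff.2 (Or.inl rfl)

theorem Edge.mem_upper_edges (e : Edge) : e ∈ e.upper.edges := mem_edges_iff.2 (Or.inr rfl)

theorem Edge.lower_ne_upper (e : Edge) : e.lower ≠ e.upper := by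
  intro h
  have := congrArg Prod.snd h
  simp [lower, upper] at this

/-- Starting from `e`, the directions run `d, d + 1, d + 2` around the lower triangle and `d, d + 2,
d + 1` around the upper one. In this normal form, comparing orientations across `e` needs no case
distinction on `d`. -/
theorem Edge.lower_edges (e : Edge) :
    e.lower.edges = {e, (e.tgt, e.2 + 1), (e.lowerApex, e.2 + 2)} := by
  obtain ⟨⟨x, y⟩, d⟩ := e
  ext ⟨⟨i, j⟩, k⟩
  fin_cases d <;> fin_cases k <;>
    simp [Tri.edges, Edge.lower, Edge.tgt, Edge.lowerApex, dirVec, Prod.ext_iff] <;> omega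

theorem Edge.upper_edges (e : Edge) :
    e.upper.edges = {e, (e.tgt, e.2 + 2), (e.upperApex, e.2 + 1)} := by
  obtain ⟨⟨x, y⟩, d⟩ := e
  ext ⟨⟨i, j⟩, k⟩
  fin_cases d <;> fin_cases k <;>
    simp [Tri.edges, Edge.upper, Edge.tgt, Edge.upperApex, dirVec, Prod.ext_iff] <;> omega

theorem Edge.tgt_apex (e : Edge) :
    Edge.tgt (e.tgt, e.2 + 1) = e.lowerApex ∧ Edge.tgt (e.lowerApex, e.2 + 2) = e.src ∧
    Edge.tgt (e.tgt, e.2 + 2) = e.upperApex ∧ Edge.tgt (e.upperApex, e.2 + 1) = e.src := by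
  obtain ⟨⟨x, y⟩, d⟩ := e
  fin_cases d <;> simp [Edge.tgt, Edge.src, Edge.lowerApex, Edge.upperApex, dirVec]

theorem Edge.lowerApex_ne_upperApex (e : Edge) : e.lowerApex ≠ e.upperApex := by
  obtain ⟨⟨x, y⟩, d⟩ := e
  fin_cases d <;> simp [Edge.lowerApex, Edge.upperApex]

theorem adjacent_iff {p q : Vertex} :
    Adjacent p q ↔ q - p ∈ ({(1, 0), (0, 1), (-1, -1), (-1, 0), (0, -1), (1, 1)} : Finset Vertex) := by
  obtain ⟨x, y⟩ := p
  obtain ⟨x', y'⟩ := q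
  have : Adjacent (x, y) (x', y') ↔
      ∃ d : Fin 3, (x', y') = (x, y) + dirVec d ∨ (x, y) = (x', y') + dirVec d := by
    constructor
    · rintro ⟨⟨v, d⟩, ⟨h1, h2⟩ | ⟨h1, h2⟩⟩
      · exact ⟨d, Or.inl (by rw [← h2, ← h1]; rfl)⟩
      · exact ⟨d, Or.inr (by rw [← h2, ← h1]; rfl)⟩
    · rintro ⟨d, h | h⟩
      · exact ⟨((x, y), d), Or.inl ⟨rfl, h.symm⟩⟩
      · exact ⟨((x', y'), d), Or.inr ⟨rfl, h.symm⟩⟩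
  rw [this]
  simp [Fin.exists_fin_succ, dirVec, Prod.ext_iff]
  omega

/-- This identifies the weight-0 arcs of an edge of `X₂` as the two arcs between its apexes. -/
theorem Edge.common_neighbor_iff {e : Edge} {w : Vertex} :
    Adjacent w e.src ∧ Adjacent w e.tgt ↔ w = e.lowerApex ∨ w = e.upperApex := by
  obtain ⟨⟨x, y⟩, d⟩ := e
  obtain ⟨i, j⟩ := w
  rw [adjacent_iff, adjacent_iff]
  fin_cases d <;>
    simp [Edge.src, Edge.tgt, Edge.lowerApex, Edge.upperApex, dirVec, Prod.ext_iff] <;> omega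

theorem isInterior_iff {R : Finset Tri} {e : Edge} :
    IsInterior R e ↔ e.lower ∈ R ∧ e.upper ∈ R := by
  simp [IsInterior, Edge.mem_edges_iff]

instance (R : Finset Tri) (e : Edge) : Decidable (IsInterior R e) :=
  decidable_of_iff _ isInterior_iff.symm

theorem mem_regionEdges {R : Finset Tri} {e : Edge} :
    e ∈ regionEdges R ↔ e.lower ∈ R ∨ e.upper ∈ R := by
  simp only [regionEdges, Finset.mem_biUnion, Edge.mem_edges_iff]
  constructor
  · rintro ⟨t, ht, rfl | rfl⟩ <;> simp [ht]
  · rintro (h | h)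
    · exact ⟨_, h, Or.inl rfl⟩
    · exact ⟨_, h, Or.inr rfl⟩

theorem IsInterior.mem_regionEdges {R : Finset Tri} {e : Edge} (h : IsInterior R e) :
    e ∈ regionEdges R :=
  LozengeTiling.mem_regionEdges.2 (Or.inl (isInterior_iff.1 h).1)

theorem Tri.sum_edges (t : Tri) (h : Vertex → ℤ) : ∑ e ∈ t.edges, (h e.tgt - h e.src) = 0 := by
  obtain ⟨⟨i, j⟩, k⟩ := t
  fin_cases k <;> simp [Tri.edges, Edge.src, Edge.tgt, dirVec] <;> ring

theorem Tri.card_edges (t : Tri) : t.edges.card = 3 := by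
  obtain ⟨⟨i, j⟩, k⟩ := t
  fin_cases k <;> simp [Tri.edges]

/-! ### The arcs of the graph as a finite set -/

/-- The arcs that come from the edge `e` of the region. -/
def edgeArcs (R : Finset Tri) (e : Edge) : Finset Arc :=
  insert (e.src, e.tgt, 1) (if IsInterior R e then ∅ else {(e.tgt, e.src, -1)})

/-- The arcs that come from the edges of a triangle. -/
def triArcs (R : Finset Tri) (t : Tri) : Finset Arc := t.edges.biUnion (edgeArcs R)

/-- The arcs that come from an edge in `X₁`. -/
def barArcs (e : Edge) : Finset Arc := {(e.tgt, e.src, -1)}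

/-- The arcs that come from an edge in `X₂`. -/
def bendArcs (e : Edge) : Finset Arc :=
  {(e.tgt, e.src, -1), (e.lowerApex, e.upperApex, 0), (e.upperApex, e.lowerApex, 0)}

/-- The finite set of all arcs. -/
def dcFinset (R : Finset Tri) (X₁ X₂ : Finset Edge) : Finset Arc :=
  R.biUnion (triArcs R) ∪ X₁.biUnion barArcs ∪ X₂.biUnion bendArcs

/-- The finite set is grouped by triangles, bars and bends, the order in which `buildCmd` generates
the arcs. -/
theorem coe_dcFinset {R : Finset Tri} {X₁ X₂ : Finset Edge} :
    (dcFinset R X₁ X₂ : Set Arc) = dcArcs R X₁ X₂ := by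
  ext a
  simp only [dcFinset, dcArcs, Finset.coe_union, Set.mem_union, Finset.mem_coe, Finset.mem_biUnion,
    triArcs, barArcs, bendArcs, edgeArcs, Finset.mem_insert, Finset.mem_singleton]
  constructor
  · rintro ((⟨t, ht, e, he, h⟩ | ⟨e, he, h⟩) | ⟨e, he, h | h | h⟩)
    · have heR : e ∈ regionEdges R := Finset.mem_biUnion.2 ⟨t, ht, he⟩
      rcases h with h | h
      · exact Or.inl (Or.inl ⟨e, heR, h⟩)
      · split_ifs at h with hi
        · simp at h
        · exact Or.inl (Or.inr ⟨e, Or.inl ⟨heR, hi⟩, by simpa using h⟩)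
    · exact Or.inl (Or.inr ⟨e, Or.inr (Or.inl he), h⟩)
    · exact Or.inl (Or.inr ⟨e, Or.inr (Or.inr he), h⟩)
    · have h1 := Edge.common_neighbor_iff.2 (Or.inl (rfl : e.lowerApex = _))
      have h2 := Edge.common_neighbor_iff.2 (Or.inr (rfl : e.upperApex = _))
      exact Or.inr ⟨e, he, _, _, e.lowerApex_ne_upperApex, h1.1, h1.2, h2.1, h2.2, h⟩
    · have h1 := Edge.common_neighbor_iff.2 (Or.inl (rfl : e.lowerApex = _))
      have h2 := Edge.common_neighbor_iff.2 (Or.inr (rfl : e.upperApex = _))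
      exact Or.inr ⟨e, he, _, _, e.lowerApex_ne_upperApex.symm, h2.1, h2.2, h1.1, h1.2, h⟩
  · rintro ((⟨e, he, h⟩ | ⟨e, he | he | he, h⟩) | ⟨e, he, w, w', hw, h1, h2, h3, h4, rfl⟩)
    · obtain ⟨t, ht, he⟩ := Finset.mem_biUnion.1 he
      exact Or.inl (Or.inl ⟨t, ht, e, he, Or.inl h⟩)
    · obtain ⟨he, hi⟩ := he
      obtain ⟨t, ht, he⟩ := Finset.mem_biUnion.1 he
      exact Or.inl (Or.inl ⟨t, ht, e, he, Or.inr (by simp [hi, h])⟩)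
    · exact Or.inl (Or.inr ⟨e, he, h⟩)
    · exact Or.inr ⟨e, he, Or.inl h⟩
    · refine Or.inr ⟨e, he, ?_⟩
      rcases Edge.common_neighbor_iff.1 ⟨h1, h2⟩ with rfl | rfl <;>
      rcases Edge.common_neighbor_iff.1 ⟨h3, h4⟩ with rfl | rfl <;> simp_all

/-- The vertices at the ends of a set of arcs. -/
def endpoints (A : Finset Arc) : Finset Vertex := A.biUnion fun a => {a.1, a.2.1}

theorem Tri.mem_verts_iff {t : Tri} {v : Vertex} : v ∈ t.verts ↔ ∃ e ∈ t.edges, e.src = v := by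
  obtain ⟨⟨i, j⟩, k⟩ := t
  obtain ⟨x, y⟩ := v
  fin_cases k <;> simp [Tri.verts, Tri.edges, Edge.src, eq_comm]

theorem Edge.src_tgt_mem_regionVerts {R : Finset Tri} {e : Edge} (he : e ∈ regionEdges R) :
    e.src ∈ regionVerts R ∧ e.tgt ∈ regionVerts R := by
  obtain ⟨t, ht, he⟩ := Finset.mem_biUnion.1 he
  have := Tri.src_tgt_mem_verts he
  exact ⟨Finset.mem_biUnion.2 ⟨t, ht, this.1⟩, Finset.mem_biUnion.2 ⟨t, ht, this.2⟩⟩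

theorem Edge.apex_mem_regionVerts {R : Finset Tri} {e : Edge} (he : IsInterior R e) :
    e.lowerApex ∈ regionVerts R ∧ e.upperApex ∈ regionVerts R := by
  obtain ⟨h1, h2⟩ := isInterior_iff.1 he
  constructor
  · refine Finset.mem_biUnion.2 ⟨_, h1, Tri.mem_verts_iff.2 ⟨(e.lowerApex, e.2 + 2), ?_, rfl⟩⟩
    rw [e.lower_edges]; simp
  · refine Finset.mem_biUnion.2 ⟨_, h2, Tri.mem_verts_iff.2 ⟨(e.upperApex, e.2 + 1), ?_, rfl⟩⟩
    rw [e.upper_edges]; simp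

/-- Thanks to this, numbering the ends of arcs as they appear already numbers exactly the vertices
of the region. -/
theorem endpoints_dcFinset {R : Finset Tri} {X₁ X₂ : Finset Edge} (hX₁ : X₁ ⊆ regionEdges R)
    (hX₂ : ∀ e ∈ X₂, IsInterior R e) : endpoints (dcFinset R X₁ X₂) = regionVerts R := by
  ext v
  constructor
  · intro hv
    obtain ⟨a, ha, hva⟩ := Finset.mem_biUnion.1 hv
    rw [← Finset.mem_coe, coe_dcFinset] at ha
    rcases ha with (⟨e, he, rfl⟩ | ⟨e, he, rfl⟩) | ⟨e, he, w, w', hw, h1, h2, h3, h4, rfl⟩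
    · obtain ⟨h1, h2⟩ := Edge.src_tgt_mem_regionVerts he
      simp at hva; rcases hva with rfl | rfl <;> assumption
    · have he : e ∈ regionEdges R := by
        rcases he with he | he | he
        exacts [he.1, hX₁ he, (hX₂ e he).mem_regionEdges]
      obtain ⟨h1, h2⟩ := Edge.src_tgt_mem_regionVerts he
      simp at hva; rcases hva with rfl | rfl <;> assumption
    · obtain ⟨h5, h6⟩ := Edge.apex_mem_regionVerts (hX₂ e he)
      have hw1 := Edge.common_neighbor_iff.1 ⟨h1, h2⟩
      have hw2 := Edge.common_neighbor_iff.1 ⟨h3, h4⟩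
      simp at hva
      rcases hva with rfl | rfl
      · rcases hw1 with rfl | rfl <;> assumption
      · rcases hw2 with rfl | rfl <;> assumption
  · intro hv
    obtain ⟨t, ht, hv⟩ := Finset.mem_biUnion.1 hv
    obtain ⟨e, he, rfl⟩ := Tri.mem_verts_iff.1 hv
    refine Finset.mem_biUnion.2 ⟨(e.src, e.tgt, 1), ?_, by simp⟩
    rw [← Finset.mem_coe, coe_dcFinset]
    exact Or.inl (Or.inl ⟨e, Finset.mem_biUnion.2 ⟨t, ht, he⟩, rfl⟩)

theorem card_regionEdges_le (R : Finset Tri) : (regionEdges R).card ≤ 3 * R.card := by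
  rw [mul_comm]
  exact Finset.card_biUnion_le_card_mul _ _ _ fun t _ => t.card_edges.le

/-- The constant is 6 + 3 + 9: at most two arcs for each of the three edges of a triangle, and at
most `3 * R.card` edges in each of `X₁` and `X₂`, with one and three arcs apiece. -/
theorem card_dcFinset_le {R : Finset Tri} {X₁ X₂ : Finset Edge} (hX₁ : X₁ ⊆ regionEdges R)
    (hX₂ : ∀ e ∈ X₂, IsInterior R e) : (dcFinset R X₁ X₂).card ≤ 18 * R.card := by
  have h1 : (R.biUnion (triArcs R)).card ≤ R.card * 6 := by
    refine Finset.card_biUnion_le_card_mul _ _ _ fun t _ => ?_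
    refine (Finset.card_biUnion_le_card_mul _ _ 2 fun e _ => ?_).trans (by rw [t.card_edges])
    unfold edgeArcs
    split_ifs
    · simp
    · exact Finset.card_le_two
  have h2 : (X₁.biUnion barArcs).card ≤ X₁.card * 1 :=
    Finset.card_biUnion_le_card_mul _ _ _ fun e _ => by simp [barArcs]
  have h3 : (X₂.biUnion bendArcs).card ≤ X₂.card * 3 :=
    Finset.card_biUnion_le_card_mul _ _ _ fun e _ => Finset.card_le_three
  have h4 := Finset.card_le_card hX₁
  have h5 : X₂.card ≤ (regionEdges R).card :=
    Finset.card_le_card fun e he => (hX₂ e he).mem_regionEdges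
  have h6 := card_regionEdges_le R
  have h7 := Finset.card_union_le (R.biUnion (triArcs R) ∪ X₁.biUnion barArcs) (X₂.biUnion bendArcs)
  have h8 := Finset.card_union_le (R.biUnion (triArcs R)) (X₁.biUnion barArcs)
  unfold dcFinset
  omega

/-! ### Tilings and height functions -/

/-- A feasible potential of a set of arcs. -/
def IsPotential (A : Set Arc) (h : Vertex → ℤ) : Prop := ∀ u v w, (u, v, w) ∈ A → h v - h u ≤ w

/-- Exactly one of the three edges is overlapped, so the terms are 1, 1 and -2. -/
theorem IsTiling.sum_edges {R : Finset Tri} {T : Finset Edge} (hT : IsTiling R T) {t : Tri}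
    (ht : t ∈ R) : ∑ e ∈ t.edges, (if e ∈ T then -2 else 1 : ℤ) = 0 := by
  have h1 : (t.edges.filter (· ∈ T)).card = 1 := by
    obtain ⟨l, ⟨hl, hlt⟩, huniq⟩ := hT.2 t ht
    refine Finset.card_eq_one.2 ⟨l, ?_⟩
    ext e
    simp only [Finset.mem_filter, Finset.mem_singleton]
    exact ⟨fun h => huniq e ⟨h.2, h.1⟩, by rintro rfl; exact ⟨hlt, hl⟩⟩
  have h2 : ∀ e, (if e ∈ T then -2 else 1 : ℤ) = 1 - 3 * (if e ∈ T then 1 else 0) := by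
    intro e; split_ifs <;> simp
  simp only [h2, Finset.sum_sub_distrib, ← Finset.mul_sum, Finset.sum_boole, h1]
  simp [t.card_edges]

/-- The reverse arcs sit on edges that no lozenge overlaps: a lozenge over a boundary edge would
leave the region. There the increment is exactly 1. -/
theorem IsSolution.exists_potential {R : Finset Tri} {X₁ X₂ T : Finset Edge}
    [SimplyConnectedSpace (carrier R)] (hX₁ : X₁ ⊆ regionEdges R)
    (hX₂ : ∀ e ∈ X₂, IsInterior R e) (hT : IsSolution R X₁ X₂ T) :
    ∃ h, IsPotential (dcArcs R X₁ X₂) h := by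
  obtain ⟨h, hh⟩ := exists_height_of_closed (R := R) fun t ht => hT.1.sum_edges ht
  refine ⟨h, ?_⟩
  rintro u v w ((⟨e, he, ha⟩ | ⟨e, he, ha⟩) | ⟨e, he, w₁, w₂, hw, h1, h2, h3, h4, ha⟩) <;>
    obtain ⟨rfl, rfl, rfl⟩ := by simpa using ha
  · rw [hh e he]; split_ifs <;> simp
  · have : e ∈ regionEdges R ∧ e ∉ T := by
      rcases he with he | he | he
      · exact ⟨he.1, fun heT => he.2 (hT.1.1 e heT)⟩
      · exact ⟨hX₁ he, hT.2.1 e (by simp [he])⟩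
      · exact ⟨(hX₂ e he).mem_regionEdges, hT.2.1 e (by simp [he])⟩
    have h1 := hh e this.1
    simp [this.2] at h1
    linarith
  · obtain ⟨hl, hu⟩ := isInterior_iff.1 (hX₂ e he)
    have heT : e ∉ T := hT.2.1 e (by simp [he])
    obtain ⟨a1, a2, a3, a4⟩ := e.tgt_apex
    have hmem : ∀ t ∈ R, ∀ e ∈ t.edges, e ∈ regionEdges R := fun t ht e he =>
      Finset.mem_biUnion.2 ⟨t, ht, he⟩
    have b1 := hh _ (hmem _ hl (e.tgt, e.2 + 1) (by simp [e.lower_edges]))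
    have b3 := hh _ (hmem _ hu (e.tgt, e.2 + 2) (by simp [e.upper_edges]))
    rw [a1] at b1
    rw [a3] at b3
    -- Each of the two triangles at `e` is covered across one of its other two edges. The
    -- orientations differ exactly when both of these edges start at `e.tgt` or both end at `e.src`;
    -- in either case the apexes lie at equal height.
    have key : (e.tgt, e.2 + 1) ∈ T ↔ (e.tgt, e.2 + 2) ∈ T := by
      have hne := hT.2.2 e he _ _ e.lower_ne_upper e.mem_lower_edges e.mem_upper_edges
      have hd : e.2 + 1 ≠ e.2 + 2 := by
        generalize e.2 = d; revert d; decide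
      obtain ⟨l, ⟨hlT, hle⟩, _⟩ := hT.1.2 _ hl
      obtain ⟨l', ⟨hlT', hle'⟩, _⟩ := hT.1.2 _ hu
      constructor
      · intro hmemT
        have := hne _ hmemT l' hlT' (by simp [e.lower_edges]) hle'
        rw [e.upper_edges] at hle'
        simp only [Finset.mem_insert, Finset.mem_singleton] at hle'
        rcases hle' with rfl | rfl | rfl
        · exact absurd hlT' heT
        · exact hlT'
        · exact absurd rfl this
      · intro hmemT
        have := hne l hlT _ hmemT hle (by simp [e.upper_edges])
        rw [e.lower_edges] at hle
        simp only [Finset.mem_insert, Finset.mem_singleton] at hle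
        rcases hle with rfl | rfl | rfl
        · exact absurd hlT heT
        · exact hlT
        · exact absurd rfl this
    have heq : h e.lowerApex = h e.upperApex := by
      simp only [Edge.src, key] at b1 b3
      linarith
    rcases Edge.common_neighbor_iff.1 ⟨h1, h2⟩ with rfl | rfl <;>
    rcases Edge.common_neighbor_iff.1 ⟨h3, h4⟩ with rfl | rfl <;> simp [heq]

/-- The lozenges read off a height function. -/
def heightTiling (R : Finset Tri) (h : Vertex → ℤ) : Finset Edge :=
  (regionEdges R).filter fun e => h e.tgt - h e.src ≠ 1

/-- Around a triangle the increments are at most 1, congruent to 1 modulo 3, and sum to zero. Not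
all are 1, and two of them below 1 would make the sum at most -3, so exactly one differs from 1. -/
theorem IsPotential.isSolution_heightTiling {R : Finset Tri} {X₁ X₂ : Finset Edge} {h : Vertex → ℤ}
    (hX₂ : ∀ e ∈ X₂, IsInterior R e)
    (hh : IsPotential (dcArcs R X₁ X₂) h)
    (h3 : ∀ e ∈ regionEdges R, (3 : ℤ) ∣ h e.tgt - h e.src - 1) :
    IsSolution R X₁ X₂ (heightTiling R h) := by
  have hle : ∀ e ∈ regionEdges R, h e.tgt - h e.src ≤ 1 := fun e he =>
    hh _ _ _ (Or.inl (Or.inl ⟨e, he, rfl⟩))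
  -- Arcs of weight 1 and -1 in opposite directions force the increment to be exactly 1.
  have hone : ∀ e, IsBoundary R e ∨ e ∈ X₁ ∨ e ∈ X₂ → e ∉ heightTiling R h := by
    intro e he heT
    obtain ⟨heR, hne⟩ := Finset.mem_filter.1 heT
    have h1 := hh e.tgt e.src (-1) (Or.inl (Or.inr ⟨e, he, rfl⟩))
    have h2 := hle e heR
    omega
  have hmem : ∀ t ∈ R, ∀ e ∈ t.edges, e ∈ regionEdges R := fun t ht e he =>
    Finset.mem_biUnion.2 ⟨t, ht, he⟩
  have hex : ∀ t ∈ R, ∃! l : Edge, l ∈ heightTiling R h ∧ l ∈ t.edges := by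
    intro t ht
    have hall : ∀ e ∈ t.edges, h e.tgt - h e.src ≤ 1 ∧ (3 : ℤ) ∣ h e.tgt - h e.src - 1 ∧
        (e ∈ heightTiling R h ↔ h e.tgt - h e.src ≠ 1) := fun e he =>
      ⟨hle e (hmem t ht e he), h3 e (hmem t ht e he), by simp [heightTiling, hmem t ht e he]⟩
    have hsum := t.sum_edges h
    obtain ⟨a, b, c, hab, hac, hbc, habc⟩ := Finset.card_eq_three.1 t.card_edges
    rw [habc] at hall hsum ⊢
    rw [Finset.sum_insert (by simp [hab, hac]), Finset.sum_insert (by simp [hbc]),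
      Finset.sum_singleton] at hsum
    obtain ⟨a1, a2, a3⟩ := hall a (by simp)
    obtain ⟨b1, b2, b3⟩ := hall b (by simp)
    obtain ⟨c1, c2, c3⟩ := hall c (by simp)
    have huniq : ∀ l m n : Edge, l ∈ heightTiling R h → m ∉ heightTiling R h →
        n ∉ heightTiling R h → ∀ s : Finset Edge, (∀ e, e ∈ s ↔ e = l ∨ e = m ∨ e = n) →
        ∃! l : Edge, l ∈ heightTiling R h ∧ l ∈ s := by
      intro l m n hl hm hn s hs
      refine ⟨l, ⟨hl, (hs l).2 (Or.inl rfl)⟩, ?_⟩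
      rintro e ⟨he, hes⟩
      rcases (hs e).1 hes with rfl | rfl | rfl
      exacts [rfl, absurd he hm, absurd he hn]
    by_cases ha : a ∈ heightTiling R h
    · have := a3.1 ha
      refine huniq a b c ha ?_ ?_ _ (by simp)
      · rw [b3]; omega
      · rw [c3]; omega
    · by_cases hb : b ∈ heightTiling R h
      · have := b3.1 hb
        refine huniq b a c hb ha ?_ _ (fun e => by simp; tauto)
        rw [c3]; omega
      · refine huniq c a b ?_ ha hb _ (fun e => by simp; tauto)
        rw [a3] at ha; rw [b3] at hb; rw [c3]; omega
  refine ⟨⟨fun l hl => ?_, hex⟩, fun e he => hone e (Or.inr (by simpa using he)), ?_⟩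
  · by_contra hi
    exact hone l (Or.inl ⟨(Finset.mem_filter.1 hl).1, hi⟩) hl
  · intro e he
    have heT := hone e (Or.inr (Or.inr he))
    obtain ⟨hl, hu⟩ := isInterior_iff.1 (hX₂ e he)
    obtain ⟨n1, n2⟩ := Edge.common_neighbor_iff.2 (Or.inl (rfl : e.lowerApex = _))
    obtain ⟨n3, n4⟩ := Edge.common_neighbor_iff.2 (Or.inr (rfl : e.upperApex = _))
    -- The weight-0 arcs in both directions make the heights of the two apexes equal.
    have q1 := hh _ _ 0 (Or.inr ⟨e, he, _, _, e.lowerApex_ne_upperApex, n1, n2, n3, n4, rfl⟩)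
    have q2 := hh _ _ 0 (Or.inr ⟨e, he, _, _, e.lowerApex_ne_upperApex.symm, n3, n4, n1, n2, rfl⟩)
    obtain ⟨a1, a2, a3, a4⟩ := e.tgt_apex
    have hval : ∀ l ∈ heightTiling R h, h l.tgt - h l.src ≠ 1 := fun l hl =>
      (Finset.mem_filter.1 hl).2
    have he1 : h e.tgt - h e.src = 1 := by
      by_contra hne
      exact heT (Finset.mem_filter.2 ⟨(hX₂ e he).mem_regionEdges, hne⟩)
    have b1 := h3 _ (hmem _ hl (e.tgt, e.2 + 1) (by simp [e.lower_edges]))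
    have b2 := h3 _ (hmem _ hl (e.lowerApex, e.2 + 2) (by simp [e.lower_edges]))
    have b1' := hle _ (hmem _ hl (e.tgt, e.2 + 1) (by simp [e.lower_edges]))
    have b2' := hle _ (hmem _ hl (e.lowerApex, e.2 + 2) (by simp [e.lower_edges]))
    rw [a1] at b1 b1'
    rw [a2] at b2 b2'
    simp only [Edge.src] at b1 b2 b1' b2' he1
    have hd : e.2 + 1 ≠ e.2 + 2 := by
      generalize e.2 = d; revert d; decide
    -- If the orientations agreed, one overlapped edge would start at `e.tgt` and the other end at
    -- `e.src`. With the apexes at equal height, the increments of the two triangles correspond, so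
    -- a single triangle would have two overlapped edges.
    have main : ∀ l ∈ heightTiling R h, ∀ l' ∈ heightTiling R h, l ∈ e.lower.edges →
        l' ∈ e.upper.edges → l.2 ≠ l'.2 := by
      intro l hlT l' hlT' hle' hle''
      have v1 := hval l hlT
      have v2 := hval l' hlT'
      rw [e.lower_edges] at hle'
      rw [e.upper_edges] at hle''
      simp only [Finset.mem_insert, Finset.mem_singleton] at hle' hle''
      rcases hle' with rfl | rfl | rfl
      · exact absurd hlT heT
      · rcases hle'' with rfl | rfl | rfl
        · exact absurd hlT' heT
        · exact hd
        · rw [a1] at v1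
          rw [a4] at v2
          simp only [Edge.src] at v1 v2
          omega
      · rcases hle'' with rfl | rfl | rfl
        · exact absurd hlT' heT
        · rw [a2] at v1
          rw [a3] at v2
          simp only [Edge.src] at v1 v2
          omega
        · exact hd.symm
    intro t t' htt' ht ht' l hl l' hl' hlt hlt'
    rcases Edge.mem_edges_iff.1 ht with rfl | rfl <;>
    rcases Edge.mem_edges_iff.1 ht' with rfl | rfl
    · exact absurd rfl htt'
    · exact main l hl l' hl' hlt hlt'
    · exact (main l' hl' l hl hlt' hlt).symm
    · exact absurd rfl htt'

/-- The colour of a vertex modulo `3` changes along every arc by the weight of the arc. -/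
theorem three_dvd_of_mem_dcArcs {R : Finset Tri} {X₁ X₂ : Finset Edge} {u v : Vertex} {w : ℤ}
    (h : (u, v, w) ∈ dcArcs R X₁ X₂) : (3 : ℤ) ∣ (v.1 + v.2) - (u.1 + u.2) - w := by
  -- The coordinate sum changes by 1, 1 or -2 in the three positive directions.
  have key : ∀ e : Edge, (3 : ℤ) ∣ (e.tgt.1 + e.tgt.2) - (e.src.1 + e.src.2) - 1 := by
    rintro ⟨⟨x, y⟩, d⟩
    fin_cases d <;> simp [Edge.tgt, Edge.src, dirVec]
    omega
  rcases h with (⟨e, he, ha⟩ | ⟨e, he, ha⟩) | ⟨e, he, w₁, w₂, hw, h1, h2, h3, h4, ha⟩ <;>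
    obtain ⟨rfl, rfl, rfl⟩ := by simpa using ha
  · exact key e
  · have := key e; omega
  · have a1 := key (e.tgt, e.2 + 1)
    have a2 := key (e.tgt, e.2 + 2)
    rw [e.tgt_apex.1] at a1
    rw [e.tgt_apex.2.2.1] at a2
    simp only [Edge.src] at a1 a2
    rcases Edge.common_neighbor_iff.1 ⟨h1, h2⟩ with rfl | rfl <;>
    rcases Edge.common_neighbor_iff.1 ⟨h3, h4⟩ with rfl | rfl <;> omega

/-! ### Total correctness with time bounds -/

@[simp] theorem Store.setVar_var (s : Store) (x : ℕ) (k : ℤ) (y : ℕ) :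
    (s.setVar x k).var y = if y = x then k else s.var y := by
  simp [Store.setVar, Function.update_apply]

@[simp] theorem Store.setVar_arr (s : Store) (x : ℕ) (k : ℤ) : (s.setVar x k).arr = s.arr := rfl

@[simp] theorem Store.setArr_var (s : Store) (a : ℕ) (i k : ℤ) : (s.setArr a i k).var = s.var := rfl

@[simp] theorem Store.setArr_arr (s : Store) (a : ℕ) (i k : ℤ) (b : ℕ) (j : ℤ) :
    (s.setArr a i k).arr b j = if b = a ∧ j = i then k else s.arr b j := by
  by_cases h : b = a
  · subst h; simp [Store.setArr, Function.update_apply]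
  · simp [Store.setArr, h]

theorem Store.setArr_arr_of_ne (s : Store) {a b : ℕ} (i k : ℤ) (h : b ≠ a) :
    (s.setArr a i k).arr b = s.arr b := by
  simp [Store.setArr, h]

/-- Started in `s`, the program halts within `n` steps in a store that satisfies `Q`. -/
def Cmd.Within (c : Cmd) (s : Store) (n : ℕ) (Q : Store → Prop) : Prop :=
  ∃ m s', m ≤ n ∧ Run c s m s' ∧ Q s'

namespace Cmd

variable {c d : Cmd} {s : Store} {m n n' : ℕ} {Q Q' : Store → Prop}

theorem Within.mono (h : c.Within s n Q) (hn : n ≤ n') (hQ : ∀ s', Q s' → Q' s') :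
    c.Within s n' Q' := by
  obtain ⟨m, s', hm, hr, hq⟩ := h
  exact ⟨m, s', hm.trans hn, hr, hQ s' hq⟩

theorem within_skip (h : Q s) : Cmd.skip.Within s 1 Q := ⟨1, s, le_rfl, .skip s, h⟩

theorem within_assign {x : ℕ} {e : Expr} (h : Q (s.setVar x (e.eval s))) (hn : e.cost + 1 ≤ n) :
    (Cmd.assign x e).Within s n Q := ⟨_, _, hn, .assign x e s, h⟩

theorem within_write {a : ℕ} {i e : Expr} (h : Q (s.setArr a (i.eval s) (e.eval s)))
    (hn : i.cost + e.cost + 1 ≤ n) : (Cmd.write a i e).Within s n Q :=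
  ⟨_, _, hn, .write a i e s, h⟩

theorem within_seq (h : c.Within s m fun s' => d.Within s' n Q) (hn : m + n ≤ n') :
    (Cmd.seq c d).Within s n' Q := by
  obtain ⟨k, s', hk, hr, k', s'', hk', hr', hq⟩ := h
  exact ⟨_, _, by omega, .seq hr hr', hq⟩

theorem within_ite {b : Expr} (h₁ : b.eval s ≠ 0 → c.Within s n Q)
    (h₂ : b.eval s = 0 → d.Within s n Q) (hn : b.cost + 1 + n ≤ n') :
    (Cmd.ite b c d).Within s n' Q := by
  by_cases hb : b.eval s = 0
  · obtain ⟨k, s', hk, hr, hq⟩ := h₂ hb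
    exact ⟨_, _, by omega, .ite_false hb hr, hq⟩
  · obtain ⟨k, s', hk, hr, hq⟩ := h₁ hb
    exact ⟨_, _, by omega, .ite_true hb hr, hq⟩

/-- A loop with an invariant `I` and a variant that decreases in every round. -/
theorem within_loop {b : Expr} {I : ℕ → Store → Prop}
    (hstep : ∀ k s, I k s → b.eval s ≠ 0 → ∃ k', k = k' + 1 ∧ c.Within s n (I k')) :
    ∀ k s, I k s → (Cmd.loop b c).Within s (b.cost + 1 + k * (b.cost + 1 + n))
      fun s' => b.eval s' = 0 ∧ ∃ k', I k' s' := by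
  intro k
  induction k with
  | zero =>
    intro s hs
    by_cases hb : b.eval s = 0
    · exact ⟨_, _, by omega, .loop_false hb, hb, _, hs⟩
    · obtain ⟨k', hk, _⟩ := hstep _ _ hs hb
      omega
  | succ k ih =>
    intro s hs
    by_cases hb : b.eval s = 0
    · exact ⟨_, _, by omega, .loop_false hb, hb, _, hs⟩
    · obtain ⟨k', hk, m, s', hm, hr, hs'⟩ := hstep _ _ hs hb
      obtain rfl : k' = k := by omega
      obtain ⟨m', s'', hm', hr', hq⟩ := ih s' hs'
      exact ⟨_, _, by rw [add_mul]; omega, .loop_true hb hr hr', hq⟩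

/-- The rule for counting loops; the invariant must not depend on the counter. -/
theorem within_forLt {x : ℕ} {e : Expr} {N : ℕ} {I : ℕ → Store → Prop}
    (hx : ∀ i s k, I i s → I i (s.setVar x k)) (h0 : I 0 s)
    (he : ∀ i s, I i s → e.eval s = N)
    (hstep : ∀ i < N, ∀ s, I i s → s.var x = i →
      c.Within s n fun s' => s'.var x = i ∧ I (i + 1) s')
    (hn : (N + 1) * (e.cost + n + 10) ≤ n') :
    (forLt x e c).Within s n' (I N) := by
  have h1 := within_loop (c := .seq c (.assign x (.add (.var x) (.const 1))))
    (b := .lt (.var x) e) (n := n + 4)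
    (I := fun k s => ∃ i, k + i = N ∧ s.var x = i ∧ I i s) ?_ N (s.setVar x 0)
    ⟨0, by simp, by simp, hx _ _ _ h0⟩
  · refine within_seq (m := 2) (n := (N + 1) * (e.cost + n + 10) - 2) ?_ (by
      have : 1 * 10 ≤ (N + 1) * (e.cost + n + 10) := Nat.mul_le_mul (by omega) (by omega)
      omega)
    refine within_assign ?_ (by simp [Expr.cost])
    refine h1.mono ?_ ?_
    · simp only [Expr.cost]
      have : (N + 1) * (e.cost + n + 10) = N * (1 + e.cost + 1 + 1 + (n + 4))
        + N * 3 + (e.cost + n + 10) := by ring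
      omega
    · rintro s' ⟨hb, k, i, hki, hxi, hI⟩
      simp only [Expr.eval, hxi, he i s' hI] at hb
      have : i = N := by
        by_contra hne
        rw [if_pos (by omega)] at hb
        simp at hb
      exact this ▸ hI
  · rintro k s ⟨i, hki, hxi, hI⟩ hb
    simp only [Expr.eval, hxi, he i s hI] at hb
    have hi : i < N := by
      by_contra hne
      rw [if_neg (by omega)] at hb
      simp at hb
    refine ⟨k - 1, by omega, ?_⟩
    refine within_seq (m := n) (n := 4) ?_ le_rfl
    refine (hstep i hi s hI hxi).mono le_rfl ?_
    rintro s' ⟨hxi', hI'⟩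
    refine within_assign ⟨i + 1, by omega, ?_, hx _ _ _ hI'⟩ (by simp [Expr.cost])
    simp [Expr.eval, hxi']

end Cmd

/-! ### Bellman-Ford -/

section BellmanFord

/-- The arc number `a` can be relaxed. -/
def Relaxable (s : Store) (a : ℤ) : Prop :=
  s.arr reachedA (s.arr aSrc a) ≠ 0 ∧
    (s.arr reachedA (s.arr aDst a) = 0 ∨
      s.arr distA (s.arr aSrc a) + s.arr aWt a < s.arr distA (s.arr aDst a))

theorem within_ifRelaxable {c : Cmd} {s : Store} {n n' : ℕ} {Q : Store → Prop}
    (h₁ : Relaxable s (s.var ctrI) → c.Within s n Q) (h₂ : ¬ Relaxable s (s.var ctrI) → Q s)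
    (hn : n + 20 ≤ n') : (ifRelaxable c).Within s n' Q := by
  have hskip : ¬ Relaxable s (s.var ctrI) → Cmd.skip.Within s (n + 1) Q := fun h =>
    (Cmd.within_skip (h₂ h)).mono (by omega) fun _ h => h
  refine Cmd.within_ite (n := n + 16) (fun hr => ?_) (fun hr => ?_) (by simp [Expr.cost]; omega)
  · refine Cmd.within_ite (n := n + 12) (fun hr' => ?_) (fun hr' => ?_)
      (by simp [Expr.cost]; omega)
    · refine Cmd.within_ite (n := n + 1) (fun hl => ?_) (fun hl => ?_)
        (by simp [Expr.cost]; omega)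
      · refine (h₁ ⟨hr, Or.inr ?_⟩).mono (by omega) fun _ h => h
        by_contra hne
        simp [Expr.eval, hne] at hl
      · refine hskip ?_
        rintro ⟨_, h | h⟩
        · exact hr' h
        · simp [Expr.eval, h] at hl
    · exact (h₁ ⟨hr, Or.inl hr'⟩).mono (by omega) fun _ h => h
  · exact (hskip fun h => h.1 hr).mono (by omega) fun _ h => h

/-- `d` is the length of a walk from the source to the vertex number `i`. -/
inductive WalkLength (g : Store) : ℤ → ℤ → Prop
  | nil : WalkLength g 0 0
  | cons {a d : ℤ} : a ∈ Set.Ico 0 (g.var numA) → WalkLength g (g.arr aSrc a) d →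
      WalkLength g (g.arr aDst a) (d + g.arr aWt a)

/-- `d` is the length of a path from the source to the vertex number `i` whose set of vertices
is `S`. -/
inductive PathLength (g : Store) : Finset ℤ → ℤ → ℤ → Prop
  | nil : PathLength g {0} 0 0
  | cons {S : Finset ℤ} {a d : ℤ} : a ∈ Set.Ico 0 (g.var numA) →
      PathLength g S (g.arr aSrc a) d → g.arr aDst a ∉ S →
      PathLength g (insert (g.arr aDst a) S) (g.arr aDst a) (d + g.arr aWt a)

variable {g : Store}

theorem PathLength.mem {S : Finset ℤ} {i d : ℤ} (h : PathLength g S i d) : i ∈ S := by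
  cases h <;> simp

theorem PathLength.subset {S : Finset ℤ} {i d : ℤ} (h : PathLength g S i d)
    (hN : 0 < g.var numV)
    (hg : ∀ a ∈ Set.Ico 0 (g.var numA), g.arr aDst a ∈ Set.Ico 0 (g.var numV)) :
    S ⊆ Finset.Ico 0 (g.var numV) := by
  induction h with
  | nil => simpa using hN
  | cons ha _ _ ih => exact Finset.insert_subset (by simpa using hg _ ha) ih

/-- Cut the path at `j`: the potential bounds the length of the part after `j` from below by `H i -
H j`. -/
theorem PathLength.exists_prefix {S : Finset ℤ} {i d : ℤ} (h : PathLength g S i d) {H : ℤ → ℤ}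
    (hH : ∀ a ∈ Set.Ico 0 (g.var numA), H (g.arr aDst a) - H (g.arr aSrc a) ≤ g.arr aWt a)
    {j : ℤ} (hj : j ∈ S) : ∃ S' d', PathLength g S' j d' ∧ H i - H j ≤ d - d' := by
  induction h with
  | nil => obtain rfl := Finset.mem_singleton.1 hj; exact ⟨_, _, .nil, by simp⟩
  | @cons S a d ha hp hn ih =>
    rcases Finset.mem_insert.1 hj with rfl | hj
    · exact ⟨_, _, .cons ha hp hn, by simp⟩
    · obtain ⟨S', d', h', hd'⟩ := ih hj
      have := hH a ha
      exact ⟨S', d', h', by linarith⟩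

/-- In a graph with a feasible potential, walks can be shortened to paths. -/
theorem WalkLength.exists_path {i d : ℤ} (h : WalkLength g i d) {H : ℤ → ℤ}
    (hH : ∀ a ∈ Set.Ico 0 (g.var numA), H (g.arr aDst a) - H (g.arr aSrc a) ≤ g.arr aWt a) :
    ∃ S d', PathLength g S i d' ∧ d' ≤ d := by
  induction h with
  | nil => exact ⟨_, _, .nil, le_rfl⟩
  | @cons a d ha _ ih =>
    obtain ⟨S, d', hp, hd⟩ := ih
    by_cases hm : g.arr aDst a ∈ S
    · obtain ⟨S', d'', hp', hd'⟩ := hp.exists_prefix hH hm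
      have := hH a ha
      exact ⟨S', d'', hp', by linarith⟩
    · exact ⟨_, _, .cons ha hp hm, by linarith⟩

/-- What Bellman-Ford leaves unchanged. -/
def BFFrame (g s : Store) : Prop :=
  (∀ x, x ≠ ctrR → x ≠ ctrI → x ≠ okB → s.var x = g.var x) ∧
  ∀ a, a ≠ distA → a ≠ reachedA → s.arr a = g.arr a

theorem BFFrame.setVar {s : Store} (h : BFFrame g s) {x : ℕ} (hx : x = ctrR ∨ x = ctrI ∨ x = okB)
    (k : ℤ) : BFFrame g (s.setVar x k) := by
  refine ⟨fun y h1 h2 h3 => ?_, h.2⟩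
  rw [Store.setVar_var, if_neg (by rintro rfl; tauto)]
  exact h.1 y h1 h2 h3

theorem BFFrame.setArr {s : Store} (h : BFFrame g s) {a : ℕ} (ha : a = distA ∨ a = reachedA)
    (i k : ℤ) : BFFrame g (s.setArr a i k) := by
  refine ⟨h.1, fun b h1 h2 => ?_⟩
  rw [Store.setArr_arr_of_ne _ _ _ (by rintro rfl; tauto)]
  exact h.2 b h1 h2

/-- All finite tentative distances are lengths of walks. -/
def BFSound (g s : Store) : Prop :=
  s.arr reachedA 0 ≠ 0 ∧
  ∀ i ∈ Set.Ico 0 (g.var numV), s.arr reachedA i ≠ 0 → WalkLength g i (s.arr distA i)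

/-- The tentative distance to the vertex number `i` is at most `d`. -/
def DistLE (s : Store) (i d : ℤ) : Prop := s.arr reachedA i ≠ 0 ∧ s.arr distA i ≤ d

/-- The tentative distances are at most the lengths of the paths with at most `k + 1` vertices. -/
def BFProgress (g s : Store) (k : ℕ) : Prop :=
  ∀ S i d, PathLength g S i d → S.card ≤ k + 1 → DistLE s i d

def relaxCmd : Cmd :=
  .seq
    (.write distA (.read aDst (.var ctrI))
      (.add (.read distA (.read aSrc (.var ctrI))) (.read aWt (.var ctrI))))
    (.write reachedA (.read aDst (.var ctrI)) (.const 1))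

/-- Relaxations act in place, so a round may use distances improved in the same round. This does no
harm: soundness only asks for lengths of walks, and progress only uses that `DistLE` is never lost.
-/
theorem within_relax {s : Store} (hf : BFFrame g s) (hs : BFSound g s)
    (hg : ∀ a ∈ Set.Ico 0 (g.var numA), g.arr aSrc a ∈ Set.Ico 0 (g.var numV))
    (ha : s.var ctrI ∈ Set.Ico 0 (g.var numA)) :
    (ifRelaxable relaxCmd).Within s 40 fun s' => s'.var = s.var ∧ BFFrame g s' ∧ BFSound g s' ∧
      (∀ i d, DistLE s i d → DistLE s' i d) ∧
      ∀ d, DistLE s (g.arr aSrc (s.var ctrI)) d →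
        DistLE s' (g.arr aDst (s.var ctrI)) (d + g.arr aWt (s.var ctrI)) := by
  have e1 : s.arr aSrc = g.arr aSrc := hf.2 _ (by decide) (by decide)
  have e2 : s.arr aDst = g.arr aDst := hf.2 _ (by decide) (by decide)
  have e3 : s.arr aWt = g.arr aWt := hf.2 _ (by decide) (by decide)
  refine within_ifRelaxable (n := 20) (fun hr => ?_) (fun hr => ?_) le_rfl
  · refine Cmd.within_seq (m := 9) (n := 4) ?_ (by omega)
    refine Cmd.within_write ?_ (by simp [Expr.cost])
    refine Cmd.within_write ?_ (by simp [Expr.cost])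
    unfold Relaxable at hr
    rw [e1, e2, e3] at hr
    simp only [Expr.eval, Store.setArr_var,
      Store.setArr_arr_of_ne _ _ _ (show aDst ≠ distA by decide), e1, e2, e3]
    generalize hk : s.var ctrI = k at *
    refine ⟨trivial, (hf.setArr (Or.inl rfl) _ _).setArr (Or.inr rfl) _ _, ⟨?_, ?_⟩, ?_, ?_⟩
    · simp only [Store.setArr_arr]
      split_ifs with h1 h2
      · simp
      · simp at h2
      · exact hs.1
    · intro i hi hri
      simp only [Store.setArr_arr] at hri ⊢
      by_cases hid : i = g.arr aDst k
      · subst hid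
        simpa using WalkLength.cons ha (hs.2 _ (hg _ ha) hr.1)
      · simp [hid] at hri ⊢
        exact hs.2 i hi hri
    · rintro i d ⟨h1, h2⟩
      simp only [DistLE, Store.setArr_arr]
      by_cases hid : i = g.arr aDst k
      · subst hid
        rcases hr.2 with h | h
        · exact absurd h h1
        · simp; linarith
      · simpa [hid] using ⟨h1, h2⟩
    · rintro d ⟨h1, h2⟩
      simp [DistLE, Store.setArr_arr]
      exact h2
  · refine ⟨rfl, hf, hs, fun i d h => h, ?_⟩
    rintro d ⟨h1, h2⟩
    unfold Relaxable at hr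
    rw [e1, e2, e3] at hr
    push Not at hr
    obtain ⟨h3, h4⟩ := hr h1
    exact ⟨h3, by linarith⟩

/-- The result of Bellman-Ford on the graph that the store `g` holds. -/
structure BFResult (g s : Store) : Prop where
  frame : BFFrame g s
  sound : BFSound g s
  progress : ∀ S i d, PathLength g S i d → (S.card : ℤ) ≤ g.var numV → DistLE s i d
  ok : s.var okB = 1 ∧ (∀ a ∈ Set.Ico 0 (g.var numA), ¬ Relaxable s a) ∨
    s.var okB = 0 ∧ ∃ a ∈ Set.Ico 0 (g.var numA), Relaxable s a

theorem BFProgress.zero {s : Store} (h : DistLE s 0 0) : BFProgress g s 0 := by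
  intro S i d hp hc
  cases hp with
  | nil => exact h
  | cons ha hp hn =>
    rw [Finset.card_insert_of_notMem hn] at hc
    have := Finset.card_pos.2 ⟨_, hp.mem⟩
    omega

/-- After `k` rounds the distances are at most the lengths of the paths with at most `k + 1`
vertices. Hence `N - 1` rounds deal with all simple paths, whether or not there are negative cycles.
-/
theorem within_bellmanFord {N M : ℕ} (hN : g.var numV = N) (hM : g.var numA = M) (hpos : 0 < N)
    (hg : ∀ a ∈ Set.Ico 0 (g.var numA), g.arr aSrc a ∈ Set.Ico 0 (g.var numV)) :
    bellmanFord.Within g (1000 * (N + 1) * (M + 1)) (BFResult g) := by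
  have hNM : N + 1 ≤ (N + 1) * (M + 1) := Nat.le_mul_of_pos_right _ (by omega)
  have hMN : M + 1 ≤ (N + 1) * (M + 1) := Nat.le_mul_of_pos_left _ (by omega)
  refine Cmd.within_seq (m := 20 * ((N + 1) * (M + 1))) (n := 900 * ((N + 1) * (M + 1))) ?_
    (by rw [mul_assoc]; omega)
  refine (Cmd.within_forLt (N := N) (n := 3)
    (I := fun i s => BFFrame g s ∧ ∀ j : ℕ, j < i → s.arr reachedA j = 0)
    (fun i s k h => ⟨h.1.setVar (by simp) k, h.2⟩) ⟨⟨fun _ _ _ _ => rfl, fun _ _ _ => rfl⟩, by simp⟩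
    (fun i s h => by rw [Expr.eval, h.1.1 _ (by decide) (by decide) (by decide), hN])
    (fun i hi s h hx => Cmd.within_write ⟨hx, h.1.setArr (by simp) _ _, ?_⟩ (by simp [Expr.cost]))
    le_rfl).mono (by simp only [Expr.cost]; omega) ?_
  · intro j hj
    simp only [Expr.eval, Store.setArr_arr, hx]
    split_ifs with h1
    · rfl
    · exact h.2 j (by simp at h1; omega)
  rintro s₁ ⟨hf₁, hr₁⟩
  refine Cmd.within_seq (m := 3) (n := 800 * ((N + 1) * (M + 1))) ?_ (by omega)
  refine Cmd.within_write ?_ (by simp [Expr.cost])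
  refine Cmd.within_seq (m := 3) (n := 700 * ((N + 1) * (M + 1))) ?_ (by omega)
  refine Cmd.within_write ?_ (by simp [Expr.cost])
  simp only [Expr.eval]
  refine Cmd.within_seq (m := 600 * ((N + 1) * (M + 1))) (n := 100 * ((N + 1) * (M + 1))) ?_ (by omega)
  refine (Cmd.within_forLt (N := N - 1) (n := (M + 1) * 60)
    (I := fun k s => BFFrame g s ∧ BFSound g s ∧ BFProgress g s k)
    (fun i s k h => ⟨h.1.setVar (by simp) k, h.2⟩) ?_ ?_ ?_ le_rfl).mono ?_ ?_
  · refine ⟨(hf₁.setArr (by simp) _ _).setArr (by simp) _ _, ⟨by simp, ?_⟩,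
      BFProgress.zero ⟨by simp, by simp⟩⟩
    intro i hi hri
    by_cases hi0 : i = 0
    · subst hi0; simpa using WalkLength.nil
    · obtain ⟨j, rfl⟩ := Int.eq_ofNat_of_zero_le hi.1
      have h2 := hi.2
      rw [hN] at h2
      have := hr₁ j (by omega)
      simp_all
  · rintro i s ⟨h, _⟩
    simp only [Expr.eval]
    rw [h.1 _ (by decide) (by decide) (by decide), hN]
    omega
  · rintro k hk s ⟨hf, hs, hp⟩ hx
    refine (Cmd.within_forLt (N := M) (n := 40)
      -- Within a round, level `k` stays valid, and the arcs already scanned have passed it on to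
      -- paths with one more vertex. When all arcs are scanned this is level `k + 1`.
      (I := fun j s => s.var ctrR = k ∧ BFFrame g s ∧ BFSound g s ∧ BFProgress g s k ∧
        ∀ a ∈ Set.Ico (0 : ℤ) j, ∀ S d, PathLength g S (g.arr aSrc a) d → S.card ≤ k + 1 →
          DistLE s (g.arr aDst a) (d + g.arr aWt a))
      (fun i s k h => ⟨by simpa using h.1, h.2.1.setVar (by simp) k, h.2.2⟩)
      ⟨hx, hf, hs, hp, ?_⟩ ?_ ?_ le_rfl).mono ?_ ?_
    · rintro a ⟨h1, h2⟩; simp at h2; omega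
    · rintro i s ⟨_, h, _⟩
      rw [Expr.eval, h.1 _ (by decide) (by decide) (by decide), hM]
    · rintro j hj s ⟨hk, hf, hs, hp, hall⟩ hxj
      refine (within_relax hf hs hg (by rw [hxj, hM]; simp; omega)).mono le_rfl ?_
      rintro s' ⟨hv, hf', hs', hmono, hnew⟩
      rw [hxj] at hnew
      refine ⟨by rw [hv, hxj], by rw [hv, hk], hf', hs', ?_, ?_⟩
      · exact fun S i d h1 h2 => hmono _ _ (hp S i d h1 h2)
      · rintro a ⟨ha0, haj⟩ S d h1 h2
        by_cases haj' : a = j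
        · subst haj'
          exact hnew d (hp _ _ _ h1 h2)
        · exact hmono _ _ (hall a ⟨ha0, by push_cast at haj; omega⟩ S d h1 h2)
    · simp only [Expr.cost]; omega
    · rintro s' ⟨hk', hf', hs', hp', hall⟩
      refine ⟨hk', hf', hs', ?_⟩
      intro S i d h1 h2
      cases h1 with
      | nil => exact hp' _ _ _ .nil (by simp)
      | cons ha h1 hn =>
        rw [Finset.card_insert_of_notMem hn] at h2
        exact hall _ (by rwa [hM] at ha) _ _ h1 (by omega)
  · simp only [Expr.cost]
    have : N - 1 + 1 = N := by omega
    rw [this]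
    calc N * (1 + 1 + 1 + (M + 1) * 60 + 10) ≤ (N + 1) * ((M + 1) * 600) := by
          gcongr <;> omega
      _ = _ := by ring
  rintro s₂ ⟨hf₂, hs₂, hp₂⟩
  have hprog : ∀ S i d, PathLength g S i d → (S.card : ℤ) ≤ g.var numV → DistLE s₂ i d :=
    fun S i d h1 h2 => hp₂ S i d h1 (by omega)
  refine Cmd.within_seq (m := 2) (n := 90 * ((N + 1) * (M + 1))) ?_ (by omega)
  refine Cmd.within_assign ?_ (by simp [Expr.cost])
  simp only [Expr.eval]
  refine (Cmd.within_forLt (N := M) (n := 30)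
    (I := fun j s => BFFrame g s ∧ s.arr = s₂.arr ∧
      (s.var okB = 1 ∧ (∀ a ∈ Set.Ico (0 : ℤ) j, ¬ Relaxable s₂ a) ∨
        s.var okB = 0 ∧ ∃ a ∈ Set.Ico 0 (g.var numA), Relaxable s₂ a))
    (fun i s k h => ⟨h.1.setVar (by simp) k, h.2.1, by simpa using h.2.2⟩) ?_ ?_ ?_ le_rfl).mono ?_ ?_
  · refine ⟨hf₂.setVar (by simp) _, rfl, Or.inl ⟨by simp, ?_⟩⟩
    rintro a ⟨h1, h2⟩; simp at h2; omega
  · rintro i s ⟨h, _⟩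
    rw [Expr.eval, h.1 _ (by decide) (by decide) (by decide), hM]
  · rintro j hj s ⟨hf, harr, hor⟩ hxj
    have hrel : Relaxable s (s.var ctrI) ↔ Relaxable s₂ j := by
      rw [hxj]; unfold Relaxable; rw [harr]
    refine within_ifRelaxable (n := 2) (fun hr => ?_) (fun hr => ?_) (by omega)
    · refine Cmd.within_assign ?_ (by simp [Expr.cost])
      refine ⟨by simpa using hxj, hf.setVar (by simp) _, harr, Or.inr ⟨by simp [Expr.eval], ?_⟩⟩
      exact ⟨j, by rw [hM]; simp; omega, hrel.1 hr⟩
    · refine ⟨hxj, hf, harr, ?_⟩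
      rcases hor with ⟨h1, h2⟩ | h
      · refine Or.inl ⟨h1, ?_⟩
        rintro a ⟨ha0, haj⟩
        by_cases haj' : a = j
        · subst haj'; rwa [← hrel]
        · exact h2 a ⟨ha0, by push_cast at haj; omega⟩
      · exact Or.inr h
  · simp only [Expr.cost]; omega
  · rintro s ⟨hf, harr, hor⟩
    have hrel : ∀ a, Relaxable s a ↔ Relaxable s₂ a := by
      intro a; unfold Relaxable; rw [harr]
    refine ⟨hf, ?_, ?_, ?_⟩
    · unfold BFSound; rw [harr]; exact hs₂
    · unfold DistLE; rw [harr]; exact hprog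
    · simp only [hrel]
      rw [hM] at hor ⊢
      exact hor

/-- With a feasible potential, Bellman-Ford finds no negative cycle. -/
theorem BFResult.not_relaxable {s : Store} (h : BFResult g s) (hN : 0 < g.var numV)
    (hg : ∀ a ∈ Set.Ico 0 (g.var numA),
      g.arr aSrc a ∈ Set.Ico 0 (g.var numV) ∧ g.arr aDst a ∈ Set.Ico 0 (g.var numV))
    {H : ℤ → ℤ}
    (hH : ∀ a ∈ Set.Ico 0 (g.var numA), H (g.arr aDst a) - H (g.arr aSrc a) ≤ g.arr aWt a)
    {a : ℤ} (ha : a ∈ Set.Ico 0 (g.var numA)) : ¬ Relaxable s a := by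
  have e1 : s.arr aSrc = g.arr aSrc := h.frame.2 _ (by decide) (by decide)
  have e2 : s.arr aDst = g.arr aDst := h.frame.2 _ (by decide) (by decide)
  have e3 : s.arr aWt = g.arr aWt := h.frame.2 _ (by decide) (by decide)
  rintro ⟨h1, h2⟩
  rw [e1, e2, e3] at h2
  rw [e1] at h1
  -- Relaxing `a` would extend a walk to the head of `a`. That walk shortens to a simple path with
  -- at most `numV` vertices, whose length the tentative distance does not exceed, so nothing would
  -- be gained.
  obtain ⟨S, d, hp, hd⟩ := (WalkLength.cons ha (h.sound.2 _ (hg a ha).1 h1)).exists_path hH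
  have hcard := Finset.card_le_card (hp.subset hN fun a ha => (hg a ha).2)
  rw [Int.card_Ico] at hcard
  obtain ⟨h3, h4⟩ := h.progress S _ d hp (by omega)
  rcases h2 with h2 | h2
  · exact h3 h2
  · linarith

end BellmanFord

/-! ### Lists in memory -/

namespace Cmd

variable {d : Cmd} {s : Store} {n : ℕ} {Q : Store → Prop}

theorem Within.le {c : Cmd} {n' : ℕ} (h : c.Within s n Q) (hn : n ≤ n') : c.Within s n' Q :=
  h.mono hn fun _ h => h

theorem within_assign_seq {x : ℕ} {e : Expr} (h : d.Within (s.setVar x (e.eval s)) n Q) :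
    (Cmd.seq (.assign x e) d).Within s (e.cost + 1 + n) Q :=
  within_seq (within_assign h le_rfl) le_rfl

theorem within_write_seq {a : ℕ} {i e : Expr}
    (h : d.Within (s.setArr a (i.eval s) (e.eval s)) n Q) :
    (Cmd.seq (.write a i e) d).Within s (i.cost + e.cost + 1 + n) Q :=
  within_seq (within_write h le_rfl) le_rfl

end Cmd

/-- The register `n` holds the length of the list `l`, and the arrays `a`, `b`, `c` its entries. -/
def StoresList {k : ℕ} (s : Store) (n a b c : ℕ) (l : List (Vertex × Fin k)) : Prop :=
  s.var n = l.length ∧ ∀ (i : ℕ) (hi : i < l.length),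
    s.arr a i = l[i].1.1 ∧ s.arr b i = l[i].1.2 ∧ s.arr c i = ((l[i].2 : ℕ) : ℤ)

/-- Choosing a position for every element gives an injection between sets of equal size. It is a
bijection, so every position holds exactly one element. -/
theorem Lists.exists_list {k : ℕ} {s : Store} {n a b c : ℕ} {S : Finset (Vertex × Fin k)}
    (h : Lists s n a b c S) :
    ∃ l : List (Vertex × Fin k), l.Nodup ∧ l.toFinset = S ∧ StoresList s n a b c l := by
  obtain ⟨hn, hS⟩ := h
  have hex : ∀ e : S, ∃ i : Fin S.card,
      s.arr a (i : ℕ) = e.1.1.1 ∧ s.arr b (i : ℕ) = e.1.1.2 ∧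
        s.arr c (i : ℕ) = ((e.1.2 : ℕ) : ℤ) := fun e => by
    obtain ⟨i, hi, h⟩ := (hS e.1).1 e.2
    exact ⟨⟨i, hi⟩, h⟩
  choose f hf using hex
  have hinj : Function.Injective f := by
    intro e e' he
    have h1 := hf e
    have h2 := hf e'
    rw [he] at h1
    obtain ⟨h3, h4, h5⟩ := h1
    rw [h2.1] at h3; rw [h2.2.1] at h4; rw [h2.2.2] at h5
    refine Subtype.ext (Prod.ext (Prod.ext h3.symm h4.symm) (Fin.ext ?_))
    exact_mod_cast h5.symm
  have hbij : Function.Bijective f :=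
    (Fintype.bijective_iff_injective_and_card f).2 ⟨hinj, by simp⟩
  let g := Equiv.ofBijective f hbij
  have hg : ∀ i, f (g.symm i) = i := fun i => g.apply_symm_apply i
  refine ⟨List.ofFn fun i => (g.symm i).1, ?_, ?_, ?_, ?_⟩
  · exact List.nodup_ofFn.2 (Subtype.val_injective.comp g.symm.injective)
  · ext e
    rw [List.mem_toFinset, List.mem_ofFn]
    constructor
    · rintro ⟨i, rfl⟩; exact (g.symm i).2
    · intro he; exact ⟨g ⟨e, he⟩, by simp⟩
  · simp [hn]
  · intro i hi
    have hi' : i < S.card := by simpa using hi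
    have := hf (g.symm ⟨i, hi'⟩)
    rw [hg] at this
    simpa using this

theorem StoresList.congr {k : ℕ} {s s' : Store} {n a b c : ℕ} {l : List (Vertex × Fin k)}
    (h : StoresList s n a b c l) (hn : s'.var n = s.var n)
    (habc : ∀ i : ℕ, i < l.length → s'.arr a i = s.arr a i ∧ s'.arr b i = s.arr b i ∧
      s'.arr c i = s.arr c i) : StoresList s' n a b c l := by
  refine ⟨hn.trans h.1, fun i hi => ?_⟩
  obtain ⟨h1, h2, h3⟩ := habc i hi
  rw [h1, h2, h3]
  exact h.2 i hi

/-- The registers `r`, `r + 1`, `r + 2` hold the item `e`. -/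
def ItemAt {k : ℕ} (s : Store) (r : ℕ) (e : Vertex × Fin k) : Prop :=
  s.var r = e.1.1 ∧ s.var (r + 1) = e.1.2 ∧ s.var (r + 2) = ((e.2 : ℕ) : ℤ)

/-- For every item of a list, load it into the registers `20`, `21`, `22` and run `body`. -/
def forItems (n a b c : ℕ) (body : Cmd) : Cmd :=
  .forLt 30 (.var n) (.seq (.assign 20 (.read a (.var 30))) (.seq (.assign 21 (.read b (.var 30)))
    (.seq (.assign 22 (.read c (.var 30))) body)))

theorem within_forItems {k n a b c m : ℕ} {body : Cmd} {l : List (Vertex × Fin k)} {s : Store}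
    {I : ℕ → Store → Prop}
    (hx : ∀ i s x v, 20 ≤ x → I i s → I i (s.setVar x v))
    (hl : ∀ i s, I i s → StoresList s n a b c l) (h0 : I 0 s)
    (hstep : ∀ (i : ℕ) (hi : i < l.length) (s : Store), I i s → ItemAt s 20 l[i] →
      body.Within s m fun s' => s'.var 30 = s.var 30 ∧ I (i + 1) s') :
    (forItems n a b c body).Within s ((l.length + 1) * (m + 20)) (I l.length) := by
  refine Cmd.within_forLt (N := l.length) (n := 9 + m) (fun i s k h => hx i s 30 k (by simp) h) h0
    (fun i s h => (hl i s h).1) ?_ (Nat.mul_le_mul_left _ (by simp only [Expr.cost]; omega))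
  intro i hi s hI hs
  obtain ⟨h1, h2, h3⟩ := (hl i s hI).2 i hi
  apply Cmd.Within.le
  · apply Cmd.within_assign_seq
    apply Cmd.within_assign_seq
    apply Cmd.within_assign_seq
    refine (hstep i hi _ (hx i _ 22 _ (by simp) <| hx i _ 21 _ (by simp) <|
      hx i _ 20 _ (by simp) hI) ?_).mono le_rfl ?_
    · simp [ItemAt, Expr.eval, hs, h1, h2, h3]
    · rintro s' ⟨h, hI'⟩
      exact ⟨by simpa [hs] using h, hI'⟩
  · simp only [Expr.cost]; omega

/-! ### Linear search with a sentinel -/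

/-- Search the arrays `a`, `b`, `c` for the key in the registers `11`, `12`, `13`, after having
stored it behind the `n` entries; the position is returned in the register `14`. -/
def findCmd (a b c n : ℕ) : Cmd :=
  .seq (.write a (.var n) (.var 11)) (.seq (.write b (.var n) (.var 12))
    (.seq (.write c (.var n) (.var 13)) (.seq (.assign 14 (.const 0))
      (.loop (.lt (.add (.add (.eq (.read a (.var 14)) (.var 11)) (.eq (.read b (.var 14)) (.var 12)))
          (.eq (.read c (.var 14)) (.var 13))) (.const 3))
        (.assign 14 (.add (.var 14) (.const 1)))))))

/-- The store after the key has been put behind the `N` entries. -/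
def withKey (s : Store) (a b c : ℕ) (N : ℤ) : Store :=
  ((s.setArr a N (s.var 11)).setArr b N (s.var 12)).setArr c N (s.var 13)

def KeyAt (s : Store) (a b c : ℕ) (i : ℤ) : Prop :=
  s.arr a i = s.var 11 ∧ s.arr b i = s.var 12 ∧ s.arr c i = s.var 13

/-- The key stored at position `N` makes the loop stop. That it is really found there is the
hypothesis `hkey`, because the arrays may coincide, as they do in `internCmd`, and the third write
may then overwrite the second. -/
theorem within_find {a b c n N : ℕ} {s : Store} (hn : s.var n = N)
    (hkey : KeyAt (withKey s a b c N) a b c N) :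
    (findCmd a b c n).Within s (30 * (N + 1)) fun s' => ∃ i : ℕ, i ≤ N ∧
      s' = (withKey s a b c N).setVar 14 i ∧ KeyAt (withKey s a b c N) a b c i ∧
      ∀ j : ℕ, j < i → ¬ KeyAt (withKey s a b c N) a b c j := by
  set s₁ := withKey s a b c N with hs₁
  unfold findCmd
  apply Cmd.Within.le
  · apply Cmd.within_write_seq
    apply Cmd.within_write_seq
    apply Cmd.within_write_seq
    apply Cmd.within_assign_seq (n := 17 + N * 21)
    refine (Cmd.within_loop (n := 4)
      (I := fun k s' => ∃ i : ℕ, k + i = N ∧ s' = s₁.setVar 14 i ∧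
        ∀ j : ℕ, j < i → ¬ KeyAt s₁ a b c j) ?_ N _ ⟨0, by simp, ?_, by simp⟩).mono ?_ ?_
    · rintro k s' ⟨i, hki, rfl, hj⟩ hb
      have hi : ¬ KeyAt s₁ a b c i := by
        rintro ⟨h1, h2, h3⟩
        simp [Expr.eval, h1, h2, h3] at hb
      have hiN : i ≠ N := by
        rintro rfl; exact hi hkey
      refine ⟨k - 1, by omega, Cmd.within_assign ⟨i + 1, by omega, ?_, ?_⟩ (by simp [Expr.cost])⟩
      · simp [Expr.eval, Store.setVar]
      · intro j hji
        rcases Nat.lt_succ_iff_lt_or_eq.1 hji with h | rfl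
        exacts [hj j h, hi]
    · simp only [Expr.eval, Store.setArr_var, hs₁, withKey, hn, Nat.cast_zero]
    · simp [Expr.cost]
    · rintro s' ⟨hb, k, i, hki, rfl, hj⟩
      refine ⟨i, by omega, rfl, ?_, hj⟩
      by_contra hne
      have hb' : ∀ x y z : ℤ, (if s₁.arr a i = s₁.var 11 then (1 : ℤ) else 0) = x →
          (if s₁.arr b i = s₁.var 12 then (1 : ℤ) else 0) = y →
          (if s₁.arr c i = s₁.var 13 then (1 : ℤ) else 0) = z → ¬ x + y + z < 3 := by
        rintro _ _ _ rfl rfl rfl hlt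
        simp [Expr.eval, hlt] at hb
      have := hb' _ _ _ rfl rfl rfl
      apply this
      unfold KeyAt at hne
      split_ifs <;> omega
  · simp only [Expr.cost]; omega

/-! ### The graph in memory -/

/-- Find the vertex in the registers `11`, `12`, or append it. -/
def internCmd : Cmd :=
  .seq (.assign 13 (.var 12)) (.seq (findCmd vx vy vy numV)
    (.ite (.lt (.var 14) (.var numV)) .skip (.assign numV (.add (.var numV) (.const 1)))))

/-- The field `old` keeps the vertex numbers in arcs already stored meaningful. The clause `p ∈ V →
N' = N` lets `extract` use the same program as a mere lookup. -/
structure InternPost (s s' : Store) (V : Finset Vertex) (p : Vertex) (N : ℕ) : Prop where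
  num : ∃ N' : ℕ, s'.var numV = N' ∧ N ≤ N' ∧ N' ≤ N + 1 ∧ (p ∈ V → N' = N)
  index : s'.var 14 ∈ Set.Ico 0 (s'.var numV)
  at_index : vertexAt s' (s'.var 14) = p
  bij : Set.BijOn (vertexAt s') (Set.Ico 0 (s'.var numV)) (insert p V : Finset Vertex)
  old : ∀ j ∈ Set.Ico (0 : ℤ) N, vertexAt s' j = vertexAt s j
  var : ∀ x, x ≠ numV → x ≠ 13 → x ≠ 14 → s'.var x = s.var x
  arr : ∀ a, a ≠ vx → a ≠ vy → s'.arr a = s.arr a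

/-- The pair of coordinates is searched as a triple with the second coordinate repeated. If the
search stops at the sentinel, the new vertex is already in place at position `N`, and only the
counter has to grow. -/
theorem within_intern {s : Store} {V : Finset Vertex} {p : Vertex} {N : ℕ} (hN : s.var numV = N)
    (hV : Set.BijOn (vertexAt s) (Set.Ico 0 N) V) (hp : s.var 11 = p.1 ∧ s.var 12 = p.2) :
    internCmd.Within s (30 * (N + 2)) fun s' => InternPost s s' V p N := by
  unfold internCmd
  refine Cmd.Within.le (Cmd.within_assign_seq (n := 30 * (N + 1) + 9)
    (Cmd.within_seq (n := 9) ((within_find (N := N) (by simpa using hN) ?_).mono le_rfl ?_) le_rfl))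
    ?_
  · simp [KeyAt, withKey, Expr.eval]
  · rintro s' ⟨i, hi, rfl, hk, hj⟩
    set s₁ := withKey (s.setVar 13 ((Expr.var 12).eval s)) vx vy vy N with hs₁
    have hvar : ∀ x, x ≠ 13 → s₁.var x = s.var x := by
      intro x hx; simp [hs₁, withKey, hx]
    have harr : ∀ a, a ≠ vx → a ≠ vy → s₁.arr a = s.arr a := by
      intro a h1 h2
      simp only [hs₁, withKey]
      rw [Store.setArr_arr_of_ne _ _ _ h2, Store.setArr_arr_of_ne _ _ _ h2,
        Store.setArr_arr_of_ne _ _ _ h1, Store.setVar_arr]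
    have hold : ∀ j : ℤ, j ≠ N → vertexAt s₁ j = vertexAt s j := by
      intro j hj
      simp [vertexAt, hs₁, withKey, hj]
    have hkv : ∀ j : ℤ, KeyAt s₁ vx vy vy j ↔ vertexAt s₁ j = p := by
      intro j
      simp [KeyAt, vertexAt, hs₁, withKey, Expr.eval, hp.1, hp.2, Prod.ext_iff]
    have hnum : s₁.var numV = N := by rw [hvar _ (by decide), hN]
    have hEq : Set.EqOn (vertexAt s) (vertexAt s₁) (Set.Ico 0 N) := fun j hj =>
      (hold j hj.2.ne).symm
    have hV₁ : Set.BijOn (vertexAt s₁) (Set.Ico 0 N) V := hV.congr hEq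
    rw [hkv] at hk
    simp only [hkv] at hj
    have hva : ∀ (x : ℕ) (v : ℤ) (j : ℤ), vertexAt (s₁.setVar x v) j = vertexAt s₁ j :=
      fun _ _ _ => rfl
    refine Cmd.within_ite (n := 4) (fun hb => ?_) (fun hb => ?_) (by simp [Expr.cost])
    · have hiN : i < N := by
        by_contra hne
        simp [Expr.eval, hnum, hne] at hb
      have hpV : p ∈ V := hk ▸ hV₁.mapsTo ⟨by omega, by omega⟩
      refine (Cmd.within_skip ?_).mono (by omega) fun _ h => h
      refine ⟨⟨N, by simp [hnum], le_rfl, by omega, fun _ => rfl⟩, ?_, ?_, ?_, ?_, ?_, ?_⟩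
      · simp [hnum, hiN]
      · simpa [hva] using hk
      · rw [Finset.insert_eq_of_mem hpV]
        rw [Store.setVar_var, if_neg (by decide), hnum]
        exact hV₁
      · exact fun j hj => hold j hj.2.ne
      · intro x h1 h2 h3
        simp [h3, hvar x h2]
      · exact fun a h1 h2 => harr a h1 h2
    · have hiN : i = N := by
        by_contra hne
        have : i < N := by omega
        simp [Expr.eval, hnum, this] at hb
      subst hiN
      have hpV : p ∉ V := by
        intro hpV
        obtain ⟨j, hj1, hj2⟩ := hV₁.surjOn hpV
        obtain ⟨j, rfl⟩ := Int.eq_ofNat_of_zero_le hj1.1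
        exact hj j (by have := hj1.2; omega) hj2
      refine Cmd.within_assign ?_ (by simp [Expr.cost])
      have hnum' : ((s₁.setVar 14 (i : ℤ)).setVar numV
          ((Expr.add (.var numV) (.const 1)).eval (s₁.setVar 14 (i : ℤ)))).var numV = (i : ℤ) + 1 := by
        simp [Expr.eval, hnum]
      have h14 : ((s₁.setVar 14 (i : ℤ)).setVar numV
          ((Expr.add (.var numV) (.const 1)).eval (s₁.setVar 14 (i : ℤ)))).var 14 = (i : ℤ) := by
        simp
      refine ⟨⟨i + 1, by rw [hnum']; simp, by omega, le_rfl, fun h => absurd h hpV⟩, ?_, ?_, ?_,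
        ?_, ?_, ?_⟩
      · rw [hnum', h14]; exact ⟨by omega, by omega⟩
      · rw [h14]; exact hk
      · rw [hnum']
        have h1 : Set.Ico (0 : ℤ) (i + 1) = insert (i : ℤ) (Set.Ico 0 (i : ℤ)) := by
          ext j; simp
        rw [h1, Finset.coe_insert]
        have := hV₁.insert (a := (i : ℤ)) (by rw [hk]; exact_mod_cast hpV)
        rw [hk] at this
        exact this
      · exact fun j hj => hold j hj.2.ne
      · intro x h1 h2 h3
        simp [h1, h3, hvar x h2]
      · exact fun a h1 h2 => harr a h1 h2
  · simp only [Expr.cost]; omega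

/-- The memory holds the graph with the set of arcs `A`, listed with at most `k` entries, whose
vertices are the ends of the arcs. -/
structure GraphOf (s : Store) (A : Finset Arc) (k : ℕ) : Prop where
  holds : HoldsGraph s (endpoints A) A
  numV_le : ∃ N : ℕ, s.var numV = N ∧ N ≤ 2 * k
  numA_le : ∃ M : ℕ, s.var numA = M ∧ M ≤ k

/-- What the program `build` may change besides the graph. -/
structure BuildFrame (s s' : Store) : Prop where
  var : ∀ x, x < 3 ∨ 20 ≤ x → s'.var x = s.var x
  arr : ∀ a < 9, ∀ i : ℤ, i < s.var 0 ∨ 3 ≤ a → s'.arr a i = s.arr a i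

theorem BuildFrame.trans {s s' s'' : Store} (h : BuildFrame s s') (h' : BuildFrame s' s'') :
    BuildFrame s s'' :=
  ⟨fun x hx => (h'.var x hx).trans (h.var x hx), fun a ha i hi =>
    (h'.arr a ha i (by rwa [h.var 0 (by simp)])).trans (h.arr a ha i hi)⟩

theorem GraphOf.congr {s s' : Store} {A : Finset Arc} {k k' : ℕ} (h : GraphOf s A k)
    (h₁ : s'.var numV = s.var numV) (h₂ : s'.var numA = s.var numA)
    (h₃ : ∀ a, 9 ≤ a → s'.arr a = s.arr a) (hk : k ≤ k') : GraphOf s' A k' := by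
  obtain ⟨⟨g1, g2, g3⟩, ⟨N, hN, hNk⟩, ⟨M, hM, hMk⟩⟩ := h
  have hv : vertexAt s' = vertexAt s := by
    funext i; simp only [vertexAt, h₃ vx (by decide), h₃ vy (by decide)]
  have ha : arcAt s' = arcAt s := by
    funext i
    simp only [arcAt, hv, h₃ aSrc (by decide), h₃ aDst (by decide), h₃ aWt (by decide)]
  refine ⟨⟨?_, ?_, ?_⟩, ⟨N, h₁.trans hN, by omega⟩, ⟨M, h₂.trans hM, by omega⟩⟩
  · rw [hv, h₁]; exact g1
  · rw [h₁, h₂, h₃ aSrc (by decide), h₃ aDst (by decide)]; exact g2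
  · rw [ha, h₂]; exact g3

theorem endpoints_insert (u v : Vertex) (w : ℤ) (A : Finset Arc) :
    endpoints (insert (u, v, w) A) = insert v (insert u (endpoints A)) := by
  ext x
  simp only [endpoints, Finset.biUnion_insert, Finset.mem_union, Finset.mem_insert,
    Finset.mem_singleton]
  tauto

/-- Append an arc of weight `w` to the graph, with its ends if need be. -/
def addArcCmd (ux uy wx wy : Expr) (w : ℤ) : Cmd :=
  .seq (.assign 11 ux) (.seq (.assign 12 uy) (.seq internCmd (.seq (.assign 15 (.var 14))
    (.seq (.assign 11 wx) (.seq (.assign 12 wy) (.seq internCmd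
      (.seq (.write aSrc (.var numA) (.var 15)) (.seq (.write aDst (.var numA) (.var 14))
        (.seq (.write aWt (.var numA) (.const w))
          (.assign numA (.add (.var numA) (.const 1))))))))))))

/-- The pair of expressions has the value `p`, and depends on the registers from `20` on only. -/
def Denotes (s : Store) (x y : Expr) (p : Vertex) : Prop :=
  x.cost ≤ 20 ∧ y.cost ≤ 20 ∧
    ∀ s' : Store, (∀ z, 20 ≤ z → s'.var z = s.var z) → x.eval s' = p.1 ∧ y.eval s' = p.2

/-- Interning the head may lengthen the vertex table but moves no earlier entry, so the number of
the tail, saved in register `15`, remains correct. The coordinate expressions use only registers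
from `20` on, which interning leaves alone. -/
theorem within_addArc {s : Store} {A : Finset Arc} {k : ℕ} (hG : GraphOf s A k)
    {ux uy wx wy : Expr} {u v : Vertex} {w : ℤ} (hu : Denotes s ux uy u) (hv : Denotes s wx wy v) :
    (addArcCmd ux uy wx wy w).Within s (300 * (k + 1)) fun s' =>
      BuildFrame s s' ∧ GraphOf s' (insert (u, v, w) A) (k + 1) := by
  obtain ⟨⟨g1, g2, g3⟩, ⟨N, hN, hNk⟩, ⟨M, hM, hMk⟩⟩ := hG
  obtain ⟨hux, huy, hu⟩ := hu
  obtain ⟨hwx, hwy, hv⟩ := hv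
  rw [hN] at g1 g2
  rw [hM] at g2 g3
  unfold addArcCmd
  refine Cmd.Within.le (Cmd.within_assign_seq <| Cmd.within_assign_seq <|
    Cmd.within_seq (m := 30 * (N + 2)) (n := 70 + 30 * (N + 3))
      ((within_intern (V := endpoints A) (p := u) (N := N) ?_ ?_ ?_).mono le_rfl ?_) le_rfl) ?_
  · simpa using hN
  · exact g1
  · have e1 := (hu s fun _ _ => rfl).1
    have e2 := (hu (s.setVar 11 (ux.eval s)) fun z hz => by simp; omega).2
    exact ⟨by simpa using e1, by simpa using e2⟩
  · rintro s₁ ⟨⟨N₁, hN₁, hN₁a, hN₁b, -⟩, i1, i2, i3, i4, i5, i6⟩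
    rw [hN₁] at i1 i3
    have hvar₁ : ∀ x, x ≠ 11 → x ≠ 12 → x ≠ numV → x ≠ 13 → x ≠ 14 → s₁.var x = s.var x := by
      intro x h1 h2 h3 h4 h5
      rw [i5 x h3 h4 h5]; simp [h1, h2]
    have harr₁ : ∀ a, a ≠ vx → a ≠ vy → s₁.arr a = s.arr a := i6
    refine Cmd.Within.le (Cmd.within_assign_seq <| Cmd.within_assign_seq <|
      Cmd.within_assign_seq <| Cmd.within_seq (m := 30 * (N₁ + 2)) (n := 13)
        ((within_intern (V := insert u (endpoints A)) (p := v) (N := N₁) ?_ ?_ ?_).mono le_rfl ?_)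
        le_rfl) ?_
    · simpa using hN₁
    · exact i3
    · have e1 := (hv (s₁.setVar 15 ((Expr.var 14).eval s₁)) fun z hz => by
        rw [Store.setVar_var, if_neg (by omega)]
        exact hvar₁ z (by omega) (by omega) (by unfold numV; omega) (by omega) (by omega)).1
      have e2 := (hv ((s₁.setVar 15 ((Expr.var 14).eval s₁)).setVar 11
          (wx.eval (s₁.setVar 15 ((Expr.var 14).eval s₁)))) fun z hz => by
        rw [Store.setVar_var, if_neg (by omega), Store.setVar_var, if_neg (by omega)]
        exact hvar₁ z (by omega) (by omega) (by unfold numV; omega) (by omega) (by omega)).2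
      exact ⟨by simpa using e1, by simpa using e2⟩
    · rintro s₂ ⟨⟨N₂, hN₂, hN₂a, hN₂b, -⟩, j1, j2, j3, j4, j5, j6⟩
      rw [hN₂] at j1 j3
      have hvar₂ : ∀ x, x ≠ 11 → x ≠ 12 → x ≠ numV → x ≠ 13 → x ≠ 14 → x ≠ 15 →
          s₂.var x = s.var x := by
        intro x h1 h2 h3 h4 h5 h6
        rw [j5 x h3 h4 h5, ← hvar₁ x h1 h2 h3 h4 h5]; simp [h1, h2, h6]
      have harr₂ : ∀ a, a ≠ vx → a ≠ vy → s₂.arr a = s.arr a := fun a h1 h2 =>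
        (j6 a h1 h2).trans (harr₁ a h1 h2)
      have h15 : s₂.var 15 = s₁.var 14 := by
        rw [j5 15 (by decide) (by decide) (by decide)]
        simp [Expr.eval]
      have hM₂ : s₂.var numA = M := by
        rw [hvar₂ numA (by decide) (by decide) (by decide) (by decide) (by decide) (by decide), hM]
      refine Cmd.Within.le (Cmd.within_write_seq <| Cmd.within_write_seq <|
        Cmd.within_write_seq <| Cmd.within_assign (n := 4) ?_ (by simp [Expr.cost])) ?_
      · simp only [Expr.eval, Store.setArr_var, hM₂, h15]
        set s₃ := ((((s₂.setArr aSrc M (s₁.var 14)).setArr aDst M (s₂.var 14)).setArr aWt M w).setVar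
          numA (M + 1)) with hs₃
        have hva : vertexAt s₃ = vertexAt s₂ := by
          funext i; simp [vertexAt, hs₃]
        have hvs : ∀ j ∈ Set.Ico (0 : ℤ) N, vertexAt s₃ j = vertexAt s j := by
          rintro j ⟨h1, h2⟩
          rw [hva, j4 j ⟨h1, by omega⟩]
          exact i4 j ⟨h1, h2⟩
        have hNs : s₃.var numV = N₂ := by simp [hs₃, hN₂]
        have hMs : s₃.var numA = M + 1 := by simp [hs₃]
        have hold : ∀ j : ℤ, j < M → s₃.arr aSrc j = s.arr aSrc j ∧ s₃.arr aDst j = s.arr aDst j ∧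
            s₃.arr aWt j = s.arr aWt j := by
          intro j hj
          simp [hs₃, hj.ne, harr₂]
        have hnew : s₃.arr aSrc M = s₁.var 14 ∧ s₃.arr aDst M = s₂.var 14 ∧ s₃.arr aWt M = w := by
          simp [hs₃]
        have hsplit : Set.Ico (0 : ℤ) (M + 1) = insert (M : ℤ) (Set.Ico 0 (M : ℤ)) := by
          ext j; simp
        refine ⟨⟨?_, ?_⟩, ⟨⟨?_, ?_, ?_⟩, ⟨N₂, hNs, by omega⟩, ⟨M + 1, by simp [hMs], by omega⟩⟩⟩
        · intro x hx
          rw [hs₃, Store.setVar_var, if_neg (by unfold numA; omega)]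
          exact hvar₂ x (by omega) (by omega) (by unfold numV; omega) (by omega) (by omega) (by omega)
        · intro a ha i hi
          rw [hs₃, Store.setVar_arr, Store.setArr_arr_of_ne _ _ _ (by unfold aWt; omega),
            Store.setArr_arr_of_ne _ _ _ (by unfold aDst; omega),
            Store.setArr_arr_of_ne _ _ _ (by unfold aSrc; omega), harr₂ a (by unfold vx; omega) (by unfold vy; omega)]
        · rw [hNs, hva, endpoints_insert]
          exact j3
        · rw [hMs, hNs, hsplit]
          rintro j (rfl | hj)
          · rw [hnew.1, hnew.2.1]
            exact ⟨⟨i1.1, i1.2.trans_le (by omega)⟩, j1⟩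
          · obtain ⟨h1, h2, -⟩ := hold j hj.2
            obtain ⟨h3, h4⟩ := g2 j hj
            rw [h1, h2]
            exact ⟨⟨h3.1, h3.2.trans_le (by omega)⟩, ⟨h4.1, h4.2.trans_le (by omega)⟩⟩
        · rw [hMs, hsplit, Set.image_insert_eq, Finset.coe_insert, ← g3]
          congr 1
          · simp only [arcAt, hnew.1, hnew.2.1, hnew.2.2, hva, j2]
            rw [j4 _ i1]
            simp only [vertexAt, Store.setVar_arr] at i2 ⊢
            rw [i2]
          · refine Set.image_congr fun j hj => ?_
            obtain ⟨h1, h2, h3⟩ := hold j hj.2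
            simp only [arcAt, h1, h2, h3, hvs _ (g2 j hj).1, hvs _ (g2 j hj).2]
      · simp only [Expr.cost]; omega
    · simp only [Expr.cost]; omega
  · omega

/-! ### The program `build` -/

/-- The memory holds the instance as lists. -/
structure InputLists (s : Store) (lR : List Tri) (l₁ l₂ : List Edge) : Prop where
  region : StoresList s 0 0 1 2 lR
  bars : StoresList s 1 3 4 5 l₁
  bends : StoresList s 2 6 7 8 l₂

section

variable {s s' : Store} {lR : List Tri} {l₁ l₂ : List Edge} {A : Finset Arc} {k n : ℕ}

theorem InputLists.frame (h : InputLists s lR l₁ l₂) (hf : BuildFrame s s') :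
    InputLists s' lR l₁ l₂ := by
  refine ⟨h.region.congr (hf.var 0 (by simp)) fun i hi => ?_,
    h.bars.congr (hf.var 1 (by simp)) fun i hi => ?_,
    h.bends.congr (hf.var 2 (by simp)) fun i hi => ?_⟩
  · have hi' : (i : ℤ) < s.var 0 := by rw [h.region.1]; exact_mod_cast hi
    exact ⟨hf.arr 0 (by simp) i (Or.inl hi'), hf.arr 1 (by simp) i (Or.inl hi'),
      hf.arr 2 (by simp) i (Or.inl hi')⟩
  · exact ⟨hf.arr 3 (by simp) i (by simp), hf.arr 4 (by simp) i (by simp),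
      hf.arr 5 (by simp) i (by simp)⟩
  · exact ⟨hf.arr 6 (by simp) i (by simp), hf.arr 7 (by simp) i (by simp),
      hf.arr 8 (by simp) i (by simp)⟩

theorem InputLists.setVar (h : InputLists s lR l₁ l₂) {x : ℕ} (hx : 3 ≤ x) (v : ℤ) :
    InputLists (s.setVar x v) lR l₁ l₂ :=
  ⟨h.region.congr (by simp; omega) (by simp), h.bars.congr (by simp; omega) (by simp),
    h.bends.congr (by simp; omega) (by simp)⟩

theorem GraphOf.setVar (h : GraphOf s A k) {x : ℕ} (hx : 20 ≤ x) (v : ℤ) :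
    GraphOf (s.setVar x v) A k :=
  h.congr (by simp [numV]; omega) (by simp [numA]; omega) (fun _ _ => rfl) le_rfl

theorem Denotes.frame {x y : Expr} {p : Vertex} (h : Denotes s x y p) (hf : BuildFrame s s') :
    Denotes s' x y p :=
  ⟨h.1, h.2.1, fun s'' hs'' => h.2.2 s'' fun z hz => (hs'' z hz).trans (hf.var z (Or.inr hz))⟩

theorem ItemAt.frame {j r : ℕ} {e : Vertex × Fin j} (h : ItemAt s r e) (hr : 20 ≤ r)
    (hf : BuildFrame s s') : ItemAt s' r e := by
  obtain ⟨h1, h2, h3⟩ := h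
  exact ⟨(hf.var _ (by omega)).trans h1, (hf.var _ (by omega)).trans h2,
    (hf.var _ (by omega)).trans h3⟩

/-- One of three constants in `{-1, 0, 1}`, according to the direction in the register `r + 2`. -/
def selExpr (r : ℕ) (c : Fin 3 → ℤ) : Expr :=
  let term (d : Fin 3) : Expr :=
    if c d = 1 then .eq (.var (r + 2)) (.const (d : ℕ))
    else if c d = -1 then .sub (.const 0) (.eq (.var (r + 2)) (.const (d : ℕ)))
    else .const 0
  .add (term 0) (.add (term 1) (term 2))

/-- The coordinates of a vertex whose offset from the source of an edge depends on the direction. -/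
def offX (r : ℕ) (o : Fin 3 → Vertex) : Expr := .add (.var r) (selExpr r fun d => (o d).1)

def offY (r : ℕ) (o : Fin 3 → Vertex) : Expr := .add (.var (r + 1)) (selExpr r fun d => (o d).2)

theorem selExpr_cost (r : ℕ) (c : Fin 3 → ℤ) : (selExpr r c).cost ≤ 17 := by
  have h : ∀ d : Fin 3, (if c d = 1 then Expr.eq (.var (r + 2)) (.const (d : ℕ))
    else if c d = -1 then .sub (.const 0) (.eq (.var (r + 2)) (.const (d : ℕ)))
    else .const 0).cost ≤ 5 := by
    intro d; split_ifs <;> simp [Expr.cost]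
  have h0 := h 0
  have h1 := h 1
  have h2 := h 2
  simp only [selExpr, Expr.cost]
  omega

/-- Exactly one of the tests for the direction has the value 1. Adding, subtracting or omitting it
replaces multiplication by a coefficient, which is why coefficients are limited to -1, 0, 1. -/
theorem selExpr_eval {r : ℕ} {c : Fin 3 → ℤ} (hc : ∀ d, c d = -1 ∨ c d = 0 ∨ c d = 1) {d : Fin 3}
    (hd : s.var (r + 2) = ((d : ℕ) : ℤ)) : (selExpr r c).eval s = c d := by
  have h0 := hc 0
  have h1 := hc 1
  have h2 := hc 2
  simp only [selExpr, Expr.eval]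
  fin_cases d <;> rcases h0 with h0 | h0 | h0 <;> rcases h1 with h1 | h1 | h1 <;>
    rcases h2 with h2 | h2 | h2 <;> simp [h0, h1, h2, Expr.eval, hd]

theorem denotes_off {r : ℕ} {e : Edge} (he : ItemAt s r e) (hr : 20 ≤ r) {o : Fin 3 → Vertex}
    (ho : ∀ d, ((o d).1 = -1 ∨ (o d).1 = 0 ∨ (o d).1 = 1) ∧
      ((o d).2 = -1 ∨ (o d).2 = 0 ∨ (o d).2 = 1)) :
    Denotes s (offX r o) (offY r o) (e.1 + o e.2) := by
  obtain ⟨h1, h2, h3⟩ := he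
  refine ⟨?_, ?_, fun s' hs' => ?_⟩
  · have := selExpr_cost r fun d => (o d).1
    simp only [offX, Expr.cost]; omega
  · have := selExpr_cost r fun d => (o d).2
    simp only [offY, Expr.cost]; omega
  · have h3' : s'.var (r + 2) = ((e.2 : ℕ) : ℤ) := by rw [hs' _ (by omega), h3]
    simp only [offX, offY, Expr.eval, selExpr_eval (fun d => (ho d).1) h3',
      selExpr_eval (fun d => (ho d).2) h3', hs' r hr, hs' (r + 1) (by omega), h1, h2]
    simp

def srcOff : Fin 3 → Vertex := 0
def lowerOff : Fin 3 → Vertex := ![(0, 0), (-1, 0), (-1, -1)]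
def upperOff : Fin 3 → Vertex := ![(0, -1), (0, 0), (-1, -1)]
def lowerApexOff : Fin 3 → Vertex := ![(1, 1), (-1, 0), (0, -1)]
def upperApexOff : Fin 3 → Vertex := ![(0, -1), (1, 1), (-1, 0)]

theorem denotes_edge {r : ℕ} {e : Edge} (he : ItemAt s r e) (hr : 20 ≤ r) :
    Denotes s (offX r srcOff) (offY r srcOff) e.src ∧
    Denotes s (offX r dirVec) (offY r dirVec) e.tgt ∧
    Denotes s (offX r lowerOff) (offY r lowerOff) e.lower.1 ∧
    Denotes s (offX r upperOff) (offY r upperOff) e.upper.1 ∧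
    Denotes s (offX r lowerApexOff) (offY r lowerApexOff) e.lowerApex ∧
    Denotes s (offX r upperApexOff) (offY r upperApexOff) e.upperApex := by
  refine ⟨?_, ?_, ?_, ?_, ?_, ?_⟩
  · have := denotes_off he hr (o := srcOff) (by decide)
    simpa [srcOff, Edge.src] using this
  · exact denotes_off he hr (o := dirVec) (by decide)
  · have := denotes_off he hr (o := lowerOff) (by decide)
    convert this using 1
    obtain ⟨⟨x, y⟩, d⟩ := e
    fin_cases d <;> simp [lowerOff, Edge.lower, sub_eq_add_neg]
  · have := denotes_off he hr (o := upperOff) (by decide)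
    convert this using 1
    obtain ⟨⟨x, y⟩, d⟩ := e
    fin_cases d <;> simp [upperOff, Edge.upper, sub_eq_add_neg]
  · exact denotes_off he hr (o := lowerApexOff) (by decide)
  · exact denotes_off he hr (o := upperApexOff) (by decide)

/-- Test whether a triangle belongs to the region. -/
def testTriCmd (x y : Expr) (κ : ℤ) (c d : Cmd) : Cmd :=
  .seq (.assign 11 x) (.seq (.assign 12 y) (.seq (.assign 13 (.const κ))
    (.seq (findCmd 0 1 2 0) (.ite (.lt (.var 14) (.var 0)) c d))))

/-- The search puts its sentinel just behind the list of triangles. This is why `BuildFrame`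
protects the arrays `0`, `1`, `2` only below the length of that list. -/
theorem within_testTri (hI : StoresList s 0 0 1 2 lR) (hG : GraphOf s A k) {x y : Expr} {t : Tri}
    (ht : Denotes s x y t.1) {κ : ℤ} (hκ : κ = ((t.2 : ℕ) : ℤ)) {c d : Cmd} {Q : Store → Prop}
    (hc : t ∈ lR → ∀ s', BuildFrame s s' → GraphOf s' A k → c.Within s' n Q)
    (hd : t ∉ lR → ∀ s', BuildFrame s s' → GraphOf s' A k → d.Within s' n Q) :
    (testTriCmd x y κ c d).Within s (30 * lR.length + 100 + n) Q := by
  obtain ⟨hxc, hyc, hxy⟩ := ht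
  have e1 := (hxy s fun _ _ => rfl).1
  have e2 := (hxy (s.setVar 11 (x.eval s)) fun z hz => by simp; omega).2
  rw [e1] at e2
  unfold testTriCmd
  refine Cmd.Within.le (Cmd.within_assign_seq <| Cmd.within_assign_seq <| Cmd.within_assign_seq <|
    Cmd.within_seq (m := 30 * (lR.length + 1)) (n := 5 + n)
      ((within_find (N := lR.length) ?_ ?_).mono le_rfl ?_) le_rfl) ?_
  · simpa using hI.1
  · simp [KeyAt, withKey]
  · rintro s' ⟨i, hi, rfl, hk, hj⟩
    simp only [e1, e2, Expr.eval] at hk hj ⊢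
    set s₀ := ((s.setVar 11 t.1.1).setVar 12 t.1.2).setVar 13 κ with hs₀
    set s₁ := withKey s₀ 0 1 2 lR.length with hs₁
    have hframe : BuildFrame s (s₁.setVar 14 i) := by
      refine ⟨fun x hx => ?_, fun a ha j hj => ?_⟩
      · simp [hs₁, hs₀, withKey, show x ≠ 14 by omega, show x ≠ 11 by omega, show x ≠ 12 by omega,
          show x ≠ 13 by omega]
      · rw [hI.1] at hj
        rcases hj with hj | hj
        · simp [hs₁, hs₀, withKey, hj.ne]
        · simp [hs₁, hs₀, withKey, show a ≠ 0 by omega, show a ≠ 1 by omega, show a ≠ 2 by omega]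
    have hgraph : GraphOf (s₁.setVar 14 i) A k := by
      refine hG.congr ?_ ?_ (fun a ha => ?_) le_rfl
      · simp [hs₁, hs₀, withKey]
      · simp [hs₁, hs₀, withKey]
      · simp only [hs₁, hs₀, withKey]
        rw [Store.setVar_arr, Store.setArr_arr_of_ne _ _ _ (by omega),
          Store.setArr_arr_of_ne _ _ _ (by omega), Store.setArr_arr_of_ne _ _ _ (by omega)]
        rfl
    have hkey : ∀ (j : ℕ) (hj : j < lR.length), KeyAt s₁ 0 1 2 j ↔ lR[j] = t := by
      intro j hj
      obtain ⟨h1, h2, h3⟩ := hI.2 j hj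
      have hne : j ≠ lR.length := hj.ne
      simp only [KeyAt, hs₁, hs₀, withKey]
      simp [hne, h1, h2, h3, hκ, Prod.ext_iff, Fin.ext_iff, and_assoc]
    have h0 : (s₁.setVar 14 (i : ℤ)).var 0 = lR.length := by
      simp [hs₁, hs₀, withKey, hI.1]
    refine Cmd.within_ite (n := n) (fun hb => ?_) (fun hb => ?_) (by simp [Expr.cost])
    · have hil : i < lR.length := by
        by_contra hne
        simp only [Expr.eval, h0] at hb
        simp [hne] at hb
      refine hc ?_ _ hframe hgraph
      rw [← (hkey i hil).1 hk]
      exact List.getElem_mem hil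
    · refine hd (fun hmem => ?_) _ hframe hgraph
      obtain ⟨j, hjl, hjt⟩ := List.getElem_of_mem hmem
      have hij : ¬ j < i := fun h => hj j h ((hkey j hjl).2 hjt)
      have : i < lR.length := by omega
      simp only [Expr.eval, h0] at hb
      simp [this] at hb
  · simp only [Expr.cost]; omega

/-- Append the reverse of the edge in the registers from `r` on, with weight `-1`. -/
def addReverseCmd (r : ℕ) : Cmd :=
  addArcCmd (offX r dirVec) (offY r dirVec) (offX r srcOff) (offY r srcOff) (-1)

/-- Append the arcs of the edge in the registers from `r` on. -/
def edgeCmd (r : ℕ) : Cmd :=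
  .seq (addArcCmd (offX r srcOff) (offY r srcOff) (offX r dirVec) (offY r dirVec) 1)
    (testTriCmd (offX r lowerOff) (offY r lowerOff) 0
      (testTriCmd (offX r upperOff) (offY r upperOff) 1 .skip (addReverseCmd r))
      (addReverseCmd r))

theorem within_addReverse {r : ℕ} {e : Edge} (he : ItemAt s r e) (hr : 20 ≤ r)
    (hG : GraphOf s A k) : (addReverseCmd r).Within s (300 * (k + 1)) fun s' =>
      BuildFrame s s' ∧ GraphOf s' (insert (e.tgt, e.src, -1) A) (k + 1) :=
  within_addArc hG (denotes_edge he hr).2.1 (denotes_edge he hr).1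

theorem GraphOf.mono_right (h : GraphOf s A k) {k' : ℕ} (hk : k ≤ k') : GraphOf s A k' :=
  h.congr rfl rfl (fun _ _ => rfl) hk

theorem within_edge {r : ℕ} {e : Edge} (he : ItemAt s r e) (hr : 20 ≤ r)
    (hI : InputLists s lR l₁ l₂) (hG : GraphOf s A k) :
    (edgeCmd r).Within s (600 * k + 60 * lR.length + 2000) fun s' =>
      BuildFrame s s' ∧ GraphOf s' (edgeArcs lR.toFinset e ∪ A) (k + 2) := by
  obtain ⟨d1, d2, d3, d4, -, -⟩ := denotes_edge he hr
  refine Cmd.within_seq ((within_addArc hG d1 d2).mono le_rfl ?_)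
    (n := 300 * k + 60 * lR.length + 1500) (by omega)
  rintro s₁ ⟨hf₁, hG₁⟩
  have hI₁ := hI.frame hf₁
  have hrev : ¬ (e.lower ∈ lR ∧ e.upper ∈ lR) → ∀ s₂, BuildFrame s₁ s₂ →
      GraphOf s₂ (insert (e.src, e.tgt, 1) A) (k + 1) →
      (addReverseCmd r).Within s₂ (300 * (k + 2)) fun s' =>
        BuildFrame s s' ∧ GraphOf s' (edgeArcs lR.toFinset e ∪ A) (k + 2) := by
    intro hi s₂ hf₂ hG₂
    refine (within_addReverse (he.frame hr (hf₁.trans hf₂)) hr hG₂).mono le_rfl ?_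
    rintro s₃ ⟨hf₃, hG₃⟩
    refine ⟨(hf₁.trans hf₂).trans hf₃, ?_⟩
    have hni : ¬ IsInterior lR.toFinset e := by simpa [isInterior_iff] using hi
    convert hG₃ using 1
    simp only [edgeArcs, hni, if_false]
    ext a; simp; tauto
  refine Cmd.Within.le (within_testTri (n := 30 * lR.length + 100 + 300 * (k + 2)) hI₁.region hG₁
    (d3.frame hf₁) rfl (fun hl s₂ hf₂ hG₂ => ?_) (fun hl s₂ hf₂ hG₂ => ?_)) (by omega)
  · refine Cmd.Within.le (within_testTri (n := 300 * (k + 2)) (hI₁.frame hf₂).region hG₂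
      (d4.frame (hf₁.trans hf₂)) rfl (fun hu s₃ hf₃ hG₃ => ?_) (fun hu s₃ hf₃ hG₃ => ?_)) le_rfl
    · refine (Cmd.within_skip ⟨(hf₁.trans hf₂).trans hf₃, ?_⟩).le (by omega)
      have hi : IsInterior lR.toFinset e := by simpa [isInterior_iff] using ⟨hl, hu⟩
      convert hG₃.mono_right (Nat.le_succ _) using 1
      simp [edgeArcs, hi]
    · exact hrev (fun h => hu h.2) _ (hf₂.trans hf₃) hG₃
  · exact (hrev (fun h => hl h.1) _ hf₂ hG₂).le (by omega)

/-- The three edges of a triangle. -/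
def Tri.edgeList (t : Tri) : List Edge :=
  [((t.1.1, t.1.2), if t.2 = 0 then 0 else 1),
    ((t.1.1 + (1 - ((t.2 : ℕ) : ℤ)), t.1.2 + ((t.2 : ℕ) : ℤ)), if t.2 = 0 then 1 else 0),
    ((t.1.1 + 1, t.1.2 + 1), 2)]

theorem Tri.toFinset_edgeList (t : Tri) : t.edgeList.toFinset = t.edges := by
  obtain ⟨⟨i, j⟩, κ⟩ := t
  fin_cases κ <;> ext e <;> simp [edgeList, edges]

theorem Tri.nodup_edgeList (t : Tri) : t.edgeList.Nodup := by
  obtain ⟨⟨i, j⟩, κ⟩ := t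
  fin_cases κ <;> simp [edgeList]

/-- For the triangle in the registers `20`, `21`, `22`, load its edges one by one into the registers
`23`, `24`, `25` and run `body`. -/
def triEdgesCmd (body : Cmd) : Cmd :=
  .seq (.assign 23 (.var 20)) (.seq (.assign 24 (.var 21)) (.seq (.assign 25 (.var 22))
  (.seq body
  (.seq (.assign 23 (.add (.var 20) (.sub (.const 1) (.var 22))))
  (.seq (.assign 24 (.add (.var 21) (.var 22))) (.seq (.assign 25 (.sub (.const 1) (.var 22)))
  (.seq body
  (.seq (.assign 23 (.add (.var 20) (.const 1))) (.seq (.assign 24 (.add (.var 21) (.const 1)))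
  (.seq (.assign 25 (.const 2)) body))))))))))

theorem within_triEdges {t : Tri} {body : Cmd} {J : ℕ → Store → Prop} (h0 : J 0 s)
    (hitem : ∀ j s, J j s → ItemAt s 20 t)
    (hx : ∀ j s x v, 23 ≤ x → x < 30 → J j s → J j (s.setVar x v))
    (hstep : ∀ (j : ℕ) (hj : j < t.edgeList.length) (s : Store), J j s →
      ItemAt s 23 t.edgeList[j] → body.Within s n (J (j + 1))) :
    (triEdgesCmd body).Within s (3 * n + 50) (J 3) := by
  have hx3 : ∀ j s u v w, J j s → J j (((s.setVar 23 u).setVar 24 v).setVar 25 w) :=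
    fun j s u v w h => hx j _ 25 _ (by simp) (by simp) <| hx j _ 24 _ (by simp) (by simp) <|
      hx j _ 23 _ (by simp) (by simp) h
  -- The first edge has the kind of the triangle as its direction, the second has one minus the
  -- kind; so the machine computes both without a test.
  have hd : ((if t.2 = 0 then 0 else 1 : Fin 3) : ℕ) = (t.2 : ℕ) ∧
      (((if t.2 = 0 then 1 else 0 : Fin 3) : ℕ) : ℤ) = 1 - ((t.2 : ℕ) : ℤ) := by
    generalize t.2 = κ
    fin_cases κ <;> simp
  unfold triEdgesCmd
  refine Cmd.Within.le (Cmd.within_assign_seq <| Cmd.within_assign_seq <| Cmd.within_assign_seq <|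
    Cmd.within_seq (n := 2 * n + 30) ((hstep 0 (by simp [Tri.edgeList]) _ (hx3 0 s _ _ _ h0)
      ?_).mono le_rfl ?_) le_rfl) (by simp only [Expr.cost]; omega)
  · obtain ⟨h1, h2, h3⟩ := hitem 0 s h0
    refine ⟨?_, ?_, ?_⟩
    · simp [Tri.edgeList, Expr.eval, h1]
    · simp [Tri.edgeList, Expr.eval, h2]
    · simp only [Tri.edgeList, List.getElem_cons_zero, hd.1]
      simp [Expr.eval, h3]
  intro s₁ hs₁
  refine Cmd.Within.le (Cmd.within_assign_seq <| Cmd.within_assign_seq <| Cmd.within_assign_seq <|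
    Cmd.within_seq (n := n + 14) ((hstep 1 (by simp [Tri.edgeList]) _ (hx3 1 s₁ _ _ _ hs₁)
      ?_).mono le_rfl ?_) le_rfl) (by simp only [Expr.cost]; omega)
  · obtain ⟨h1, h2, h3⟩ := hitem 1 s₁ hs₁
    refine ⟨?_, ?_, ?_⟩
    · simp [Tri.edgeList, Expr.eval, h1, h3]
    · simp [Tri.edgeList, Expr.eval, h2, h3]
    · simp only [Tri.edgeList, List.getElem_cons_succ, List.getElem_cons_zero, hd.2]
      simp [Expr.eval, h3]
  intro s₂ hs₂
  refine Cmd.Within.le (Cmd.within_assign_seq <| Cmd.within_assign_seq <| Cmd.within_assign_seq <|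
    hstep 2 (by simp [Tri.edgeList]) _ (hx3 2 s₂ _ _ _ hs₂) ?_) (by simp only [Expr.cost]; omega)
  obtain ⟨h1, h2, h3⟩ := hitem 2 s₂ hs₂
  refine ⟨?_, ?_, ?_⟩ <;> simp [Tri.edgeList, Expr.eval, h1, h2]

theorem biUnion_take_succ {α β : Type*} [DecidableEq α] [DecidableEq β] (l : List α)
    (f : α → Finset β) {i : ℕ} (hi : i < l.length) :
    (l.take (i + 1)).toFinset.biUnion f = f l[i] ∪ (l.take i).toFinset.biUnion f := by
  rw [List.take_succ_eq_append_getElem hi, List.toFinset_append, Finset.union_biUnion,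
    Finset.union_comm]
  simp

theorem within_triangle {t : Tri} {i : ℤ} (ht : ItemAt s 20 t) (hI : InputLists s lR l₁ l₂)
    (hG : GraphOf s A k) (hi : s.var 30 = i) :
    (triEdgesCmd (edgeCmd 23)).Within s (1800 * k + 180 * lR.length + 20000) fun s' =>
      s'.var 30 = i ∧ InputLists s' lR l₁ l₂ ∧
        GraphOf s' (triArcs lR.toFinset t ∪ A) (k + 6) := by
  refine (within_triEdges (t := t) (n := 600 * (k + 4) + 60 * lR.length + 2000)
    (J := fun j s => s.var 30 = i ∧ ItemAt s 20 t ∧ InputLists s lR l₁ l₂ ∧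
      GraphOf s ((t.edgeList.take j).toFinset.biUnion (edgeArcs lR.toFinset) ∪ A) (k + 2 * j))
    ⟨hi, ht, hI, by simpa using hG⟩ (fun j s h => h.2.1) ?_ ?_).mono ?_ ?_
  · rintro j s x v h1 h2 ⟨a1, ⟨b1, b2, b3⟩, a3, a4⟩
    refine ⟨?_, ⟨?_, ?_, ?_⟩, a3.setVar (by omega) v, a4.setVar (by omega) v⟩ <;>
      rw [Store.setVar_var, if_neg (by omega)] <;> assumption
  · rintro j hj s ⟨a1, a2, a3, a4⟩ he
    have hj3 : j < 3 := hj
    refine (within_edge he (by simp) a3 a4).mono (by omega) ?_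
    rintro s' ⟨hf, hG'⟩
    refine ⟨(hf.var 30 (by simp)).trans a1, a2.frame (by simp) hf, a3.frame hf, ?_⟩
    rw [biUnion_take_succ _ _ hj, Finset.union_assoc]
    exact hG'
  · omega
  · rintro s' ⟨a1, -, a3, a4⟩
    refine ⟨a1, a3, ?_⟩
    rw [List.take_of_length_le (by simp [Tri.edgeList]), Tri.toFinset_edgeList] at a4
    exact a4

/-- Append the arcs of an edge in `X₂`. -/
def bendCmd : Cmd :=
  .seq (addReverseCmd 20)
    (.seq (addArcCmd (offX 20 lowerApexOff) (offY 20 lowerApexOff) (offX 20 upperApexOff)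
        (offY 20 upperApexOff) 0)
      (addArcCmd (offX 20 upperApexOff) (offY 20 upperApexOff) (offX 20 lowerApexOff)
        (offY 20 lowerApexOff) 0))

theorem within_bend {e : Edge} (he : ItemAt s 20 e) (hG : GraphOf s A k) :
    bendCmd.Within s (900 * (k + 3)) fun s' =>
      BuildFrame s s' ∧ GraphOf s' (bendArcs e ∪ A) (k + 3) := by
  obtain ⟨-, -, -, -, d5, d6⟩ := denotes_edge he (by simp)
  refine Cmd.within_seq ((within_addReverse he (by simp) hG).mono le_rfl ?_)
    (n := 600 * (k + 3)) (by omega)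
  rintro s₁ ⟨hf₁, hG₁⟩
  refine Cmd.within_seq ((within_addArc hG₁ (d5.frame hf₁) (d6.frame hf₁)).mono le_rfl ?_)
    (n := 300 * (k + 3)) (by omega)
  rintro s₂ ⟨hf₂, hG₂⟩
  refine (within_addArc hG₂ (d6.frame (hf₁.trans hf₂)) (d5.frame (hf₁.trans hf₂))).mono le_rfl ?_
  rintro s₃ ⟨hf₃, hG₃⟩
  refine ⟨(hf₁.trans hf₂).trans hf₃, ?_⟩
  convert hG₃ using 1
  ext a
  simp only [bendArcs, Finset.mem_union, Finset.mem_insert, Finset.mem_singleton]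
  tauto

def buildCmd : Cmd :=
  .seq (.assign numV (.const 0)) (.seq (.assign numA (.const 0))
    (.seq (forItems 0 0 1 2 (triEdgesCmd (edgeCmd 23)))
      (.seq (forItems 1 3 4 5 (addReverseCmd 20)) (forItems 2 6 7 8 bendCmd))))

/-- Entries are counted with repetition: six per triangle at most, one per edge of `X₁`, three per
edge of `X₂`, together at most `18 * lR.length`. Every entry costs linear searches in tables of size
`O(|R|)`. -/
theorem within_build (hI : InputLists s lR l₁ l₂) (h₁ : l₁.length ≤ 3 * lR.length)
    (h₂ : l₂.length ≤ 3 * lR.length) :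
    buildCmd.Within s (500000 * (lR.length + 1) ^ 2) fun s' => InputLists s' lR l₁ l₂ ∧
      GraphOf s' (dcFinset lR.toFinset l₁.toFinset l₂.toFinset) (18 * lR.length) := by
  set n := lR.length with hn
  set P := (n + 1) ^ 2 with hP
  have hPn : n + 1 ≤ P := by rw [hP]; nlinarith
  unfold buildCmd
  refine Cmd.Within.le (Cmd.within_assign_seq <| Cmd.within_assign_seq <| Cmd.within_seq
    (m := 100000 * P) (n := 300000 * P) ((within_forItems (l := lR) (m := 100000 * n + 30000)
      (I := fun i s => InputLists s lR l₁ l₂ ∧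
        GraphOf s ((lR.take i).toFinset.biUnion (triArcs lR.toFinset)) (6 * i))
      (fun i s x v hx h => ⟨h.1.setVar (by omega) v, h.2.setVar hx v⟩) (fun i s h => h.1.region)
      ?_ ?_).mono ?_ ?_) le_rfl) (by simp only [Expr.cost]; omega)
  · refine ⟨(hI.setVar (by decide) _).setVar (by decide) _, ⟨⟨?_, ?_, ?_⟩, ⟨0, ?_, by simp⟩,
      ⟨0, ?_, by simp⟩⟩⟩ <;> simp [Expr.eval, endpoints]
  · rintro i hi s ⟨a1, a2⟩ ht
    refine (within_triangle ht a1 a2 rfl).mono (by omega) ?_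
    rintro s' ⟨b1, b2, b3⟩
    refine ⟨b1, b2, ?_⟩
    rw [biUnion_take_succ _ _ hi]
    exact b3
  · calc (n + 1) * (100000 * n + 30000 + 20) ≤ (n + 1) * (100000 * (n + 1)) := by gcongr; omega
      _ = 100000 * P := by rw [hP]; ring
  rintro s₁ ⟨hI₁, hG₁⟩
  rw [List.take_length] at hG₁
  refine Cmd.within_seq (m := 100000 * P) (n := 200000 * P) ((within_forItems (l := l₁)
    (m := 300 * (9 * n + 1))
    (I := fun i s => InputLists s lR l₁ l₂ ∧
      GraphOf s ((l₁.take i).toFinset.biUnion barArcs ∪ lR.toFinset.biUnion (triArcs lR.toFinset))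
        (6 * n + i))
    (fun i s x v hx h => ⟨h.1.setVar (by omega) v, h.2.setVar hx v⟩) (fun i s h => h.1.bars)
    ⟨hI₁, by simpa using hG₁⟩ ?_).mono ?_ ?_) (by omega)
  · rintro i hi s ⟨a1, a2⟩ he
    refine (within_addReverse he (by simp) a2).mono (by omega) ?_
    rintro s' ⟨hf, b2⟩
    refine ⟨hf.var 30 (by simp), a1.frame hf, ?_⟩
    rw [biUnion_take_succ _ _ hi, Finset.union_assoc]
    exact b2
  · calc (l₁.length + 1) * (300 * (9 * n + 1) + 20) ≤ (3 * (n + 1)) * (10000 * (n + 1)) := by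
          gcongr <;> omega
      _ = 30000 * P := by rw [hP]; ring
      _ ≤ 100000 * P := by omega
  rintro s₂ ⟨hI₂, hG₂⟩
  rw [List.take_length] at hG₂
  refine (within_forItems (l := l₂) (m := 900 * (18 * n + 3))
    (I := fun i s => InputLists s lR l₁ l₂ ∧
      GraphOf s ((l₂.take i).toFinset.biUnion bendArcs ∪
        (l₁.toFinset.biUnion barArcs ∪ lR.toFinset.biUnion (triArcs lR.toFinset)))
        (9 * n + 3 * i))
    (fun i s x v hx h => ⟨h.1.setVar (by omega) v, h.2.setVar hx v⟩) (fun i s h => h.1.bends)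
    ⟨hI₂, by simpa using hG₂.mono_right (by omega)⟩ ?_).mono ?_ ?_
  · rintro i hi s ⟨a1, a2⟩ he
    refine (within_bend he a2).mono (by omega) ?_
    rintro s' ⟨hf, b2⟩
    refine ⟨hf.var 30 (by simp), a1.frame hf, ?_⟩
    rw [biUnion_take_succ _ _ hi, Finset.union_assoc]
    exact b2
  · calc (l₂.length + 1) * (900 * (18 * n + 3) + 20) ≤ (3 * (n + 1)) * (50000 * (n + 1)) := by
          gcongr <;> omega
      _ = 150000 * P := by rw [hP]; ring
      _ ≤ 200000 * P := by omega
  rintro s₃ ⟨hI₃, hG₃⟩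
  rw [List.take_length] at hG₃
  refine ⟨hI₃, ?_⟩
  convert hG₃.mono_right (k' := 18 * n) (by omega) using 1
  rw [dcFinset, Finset.union_comm, Finset.union_comm (lR.toFinset.biUnion _)]

end

/-! ### The program `extract` -/

/-- Find the number of a vertex of the graph. -/
def lookupCmd (x y : Expr) : Cmd := .seq (.assign 11 x) (.seq (.assign 12 y) internCmd)

/-- The state of `extract` when the lozenges in `S` have been written. -/
structure ExtractState (s : Store) (lR : List Tri) (V : Finset Vertex) (N : ℕ) (h : Vertex → ℤ)
    (S : Finset Edge) : Prop where
  region : StoresList s 0 0 1 2 lR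
  num : s.var numV = N
  verts : Set.BijOn (vertexAt s) (Set.Ico 0 N) V
  dist : ∀ i ∈ Set.Ico (0 : ℤ) N, s.arr distA i = h (vertexAt s i)
  out : Lists s 9 16 17 18 S
  ok : s.var solvable = 1

section

variable {s : Store} {lR : List Tri} {V : Finset Vertex} {N : ℕ} {h : Vertex → ℤ} {S : Finset Edge}

theorem Lists.congr {k : ℕ} {s s' : Store} {n a b c : ℕ} {S : Finset (Vertex × Fin k)}
    (h : Lists s n a b c S) (hn : s'.var n = s.var n) (ha : s'.arr a = s.arr a)
    (hb : s'.arr b = s.arr b) (hc : s'.arr c = s.arr c) : Lists s' n a b c S := by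
  unfold Lists
  rw [hn, ha, hb, hc]
  exact h

theorem ExtractState.setVar (hs : ExtractState s lR V N h S) {x : ℕ} (hx : 11 ≤ x) (v : ℤ) :
    ExtractState (s.setVar x v) lR V N h S := by
  refine ⟨hs.region.congr ?_ (by simp), ?_, hs.verts, hs.dist, hs.out.congr ?_ rfl rfl rfl, ?_⟩ <;>
    rw [Store.setVar_var, if_neg]
  · omega
  · exact hs.num
  · unfold numV; omega
  · omega
  · exact hs.ok
  · unfold solvable; omega

/-- Interning a vertex that is already present writes only behind the vertex table, so the numbering
and the distances survive. -/
theorem within_lookup (hs : ExtractState s lR V N h S) {x y : Expr} {p : Vertex}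
    (hp : Denotes s x y p) (hpV : p ∈ V) :
    (lookupCmd x y).Within s (30 * (N + 2) + 50) fun s' => ExtractState s' lR V N h S ∧
      (∀ z, 15 ≤ z → s'.var z = s.var z) ∧ s'.arr distA (s'.var 14) = h p := by
  obtain ⟨hxc, hyc, hxy⟩ := hp
  have e1 := (hxy s fun _ _ => rfl).1
  have e2 := (hxy (s.setVar 11 (x.eval s)) fun z hz => by simp; omega).2
  have hs₁ := (hs.setVar (x := 11) le_rfl (x.eval s)).setVar (x := 12) (by simp)
    (y.eval (s.setVar 11 (x.eval s)))
  refine Cmd.Within.le (Cmd.within_assign_seq <| Cmd.within_assign_seq <|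
    (within_intern hs₁.num hs₁.verts (p := p) ?_).mono le_rfl ?_) (by omega)
  · exact ⟨by simpa using e1, by simpa using e2⟩
  · rintro s' ⟨⟨N', hN', -, -, hNN⟩, i1, i2, i3, i4, i5, i6⟩
    obtain rfl := hNN hpV
    rw [hN'] at i1 i3
    rw [Finset.insert_eq_of_mem hpV] at i3
    have hdist : s'.arr distA = s.arr distA := i6 distA (by decide) (by decide)
    refine ⟨⟨?_, hN', i3, ?_, ?_, ?_⟩, ?_, ?_⟩
    · exact hs₁.region.congr (i5 0 (by decide) (by decide) (by decide)) fun i _ =>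
        ⟨by rw [i6 0 (by decide) (by decide)], by rw [i6 1 (by decide) (by decide)],
          by rw [i6 2 (by decide) (by decide)]⟩
    · intro i hi
      rw [hdist, i4 i hi]
      exact hs.dist i hi
    · exact hs₁.out.congr (i5 9 (by decide) (by decide) (by decide))
        (i6 16 (by decide) (by decide)) (i6 17 (by decide) (by decide))
        (i6 18 (by decide) (by decide))
    · rw [i5 solvable (by decide) (by decide) (by decide)]
      exact hs₁.ok
    · intro z hz
      rw [i5 z (by unfold numV; omega) (by omega) (by omega), Store.setVar_var,
        if_neg (by omega), Store.setVar_var, if_neg (by omega)]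
    · rw [hdist, ← i2, i4 _ i1]
      exact hs.dist _ i1

/-- Write the lozenge in the registers `23`, `24`, `25` unless the height difference is `1`. -/
def outCmd : Cmd :=
  .seq (lookupCmd (offX 23 srcOff) (offY 23 srcOff)) (.seq (.assign 15 (.read distA (.var 14)))
    (.seq (lookupCmd (offX 23 dirVec) (offY 23 dirVec))
      (.ite (.eq (.sub (.read distA (.var 14)) (.var 15)) (.const 1)) .skip
        (.seq (.write 16 (.var 9) (.var 23)) (.seq (.write 17 (.var 9) (.var 24))
          (.seq (.write 18 (.var 9) (.var 25)) (.assign 9 (.add (.var 9) (.const 1)))))))))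

theorem Lists.push {s s' : Store} {n a b c : ℕ} {S : Finset Edge} (h : Lists s n a b c S) {e : Edge}
    (he : e ∉ S) (hn : s'.var n = s.var n + 1)
    (hold : ∀ i : ℤ, i ≠ s.var n → s'.arr a i = s.arr a i ∧ s'.arr b i = s.arr b i ∧
      s'.arr c i = s.arr c i)
    (hnew : s'.arr a (s.var n) = e.1.1 ∧ s'.arr b (s.var n) = e.1.2 ∧
      s'.arr c (s.var n) = ((e.2 : ℕ) : ℤ)) : Lists s' n a b c (insert e S) := by
  obtain ⟨h1, h2⟩ := h
  rw [h1] at hn hold hnew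
  refine ⟨by rw [hn, Finset.card_insert_of_notMem he]; simp, fun x => ?_⟩
  rw [Finset.card_insert_of_notMem he, Finset.mem_insert, h2]
  have hold' : ∀ i : ℕ, i < S.card → s'.arr a i = s.arr a i ∧ s'.arr b i = s.arr b i ∧
      s'.arr c i = s.arr c i := fun i hi => hold i (by omega)
  constructor
  · rintro (rfl | ⟨i, hi, hx⟩)
    · exact ⟨S.card, Nat.lt_succ_self _, hnew⟩
    · obtain ⟨q1, q2, q3⟩ := hold' i hi
      exact ⟨i, by omega, by rw [q1, q2, q3]; exact hx⟩
  · rintro ⟨i, hi, hx⟩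
    rcases Nat.lt_succ_iff_lt_or_eq.1 hi with hi | rfl
    · obtain ⟨q1, q2, q3⟩ := hold' i hi
      rw [q1, q2, q3] at hx
      exact Or.inr ⟨i, hi, hx⟩
    · rw [hnew.1, hnew.2.1, hnew.2.2] at hx
      refine Or.inl (Prod.ext (Prod.ext hx.1.symm hx.2.1.symm) (Fin.ext ?_))
      exact_mod_cast hx.2.2.symm

theorem within_out (hs : ExtractState s lR V N h S) {e : Edge} (he : ItemAt s 23 e)
    (hsrc : e.src ∈ V) (htgt : e.tgt ∈ V) (heS : e ∉ S) :
    outCmd.Within s (60 * N + 400) fun s' => (∀ z, 20 ≤ z → s'.var z = s.var z) ∧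
      ExtractState s' lR V N h ((if h e.tgt - h e.src ≠ 1 then {e} else ∅) ∪ S) := by
  obtain ⟨d1, d2, -, -, -, -⟩ := denotes_edge he (by simp)
  unfold outCmd
  refine Cmd.within_seq ((within_lookup hs d1 hsrc).mono le_rfl ?_) (n := 30 * (N + 2) + 100)
    (by omega)
  rintro s₁ ⟨hs₁, hv₁, hd₁⟩
  have hs₂ := hs₁.setVar (x := 15) (by simp) ((Expr.read distA (.var 14)).eval s₁)
  refine Cmd.Within.le (Cmd.within_assign_seq <| Cmd.within_seq (m := 30 * (N + 2) + 50) (n := 30)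
    ((within_lookup hs₂ (p := e.tgt) ⟨d2.1, d2.2.1, fun s' hs' => d2.2.2 s' fun z hz => ?_⟩
      htgt).mono le_rfl ?_) le_rfl) (by simp only [Expr.cost]; omega)
  · rw [hs' z hz, Store.setVar_var, if_neg (by omega), hv₁ z (by omega)]
  rintro s₃ ⟨hs₃, hv₃, hd₃⟩
  have h15 : s₃.var 15 = h e.src := by
    rw [hv₃ 15 le_rfl, Store.setVar_var, if_pos rfl, ← hd₁]
    rfl
  have hv : ∀ z, 20 ≤ z → s₃.var z = s.var z := fun z hz => by
    rw [hv₃ z (by omega), Store.setVar_var, if_neg (by omega), hv₁ z (by omega)]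
  have hcond : (Expr.eq (.sub (.read distA (.var 14)) (.var 15)) (.const 1)).eval s₃ =
      if h e.tgt - h e.src = 1 then 1 else 0 := by
    simp only [Expr.eval, hd₃, h15]
  refine Cmd.within_ite (n := 20) (fun hb => ?_) (fun hb => ?_) (by simp [Expr.cost])
  · have hone : h e.tgt - h e.src = 1 := by
      by_contra hne
      simp [hcond, hne] at hb
    refine (Cmd.within_skip ⟨hv, ?_⟩).le (by omega)
    simpa [hone] using hs₃
  · have hone : h e.tgt - h e.src ≠ 1 := by
      intro hne
      simp [hcond, hne] at hb
    refine Cmd.Within.le (Cmd.within_write_seq <| Cmd.within_write_seq <|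
      Cmd.within_write_seq <| Cmd.within_assign (n := 4) ?_ (by simp [Expr.cost]))
      (by simp [Expr.cost])
    obtain ⟨b1, b2, b3⟩ := he
    have c1 : s₃.var 23 = e.1.1 := (hv 23 (by simp)).trans b1
    have c2 : s₃.var 24 = e.1.2 := (hv 24 (by simp)).trans b2
    have c3 : s₃.var 25 = ((e.2 : ℕ) : ℤ) := (hv 25 (by simp)).trans b3
    simp only [Expr.eval, Store.setArr_var, c1, c2, c3]
    set s₄ := ((((s₃.setArr 16 (s₃.var 9) e.1.1).setArr 17 (s₃.var 9) e.1.2).setArr 18 (s₃.var 9)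
      ((e.2 : ℕ) : ℤ)).setVar 9 (s₃.var 9 + 1)) with hs₄
    have harr : ∀ a, a ≠ 16 → a ≠ 17 → a ≠ 18 → s₄.arr a = s₃.arr a := by
      intro a h1 h2 h3
      rw [hs₄, Store.setVar_arr, Store.setArr_arr_of_ne _ _ _ h3, Store.setArr_arr_of_ne _ _ _ h2,
        Store.setArr_arr_of_ne _ _ _ h1]
    have hvar : ∀ x, x ≠ 9 → s₄.var x = s₃.var x := by
      intro x hx
      simp [hs₄, hx]
    have hva : vertexAt s₄ = vertexAt s₃ := by
      funext i
      simp only [vertexAt, harr vx (by decide) (by decide) (by decide),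
        harr vy (by decide) (by decide) (by decide)]
    refine ⟨fun z hz => (hvar z (by omega)).trans (hv z hz), ⟨?_, ?_, ?_, ?_, ?_, ?_⟩⟩
    · refine hs₃.region.congr (hvar 0 (by decide)) fun i hi => ?_
      rw [harr 0 (by decide) (by decide) (by decide), harr 1 (by decide) (by decide) (by decide),
        harr 2 (by decide) (by decide) (by decide)]
      exact ⟨rfl, rfl, rfl⟩
    · rw [hvar numV (by decide)]; exact hs₃.num
    · rw [hva]; exact hs₃.verts
    · rw [hva, harr distA (by decide) (by decide) (by decide)]; exact hs₃.dist
    · rw [if_pos hone, ← Finset.insert_eq]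
      refine hs₃.out.push heS (by simp [hs₄]) (fun i hi => ?_) ?_
      · simp [hs₄, hi]
      · simp [hs₄]
    · rw [hvar solvable (by decide)]; exact hs₃.ok

/-- A lozenge of the output lies in the region and thus contains exactly one triangle of kind 0 of
the region. Scanning these triangles alone meets every lozenge once, so the output has no
repetition. -/
def extractCmd : Cmd :=
  .seq (.assign solvable (.var okB)) (.ite (.var okB)
    (.seq (.assign 9 (.const 0)) (forItems 0 0 1 2
      (.ite (.eq (.var 22) (.const 0)) (triEdgesCmd outCmd) .skip)))
    .skip)

theorem within_extract_fail (hok : s.var okB = 0) :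
    extractCmd.Within s 10 fun s' => s'.var solvable = 0 := by
  refine Cmd.Within.le (Cmd.within_assign_seq <| Cmd.within_ite (n := 1) (fun hb => ?_)
    (fun _ => Cmd.within_skip ?_) le_rfl) (by simp [Expr.cost])
  · simp [Expr.eval, hok] at hb
  · simp [Expr.eval, hok]

theorem within_outTriangle (hs : ExtractState s lR V N h S) {t : Tri} {i : ℤ} (hi : s.var 30 = i)
    (ht : ItemAt s 20 t) (htV : t.verts ⊆ V) (hdisj : ∀ e ∈ t.edges, e ∉ S) :
    (triEdgesCmd outCmd).Within s (180 * N + 1300) fun s' => s'.var 30 = i ∧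
      ExtractState s' lR V N h (t.edges.filter (fun e => h e.tgt - h e.src ≠ 1) ∪ S) := by
  let f : Edge → Finset Edge := fun e => if h e.tgt - h e.src ≠ 1 then {e} else ∅
  have hf : ∀ e x, x ∈ f e ↔ x = e ∧ h e.tgt - h e.src ≠ 1 := by
    intro e x
    simp only [f]
    split_ifs with h1 <;> simp [h1]
  refine (within_triEdges (t := t) (n := 60 * N + 400)
    (J := fun j s => s.var 30 = i ∧ ItemAt s 20 t ∧
      ExtractState s lR V N h ((t.edgeList.take j).toFinset.biUnion f ∪ S))
    ⟨hi, ht, by simpa using hs⟩ (fun j s h => h.2.1) ?_ ?_).mono (by omega) ?_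
  · rintro j s x v h1 h2 ⟨a1, ⟨b1, b2, b3⟩, a3⟩
    refine ⟨?_, ⟨?_, ?_, ?_⟩, a3.setVar (by omega) v⟩ <;>
      rw [Store.setVar_var, if_neg (by omega)] <;> assumption
  · rintro j hj s ⟨a1, ⟨b1, b2, b3⟩, a3⟩ he
    have hmem : t.edgeList[j] ∈ t.edges := by
      rw [← t.toFinset_edgeList, List.mem_toFinset]
      exact List.getElem_mem hj
    obtain ⟨v1, v2⟩ := Tri.src_tgt_mem_verts hmem
    refine (within_out a3 he (htV v1) (htV v2) ?_).mono le_rfl ?_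
    · rw [Finset.mem_union, not_or]
      refine ⟨fun hm => ?_, hdisj _ hmem⟩
      obtain ⟨e', he', hm⟩ := Finset.mem_biUnion.1 hm
      rw [← ((hf _ _).1 hm).1, List.mem_toFinset, List.mem_take_iff_getElem] at he'
      obtain ⟨m, hm, heq⟩ := he'
      have := (t.nodup_edgeList.getElem_inj_iff).1 heq
      omega
    · rintro s' ⟨c1, c2⟩
      refine ⟨(c1 30 (by simp)).trans a1, ⟨(c1 _ (by simp)).trans b1, (c1 _ (by simp)).trans b2,
        (c1 _ (by simp)).trans b3⟩, ?_⟩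
      rw [biUnion_take_succ _ _ hj, Finset.union_assoc]
      exact c2
  · rintro s' ⟨a1, -, a3⟩
    refine ⟨a1, ?_⟩
    rw [List.take_of_length_le (by simp [Tri.edgeList]), Tri.toFinset_edgeList] at a3
    convert a3 using 2
    ext e
    simp only [Finset.mem_filter, Finset.mem_biUnion, hf]
    constructor
    · rintro ⟨h1, h2⟩; exact ⟨e, h1, rfl, h2⟩
    · rintro ⟨_, h1, rfl, h2⟩; exact ⟨h1, h2⟩

theorem within_extract_ok {R : Finset Tri} (hR : lR.toFinset = R) (hnodup : lR.Nodup)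
    (hregion : StoresList s 0 0 1 2 lR) (hok : s.var okB = 1) (hN : s.var numV = N)
    (hV : Set.BijOn (vertexAt s) (Set.Ico 0 N) (regionVerts R))
    (hdist : ∀ i ∈ Set.Ico (0 : ℤ) N, s.arr distA i = h (vertexAt s i))
    (hint : ∀ e ∈ heightTiling R h, IsInterior R e) :
    extractCmd.Within s ((lR.length + 1) * (180 * N + 1400)) fun s' =>
      s'.var solvable = 1 ∧ HoldsOutput s' (heightTiling R h) := by
  subst hR
  set g : Tri → Finset Edge := fun t =>
    if t.2 = 0 then t.edges.filter (fun e => h e.tgt - h e.src ≠ 1) else ∅ with hg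
  have hmemg : ∀ e t, e ∈ g t ↔ t = e.lower ∧ h e.tgt - h e.src ≠ 1 := by
    intro e t
    simp only [hg]
    split_ifs with h0
    · rw [Finset.mem_filter, Edge.mem_edges_iff]
      constructor
      · rintro ⟨rfl | rfl, h1⟩
        · exact ⟨rfl, h1⟩
        · simp [Edge.upper] at h0
      · exact fun h1 => ⟨Or.inl h1.1, h1.2⟩
    · simp only [Finset.notMem_empty, false_iff]
      rintro ⟨rfl, -⟩
      exact h0 rfl
  unfold extractCmd
  refine Cmd.Within.le (Cmd.within_assign_seq <| Cmd.within_ite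
    (n := (lR.length + 1) * (180 * N + 1310 + 20) + 2) (fun _ => ?_) (fun hb => ?_) le_rfl) ?_
  · refine Cmd.Within.le (Cmd.within_assign_seq <| (within_forItems (l := lR)
      (m := 180 * N + 1310)
      (I := fun i s => ExtractState s lR (regionVerts lR.toFinset) N h
        ((lR.take i).toFinset.biUnion g))
      (fun i s x v hx hs => hs.setVar (by omega) v) (fun i s hs => hs.region) ?_ ?_).mono
        le_rfl ?_) (by simp only [Expr.cost]; omega)
    · refine ⟨hregion.congr ?_ (by simp), ?_, hV, hdist, ⟨?_, ?_⟩, ?_⟩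
      · simp
      · simp [hN]
      · simp [Expr.eval]
      · simp
      · simp [Expr.eval, hok]
    · intro i hi s hs ht
      refine Cmd.within_ite (n := 180 * N + 1300) (fun hb => ?_) (fun hb => ?_)
        (by simp [Expr.cost]; omega)
      · have h22 : lR[i].2 = 0 := by
          by_contra hne
          simp [Expr.eval, ht.2.2] at hb
          exact hne (Fin.ext (by simpa using hb))
        refine (within_outTriangle hs rfl ht ?_ ?_).mono le_rfl ?_
        · exact fun v hv => Finset.mem_biUnion.2 ⟨_, by simp, hv⟩
        -- A lozenge written earlier came from its own lower triangle. That would be the current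
        -- triangle at an earlier position, but the list has no repetition.
        · intro e he hm
          obtain ⟨t', ht', hm⟩ := Finset.mem_biUnion.1 hm
          have h1 := ((hmemg _ _).1 hm).1
          have h2 : lR[i] = e.lower := by
            rcases Edge.mem_edges_iff.1 he with h | h
            · exact h
            · rw [h] at h22; simp [Edge.upper] at h22
          rw [h1, ← h2, List.mem_toFinset, List.mem_take_iff_getElem] at ht'
          obtain ⟨m, hm, heq⟩ := ht'
          have := (hnodup.getElem_inj_iff).1 heq
          omega
        · rintro s' ⟨a1, a2⟩
          refine ⟨a1, ?_⟩
          rw [biUnion_take_succ _ _ hi]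
          simpa only [hg, h22, if_true] using a2
      · have h22 : lR[i].2 ≠ 0 := by
          intro hz
          simp [Expr.eval, ht.2.2, hz] at hb
        refine (Cmd.within_skip ⟨rfl, ?_⟩).le (by omega)
        rw [biUnion_take_succ _ _ hi]
        simpa only [hg, h22, if_false, Finset.empty_union] using hs
    · intro s' hs'
      refine ⟨hs'.ok, ?_⟩
      have := hs'.out
      rw [List.take_length] at this
      suffices heq : heightTiling lR.toFinset h = lR.toFinset.biUnion g by
        rw [heq]; exact this
      ext e
      simp only [Finset.mem_biUnion, hmemg]
      constructor
      · intro he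
        exact ⟨_, (isInterior_iff.1 (hint e he)).1, rfl, (Finset.mem_filter.1 he).2⟩
      · rintro ⟨t, ht, rfl, hne⟩
        exact Finset.mem_filter.2 ⟨mem_regionEdges.2 (Or.inl ht), hne⟩
  · simp [Expr.eval, hok] at hb
  · simp only [Expr.cost]
    have : (lR.length + 1) * (180 * N + 1400) =
      (lR.length + 1) * (180 * N + 1310 + 20) + 70 * (lR.length + 1) := by ring
    omega

end

/-! ### The main theorem -/

/-- The length of a walk is, modulo `3`, the difference of the colours of its ends. -/
theorem WalkLength.three_dvd {g : Store} {R : Finset Tri} {X₁ X₂ : Finset Edge}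
    (hA : arcAt g '' Set.Ico 0 (g.var numA) = dcArcs R X₁ X₂) {i d : ℤ} (h : WalkLength g i d) :
    (3 : ℤ) ∣ (vertexAt g i).1 + (vertexAt g i).2 - (vertexAt g 0).1 - (vertexAt g 0).2 - d := by
  induction h with
  | nil => simp
  | @cons a d ha _ ih =>
    have : arcAt g a ∈ dcArcs R X₁ X₂ := hA ▸ Set.mem_image_of_mem _ ha
    have := three_dvd_of_mem_dcArcs this
    omega

/-- If no arc is relaxable, the reached vertices are closed under arcs. Positive edges go round each
triangle and the region is connected, so every vertex is reached, and failure to relax is the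
potential inequality. The congruence holds because distances are lengths of walks. -/
theorem BFResult.exists_height {g s : Store} (hres : BFResult g s) {R : Finset Tri}
    {X₁ X₂ : Finset Edge} [PreconnectedSpace (carrier R)]
    (hG : HoldsGraph g (regionVerts R) (dcArcs R X₁ X₂)) (hN : 0 < g.var numV)
    (hrel : ∀ a ∈ Set.Ico 0 (g.var numA), ¬ Relaxable s a) :
    ∃ h : Vertex → ℤ, (∀ i ∈ Set.Ico 0 (g.var numV), s.arr distA i = h (vertexAt g i)) ∧
      IsPotential (dcArcs R X₁ X₂) h ∧
      ∀ e ∈ regionEdges R, (3 : ℤ) ∣ h e.tgt - h e.src - 1 := by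
  classical
  obtain ⟨hbij, hends, hA⟩ := hG
  have e1 : s.arr aSrc = g.arr aSrc := hres.frame.2 _ (by decide) (by decide)
  have e2 : s.arr aDst = g.arr aDst := hres.frame.2 _ (by decide) (by decide)
  have e3 : s.arr aWt = g.arr aWt := hres.frame.2 _ (by decide) (by decide)
  simp only [Relaxable, e1, e2, e3] at hrel
  have harc : ∀ u v w, (u, v, w) ∈ dcArcs R X₁ X₂ → ∃ a ∈ Set.Ico 0 (g.var numA),
      vertexAt g (g.arr aSrc a) = u ∧ vertexAt g (g.arr aDst a) = v ∧ g.arr aWt a = w := by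
    intro u v w h
    rw [← hA] at h
    obtain ⟨a, ha, h⟩ := h
    simp only [arcAt, Prod.mk.injEq] at h
    exact ⟨a, ha, h⟩
  let S : Set Vertex := {v | ∃ i ∈ Set.Ico 0 (g.var numV), vertexAt g i = v ∧ s.arr reachedA i ≠ 0}
  have h0 : (0 : ℤ) ∈ Set.Ico 0 (g.var numV) := ⟨le_rfl, hN⟩
  have hS : ∀ v ∈ regionVerts R, v ∈ S := by
    intro v hv
    refine regionVerts_subset_of_closed (S := S) (fun t ht => Tri.verts_closed fun e he => ?_)
      (hbij.mapsTo h0) ⟨0, h0, rfl, hres.sound.1⟩ hv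
    rintro ⟨i, hi, hiv, hri⟩
    obtain ⟨a, ha, h1, h2, -⟩ := harc e.src e.tgt 1
      (Or.inl (Or.inl ⟨e, Finset.mem_biUnion.2 ⟨t, ht, he⟩, rfl⟩))
    obtain rfl := hbij.injOn (hends a ha).1 hi (h1.trans hiv.symm)
    refine ⟨_, (hends a ha).2, h2, fun hz => hrel a ha ⟨hri, Or.inl hz⟩⟩
  have hreach : ∀ i ∈ Set.Ico 0 (g.var numV), s.arr reachedA i ≠ 0 := by
    intro i hi
    obtain ⟨j, hj, hij, hr⟩ := hS _ (hbij.mapsTo hi)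
    rwa [← hbij.injOn hj hi hij]
  -- The distance array is pulled back along the numbering; the values at vertices outside the
  -- region play no role.
  let h : Vertex → ℤ := fun v => s.arr distA (Function.invFunOn (vertexAt g)
    (Set.Ico 0 (g.var numV)) v)
  have hh : ∀ i ∈ Set.Ico 0 (g.var numV), s.arr distA i = h (vertexAt g i) := by
    intro i hi
    simp only [h, hbij.injOn.leftInvOn_invFunOn hi]
  have hcol : ∀ i ∈ Set.Ico 0 (g.var numV), (3 : ℤ) ∣ (vertexAt g i).1 + (vertexAt g i).2 -
      (vertexAt g 0).1 - (vertexAt g 0).2 - h (vertexAt g i) := by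
    intro i hi
    rw [← hh i hi]
    exact (hres.sound.2 i hi (hreach i hi)).three_dvd hA
  refine ⟨h, hh, ?_, ?_⟩
  · intro u v w huvw
    obtain ⟨a, ha, rfl, rfl, rfl⟩ := harc u v w huvw
    obtain ⟨h1, h2⟩ := hends a ha
    rw [← hh _ h1, ← hh _ h2]
    have := hrel a ha
    push Not at this
    have := (this (hreach _ h1)).2
    linarith
  · intro e he
    have hmem : (e.src, e.tgt, (1 : ℤ)) ∈ dcArcs R X₁ X₂ := Or.inl (Or.inl ⟨e, he, rfl⟩)
    have h3 := three_dvd_of_mem_dcArcs hmem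
    obtain ⟨a, ha, h1, h2, -⟩ := harc _ _ _ hmem
    have h4 := hcol _ (hends a ha).1
    have h5 := hcol _ (hends a ha).2
    rw [h1] at h4
    rw [h2] at h5
    omega

theorem HoldsGraph.numV_pos {s : Store} {V : Finset Vertex} {A : Set Arc}
    (h : HoldsGraph s V A) (hV : V.Nonempty) : 0 < s.var numV := by
  obtain ⟨v, hv⟩ := hV
  obtain ⟨i, hi, -⟩ := h.1.surjOn hv
  exact hi.1.trans_lt hi.2

theorem regionVerts_nonempty {R : Finset Tri} [Nonempty (carrier R)] :
    R.Nonempty ∧ (regionVerts R).Nonempty := by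
  obtain ⟨p, hp⟩ : Nonempty (carrier R) := inferInstance
  obtain ⟨t, ht, -⟩ := Set.mem_iUnion₂.1 hp
  exact ⟨⟨t, ht⟩, ⟨t.1, Finset.mem_biUnion.2 ⟨t, ht, by simp [Tri.verts]⟩⟩⟩

end LozengeTiling

open LozengeTiling
/-- There is a program of the form `build; bellmanFord; extract` that solves `Tiling(R, X₁, X₂)` for
every finite simply connected region in `O(|R|²)` steps, where `build` writes `DC(R, X₁, X₂)`, a
graph with `O(|R|)` directed edges, and `extract` reads the tiling off the distances. -/
theorem mainTheorem7 :
    ∃ (build extract : Cmd) (C : ℕ),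
      ∀ (R : Finset Tri) (X₁ X₂ : Finset Edge),
        SimplyConnectedSpace (carrier R) →
        X₁ ⊆ regionEdges R →
        (∀ e ∈ X₂, IsInterior R e) →
        (dcArcs R X₁ X₂).encard ≤ ((C * R.card : ℕ) : ℕ∞) ∧
        ∀ s : Store, HoldsInput s R X₁ X₂ →
          ∃ (n₁ n₂ n₃ : ℕ) (s₁ s₂ s₃ : Store),
            Run build s n₁ s₁ ∧
            HoldsGraph s₁ (regionVerts R) (dcArcs R X₁ X₂) ∧
            Run bellmanFord s₁ n₂ s₂ ∧
            Run extract s₂ n₃ s₃ ∧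
            n₁ + n₂ + n₃ ≤ C * R.card ^ 2 ∧
            ((s₂.var okB = 0 ∧ s₃.var solvable = 0 ∧ ¬ ∃ T, IsSolution R X₁ X₂ T) ∨
             (s₂.var okB = 1 ∧ s₃.var solvable = 1 ∧
              ∃ (h : Vertex → ℤ) (T : Finset Edge),
                (∀ i ∈ Set.Ico 0 (s₂.var numV), s₂.arr distA i = h (vertexAt s₂ i)) ∧
                (∀ u v w, (u, v, w) ∈ dcArcs R X₁ X₂ → h v - h u ≤ w) ∧
                (∀ e, e ∈ T ↔ e ∈ regionEdges R ∧ h e.tgt - h e.src ≠ 1) ∧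
                IsSolution R X₁ X₂ T ∧ HoldsOutput s₃ T)) := by
  refine ⟨buildCmd, extractCmd, 10000000, fun R X₁ X₂ hsc hX₁ hX₂ => ⟨?_, fun s hs => ?_⟩⟩
  · rw [← coe_dcFinset, Set.encard_coe_eq_coe_finsetCard]
    have := card_dcFinset_le hX₁ hX₂
    exact_mod_cast this.trans (by omega)
  -- Simply connected spaces are nonempty. So `R.card` is at least 1, additive constants are
  -- absorbed into the quadratic bound, and there is a vertex to serve as source.
  obtain ⟨hR, hVne⟩ := regionVerts_nonempty (R := R)
  obtain ⟨i₁, i₂, i₃⟩ := hs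
  obtain ⟨lR, hnd, hlR, hsR⟩ := i₁.exists_list
  obtain ⟨l₁, hnd₁, hl₁, hs₁⟩ := i₂.exists_list
  obtain ⟨l₂, hnd₂, hl₂, hs₂⟩ := i₃.exists_list
  have hn : lR.length = R.card := by rw [← hlR, List.toFinset_card_of_nodup hnd]
  have hn₁ : l₁.length ≤ 3 * lR.length := by
    rw [← List.toFinset_card_of_nodup hnd₁, hl₁, hn]
    exact (Finset.card_le_card hX₁).trans (card_regionEdges_le R)
  have hn₂ : l₂.length ≤ 3 * lR.length := by
    rw [← List.toFinset_card_of_nodup hnd₂, hl₂, hn]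
    exact (Finset.card_le_card fun e he => (hX₂ e he).mem_regionEdges).trans
      (card_regionEdges_le R)
  have hpos := hR.card_pos
  obtain ⟨n₁, s₁, hn₁, hrun₁, hI, hG, ⟨N, hN, hNle⟩, ⟨M, hM, hMle⟩⟩ :=
    within_build ⟨hsR, hs₁, hs₂⟩ hn₁ hn₂
  rw [hlR, hl₁, hl₂, coe_dcFinset, endpoints_dcFinset hX₁ hX₂] at hG
  have hNpos := hG.numV_pos hVne
  obtain ⟨n₂, s₂, hn₂, hrun₂, hres⟩ := within_bellmanFord hN hM (by omega)
    fun a ha => (hG.2.1 a ha).1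
  rw [hn] at hn₁ hNle hMle
  set n := R.card with hncard
  have hva : vertexAt s₂ = vertexAt s₁ := by
    funext i
    simp only [vertexAt, hres.frame.2 vx (by decide) (by decide),
      hres.frame.2 vy (by decide) (by decide)]
  have hN₂ : s₂.var numV = N := by
    rw [hres.frame.1 numV (by decide) (by decide) (by decide), hN]
  have c₁ : n₁ ≤ 2000000 * n ^ 2 := by
    have : (n + 1) ^ 2 ≤ (2 * n) ^ 2 := Nat.pow_le_pow_left (by omega) 2
    nlinarith
  have c₂ : n₂ ≤ 1000000 * n ^ 2 := by
    -- From `N ≤ 36 * n`, two ends for each of at most `18 * n` listed arcs, and `M ≤ 18 * n`, with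
    -- `1 ≤ n`.
    have : (N + 1) * (M + 1) ≤ (37 * n) * (19 * n) := Nat.mul_le_mul (by omega) (by omega)
    nlinarith
  have hcost : ∀ n₃, n₃ ≤ 100000 * n ^ 2 → n₁ + n₂ + n₃ ≤ 10000000 * n ^ 2 := by
    intro n₃ h; omega
  rcases hres.ok with ⟨hok, hrel⟩ | ⟨hok, a, ha, hrel⟩
  · obtain ⟨h, hdist, hpot, h3⟩ := hres.exists_height hG hNpos hrel
    have hsol := hpot.isSolution_heightTiling hX₂ h3
    have hG' := hG.1
    rw [hN, ← hva] at hG'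
    rw [hN, ← hva] at hdist
    obtain ⟨n₃, s₃, hn₃, hrun₃, hsolv, hout⟩ := within_extract_ok hlR hnd
      (hI.region.congr (hres.frame.1 0 (by decide) (by decide) (by decide)) fun i _ =>
        ⟨by rw [hres.frame.2 0 (by decide) (by decide)],
          by rw [hres.frame.2 1 (by decide) (by decide)],
          by rw [hres.frame.2 2 (by decide) (by decide)]⟩)
      hok hN₂ hG' hdist fun e he t het => hsol.1.1 e he t het
    refine ⟨n₁, n₂, n₃, s₁, s₂, s₃, hrun₁, hG, hrun₂, hrun₃, hcost n₃ ?_, Or.inr ⟨hok, hsolv,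
      h, _, by rwa [hN₂], hpot, fun e => Finset.mem_filter, hsol, hout⟩⟩
    rw [hn] at hn₃
    have : (n + 1) * (180 * N + 1400) ≤ (2 * n) * (10000 * n) :=
      Nat.mul_le_mul (by omega) (by omega)
    nlinarith
  · obtain ⟨n₃, s₃, hn₃, hrun₃, hsolv⟩ := within_extract_fail hok
    refine ⟨n₁, n₂, n₃, s₁, s₂, s₃, hrun₁, hG, hrun₂, hrun₃, hcost n₃ ?_, Or.inl ⟨hok, hsolv, ?_⟩⟩
    · nlinarith
    · rintro ⟨T, hT⟩
      obtain ⟨h, hpot⟩ := hT.exists_potential hX₁ hX₂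
      -- The height of a hypothetical solution, read on vertex numbers, is a potential, which
      -- contradicts the arc that is still relaxable.
      refine hres.not_relaxable hNpos hG.2.1 (H := fun i => h (vertexAt s₁ i)) ?_ ha hrel
      intro a ha
      exact hpot _ _ _ (hG.2.2 ▸ Set.mem_image_of_mem _ ha)
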